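/- **Setting.** Let $\mathbb F_q$ be a finite field with $q$ elements and $0\le k'\le n$, $k=n-k'$. An instance of the short codeword problem $\mathrm{SCP}(q,n,k',\omega')$, $\omega'\in(0,1)$, is a uniformly random matrix $\mathbf H\in\mathbb F_q^{k\times n}$; a solution is a vector $\mathbf z\in\mathbb F_q^n\setminus\{\mathbf 0\}$ with $\mathbf H\mathbf z^{\top}=\mathbf 0$ and Hamming weight $|\mathbf z|\le\omega' n$. For $x\in[0,1]$ put $x^\perp=\frac1q\big(\sqrt{(q-1)(1-x)}-\sqrt x\big)^2$. Write $\chi_y(x)=e^{2\pi i\,\mathrm{tr}(xy)/p}$, with $p$ the characteristic of $\mathbb F_q$ and $\mathrm{tr}$ the trace to $\mathbb F_p$; for vectors $\chi_{\mathbf y}(\mathbf x)=\prod_i\chi_{y_i}(x_i)$. The quantum Fourier transform is $|\mathbf x\rangle\mapsto q^{-m/2}\sum_{\mathbf y\in\mathbb F_q^m}\chi_{\mathbf x}(\mathbf y)|\mathbf y\rangle$, and $|\hat 0\rangle=q^{-1/2}\sum_{x\in\mathbb F_q}|x\rangle$. **The algorithm** (Regev's reduction with coherent $q$-ary unambiguous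 state discrimination, USD). Input: $\mathbf H\in\mathbb F_q^{k\times n}$, and a noise rate $\omega\in[0,\frac{q-1}q]$. Let $\mathcal C$ be the row space of $\mathbf H$, and let $f(\mathbf e)=\big(\tfrac{\omega}{q-1}\big)^{|\mathbf e|/2}(1-\omega)^{(n-|\mathbf e|)/2}$. 1. Prepare $|\mathcal C|^{-1/2}\sum_{\mathbf c\in\mathcal C}\sum_{\mathbf e}f(\mathbf e)|\mathbf c\rangle|\mathbf e\rangle$ and add the first register to the second one. 2. Append a flag $|0\rangle$ to each of the $n$ symbols of the second register and apply to each pair (symbol, flag) the unitary $U=I+|\hat 0\rangle\langle\hat 0|\otimes(\mathcal R-I)$, where $\mathcal R$ is the rotation $|0\rangle\mapsto u|0\rangle+\sqrt{1-u^2}|1\rangle$, $|1\rangle\mapsto-\sqrt{1-u^2}|0\rangle+u|1\rangle$ and $u^2=\frac{\omega^\perp}{(1-\omega^\perp)(q-1)}$. 3. Measure the flags; let $J$ be the set of positions with flag $0$. If the submatrix $\mathbf H_J$ of the columns in $J$ has rank less than $k$, fail (output $\mathbf 0$). 4. Otherwise choose $\mathbf M$ with $\mathbf H_J\mathbf M=\mathbf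 I$ and erase the codeword register by $|\mathbf c\rangle|\mathbf x\rangle\mapsto|\mathbf c-\mathbf x_J\mathbf M\mathbf H\rangle|\mathbf x\rangle$. 5. Apply the quantum Fourier transform to the positions in $J$ of the second register, measure, and output the vector that agrees with the outcome on $J$ and is $0$ outside $J$. **Machine model.** A program controls a classical memory, made of integer counters (which can be reset, copied, incremented, decremented and compared) and arrays of elements of $\mathbb F_q$ (field operations, zero test), and a quantum memory made of $q$-level systems addressed by counters. Its quantum operations are: the quantum Fourier transform of one cell; a reflection of one cell that exchanges $|0\rangle$ and $\sqrt{1-\omega}\,|0\rangle+\sqrt{\omega/(q-1)}\sum_{\alpha\ne0}|\alpha\rangle$; $|x\rangle|y\rangle\mapsto|x\rangle|y+ax\rangle$ with $a$ a classical cell; the rotation $\mathcal R$ on the levels $|0\rangle,|1\rangle$ of one cell, controlled by another cell being $|0\rangle$; measurement of one cell. Control flow: sequences, conditionals, for-loops. Each operation, each test, each loop entry and each loop iteration takes one step. **Theorem.** There are a single program and a polynomial $P$, both independent of $q,n,k',\omega,\omega'$, such that: (i) for all $q$, all $\omega\in[0,\frac{q-1}q]$, all $0\le k\le n$ and all $\mathbf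 H\in\mathbb F_q^{k\times n}$, the program halts within $P(n)$ steps for all measurement outcomes, and its output distribution is exactly that of the algorithm above (which is a probability distribution); (ii) for all $\omega'\in(0,1)$ and $\delta>0$ there are $c>0$ and $N$, depending only on $\omega'$ and $\delta$, such that for all $q$, all $n\ge N$ and all $0\le k'\le n$ with $$\tau\;\ge\;\frac{(q-1)(n-k')}{q\,n}+\delta,\qquad \tau:=\min\Big(\omega',\frac{q-1}q\Big),$$ the program, run with $\omega=\tau^\perp$, outputs a solution of $\mathrm{SCP}(q,n,k',\omega')$ with probability at least $c$ over the random matrix $\mathbf H$ and the measurements. In particular, for fixed $q$, fixed rate $k'/n\to R'>0$ and fixed $\omega'\in(0,1)$ with $\omega'>\frac{(q-1)(1-R')}{q}$ (Prange's bound), $\mathrm{SCP}(q,n,k',\omega')$ is solved in quantum polynomial time with probability $\Theta(1)$. -/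

import Mathlib

open scoped Matrix

noncomputable section

namespace RegevUSD

universe u

/-! ### Characters, Fourier transform, noise -/

section Basic

variable (F : Type u) [Field F] [Fintype F]

/-- The additive character `a ↦ exp (2 π i tr(a) / p)` of `F`, where `p` is the characteristic of
`F` and `tr : F → ZMod p` is the absolute trace. -/
def traceChar (a : F) : ℂ :=
  haveI : Fact (ringChar F).Prime := ⟨CharP.char_is_prime F (ringChar F)⟩
  letI : Algebra (ZMod (ringChar F)) F := ZMod.algebra F (ringChar F)
  ZMod.stdAddChar (Algebra.trace (ZMod (ringChar F)) F a)

/-- `x^⊥ = (√((q-1)(1-x)) - √x)² / q`, where `q = |F|`. -/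
def perp (x : ℝ) : ℝ :=
  (√(((Fintype.card F : ℝ) - 1) * (1 - x)) - √x) ^ 2 / (Fintype.card F : ℝ)

variable {F}

/-- The characters `χ_y(x) = exp (2 π i tr(x y) / p)` of `F`. -/
def chi (y x : F) : ℂ := traceChar F (x * y)

variable [DecidableEq F]

/-- Amplitudes of `|ψ⟩ = √(1-ω) |0⟩ + ∑_{α ≠ 0} √(ω/(q-1)) |α⟩`. -/
def noiseAmp (ω : ℝ) (e : F) : ℝ :=
  if e = 0 then √(1 - ω) else √(ω / ((Fintype.card F : ℝ) - 1))

variable (F) in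
/-- `u = √(ω^⊥ / ((1 - ω^⊥)(q-1)))`. -/
def usdCos (ω : ℝ) : ℝ :=
  √(perp F ω / ((1 - perp F ω) * ((Fintype.card F : ℝ) - 1)))

/-- The rotation `|0⟩ ↦ u |0⟩ + √(1-u²) |1⟩`, `|1⟩ ↦ -√(1-u²) |0⟩ + u |1⟩`
(entry `R b' b = ⟨b'| R |b⟩`). -/
def rot (u : ℝ) : Matrix (Fin 2) (Fin 2) ℝ :=
  !![u, -√(1 - u ^ 2); √(1 - u ^ 2), u]

/-- The unitary `U` of coherent unambiguous state discrimination, on `ℂ^F ⊗ ℂ²`: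
it rotates the flag by `rot u` when the first register is in the state
`|0̂⟩ = q^{-1/2} ∑_x |x⟩`, and is the identity when the first register is orthogonal to `|0̂⟩`; that
is, `U = I + |0̂⟩⟨0̂| ⊗ (R - I)`.  Flag value `0` means success, flag value `1` means failure. -/
def usd (ω : ℝ) : Matrix (F × Fin 2) (F × Fin 2) ℂ := fun y x =>
  (if y = x then 1 else 0) +
    ((1 / (Fintype.card F : ℝ) *
      (rot (usdCos F ω) y.2 x.2 - (if y.2 = x.2 then 1 else 0)) : ℝ) : ℂ)

end Basic

/-! ### The reduction, as a sequence of quantum states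

A state is given by its amplitudes in the computational basis.  `G` is a `k × n` matrix, the code
is its row space, `ω` is the noise rate. -/

section Algorithm

variable {F : Type u} [Field F] [Fintype F] [DecidableEq F] {n k : ℕ}

/-- The code `{m G : m ∈ F^k}`. -/
def code (G : Matrix (Fin k) (Fin n) F) : Submodule F (Fin n → F) :=
  LinearMap.range (Matrix.vecMulLinear G)

open scoped Classical in
/-- Initial state `|C|^{-1/2} ∑_{c ∈ C} ∑_e f(e) |c⟩|e⟩`, with `f(e) = ∏ᵢ noiseAmp ω (eᵢ)`. -/
def omega0 (ω : ℝ) (G : Matrix (Fin k) (Fin n) F) (c e : Fin n → F) : ℂ :=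
  if c ∈ code G then (((1 / √(Nat.card (code G) : ℝ)) * ∏ i, noiseAmp ω (e i) : ℝ) : ℂ) else 0

/-- Adding the first register to the second one: `|c⟩|e⟩ ↦ |c⟩|c + e⟩`. -/
def omega1 (ω : ℝ) (G : Matrix (Fin k) (Fin n) F) (c x : Fin n → F) : ℂ :=
  omega0 ω G c (x - c)

/-- Coherent USD: append to every position a flag `|0⟩` and apply `U` to each of the `n` pairs
(symbol, flag). -/
def omega2 (ω : ℝ) (G : Matrix (Fin k) (Fin n) F) (c x : Fin n → F) (b : Fin n → Fin 2) : ℂ :=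
  ∑ x' : Fin n → F, (∏ i, usd ω (x i, b i) (x' i, 0)) * omega1 ω G c x'

/-- Measuring the flags and finding that the set of successful positions is `J`; the state is left
unnormalised, so that its squared norm is the probability of `J`. -/
def omega4 (ω : ℝ) (G : Matrix (Fin k) (Fin n) F) (J : Finset (Fin n)) (c x : Fin n → F) : ℂ :=
  omega2 ω G c x (fun i => if i ∈ J then 0 else 1)

/-- The submatrix `G_J` of the columns in `J`. -/
def cols (G : Matrix (Fin k) (Fin n) F) (J : Finset (Fin n)) : Matrix (Fin k) J F :=
  G.submatrix id (fun j => (j : Fin n))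

open scoped Classical in
/-- A pseudo-inverse of `G_J`: a matrix `M` with `G_J M = 1` (if there is one). -/
def pinv (G : Matrix (Fin k) (Fin n) F) (J : Finset (Fin n)) : Matrix J (Fin k) F :=
  if h : ∃ M : Matrix J (Fin k) F, cols G J * M = 1 then h.choose else 0

/-- Decoding `c` from its punctured part `v = c_J`: `v ↦ v G_J⁻¹ G`. -/
def decode (G : Matrix (Fin k) (Fin n) F) (J : Finset (Fin n)) (v : J → F) : Fin n → F :=
  (v ᵥ* pinv G J) ᵥ* G

/-- Erasing the codeword register by coherent decoding: `|c⟩|x⟩ ↦ |c - decode(x_J)⟩|x⟩`. -/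
def omega5 (ω : ℝ) (G : Matrix (Fin k) (Fin n) F) (J : Finset (Fin n)) (c x : Fin n → F) : ℂ :=
  omega4 ω G J (c + decode G J (fun j => x j)) x

/-- The quantum Fourier transform on the positions in `J` of the second register. -/
def omega6 (ω : ℝ) (G : Matrix (Fin k) (Fin n) F) (J : Finset (Fin n)) (c x : Fin n → F) : ℂ :=
  (1 / (√((Fintype.card F : ℝ) ^ J.card) : ℝ) : ℂ) *
    ∑ v : J → F, (∏ j : J, chi (x j) (v j)) *
      omega5 ω G J c (fun i => if h : i ∈ J then v ⟨i, h⟩ else x i)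

/-- The word that agrees with `x` on `J` and is zero outside `J`. -/
def extendZero (J : Finset (Fin n)) (x : Fin n → F) : Fin n → F :=
  fun i => if i ∈ J then x i else 0

/-- Probability that the reduction outputs `z`.  The flags are measured, giving `J`.  If `G_J` has
rank `k`, the codeword register is erased, the Fourier transform is applied on `J`, everything is
measured, and the outcome on `J`, extended by zero, is the output.  Otherwise the algorithm fails,
which is represented by the output `0`. -/
def outputLaw (ω : ℝ) (G : Matrix (Fin k) (Fin n) F) (z : Fin n → F) : ℝ :=
  ∑ J : Finset (Fin n),
    if (cols G J).rank = k then
      ∑ c : Fin n → F, ∑ x : Fin n → F,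
        if extendZero J x = z then ‖omega6 ω G J c x‖ ^ 2 else 0
    else
      if z = 0 then ∑ c : Fin n → F, ∑ x : Fin n → F, ‖omega4 ω G J c x‖ ^ 2 else 0

end Algorithm

/-! ### The machine: a RAM controlling a quantum memory

Classical memory: counters `var x : ℕ`, and cells `mem a i j : F`, arranged in arrays named by `a`.
Quantum memory: `|F|`-level systems at addresses `(a, i)`.  Arrays are addressed through counters.
Every operation takes one step and touches a bounded number of counters and cells; counters can only
be reset, copied, incremented, decremented, so that they stay below (input length + time). -/

/-- The classical cell `mem arr (var row) (var col)`. -/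
structure CLoc where
  arr : ℕ
  row : ℕ
  col : ℕ

/-- The quantum cell with address `(arr, var idx)`. -/
structure QLoc where
  arr : ℕ
  idx : ℕ

/-- Programs.  They mention neither the field nor the input. -/
inductive Cmd : Type
  /-- do nothing -/
  | skip
  /-- `var x := 0` -/
  | zero (x : ℕ)
  /-- `var x := var y` -/
  | copy (x y : ℕ)
  /-- `var x := var x + 1` -/
  | succ (x : ℕ)
  /-- `var x := var x - 1` (truncated) -/
  | pred (x : ℕ)
  /-- `a := 0` in `F` -/
  | fzero (a : CLoc)
  /-- `a := 1` in `F` -/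
  | fone (a : CLoc)
  /-- `a := b + c` in `F` -/
  | fadd (a b c : CLoc)
  /-- `a := -b` in `F` -/
  | fneg (a b : CLoc)
  /-- `a := b * c` in `F` -/
  | fmul (a b c : CLoc)
  /-- `a := b⁻¹` in `F` (with `0⁻¹ = 0`) -/
  | finv (a b : CLoc)
  /-- quantum Fourier transform over `F` of one quantum cell -/
  | qft (l : QLoc)
  /-- noise gate: a reflection that exchanges `|0⟩` and `√(1-ω)|0⟩ + ∑_{α≠0} √(ω/(q-1))|α⟩` -/
  | noise (l : QLoc)
  /-- `|x⟩|y⟩ ↦ |x⟩|y + a x⟩`, with `a` a classical cell -/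
  | cadd (a : CLoc) (l r : QLoc)
  /-- rotation of the levels `|0⟩`, `|1⟩` of `r`, controlled by `l` being `|0⟩` -/
  | crot (l r : QLoc)
  /-- measure a quantum cell in the computational basis and write the outcome in `a` -/
  | meas (a : CLoc) (l : QLoc)
  /-- sequence -/
  | seq (c d : Cmd)
  /-- if the classical cell `a` is zero then `c` else `d` -/
  | ifZero (a : CLoc) (c d : Cmd)
  /-- if `var x < var y` then `c` else `d` -/
  | ifLt (x y : ℕ) (c d : Cmd)
  /-- for `var x` from `0` to `var y - 1` (bound evaluated on entry) do `c` -/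
  | loop (x y : ℕ) (c : Cmd)

/-- A configuration: number of steps so far, counters, classical cells, and an unnormalised quantum
state, a finite combination of basis states, each of which assigns a symbol to every address.
The squared norm of the quantum state is the probability of the branch. -/
structure Cfg (F : Type u) where
  time : ℕ
  var : ℕ → ℕ
  mem : ℕ → ℕ → ℕ → F
  ket : (ℕ × ℕ → F) →₀ ℂ

section Machine

variable {F : Type u} [Field F] [Fintype F] [DecidableEq F]

/-- Apply a one-cell gate with matrix entries `M y x = ⟨y| M |x⟩` to the cell `l`. -/
def gate1 (M : Matrix F F ℂ) (l : ℕ × ℕ) (ψ : (ℕ × ℕ → F) →₀ ℂ) : (ℕ × ℕ → F) →₀ ℂ :=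
  ψ.sum fun v a => ∑ y : F, Finsupp.single (Function.update v l y) (M y (v l) * a)

/-- Apply a two-cell gate to distinct cells `l`, `r` (nothing happens if `l = r`). -/
def gate2 (M : Matrix (F × F) (F × F) ℂ) (l r : ℕ × ℕ) (ψ : (ℕ × ℕ → F) →₀ ℂ) :
    (ℕ × ℕ → F) →₀ ℂ :=
  if l = r then ψ else
    ψ.sum fun v a => ∑ y : F × F,
      Finsupp.single (Function.update (Function.update v l y.1) r y.2) (M y (v l, v r) * a)

variable (F) in
/-- Matrix of the Fourier transform over `F`: `|x⟩ ↦ q^{-1/2} ∑_y χ_x(y) |y⟩`. -/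
def qftMatrix : Matrix F F ℂ := fun y x => (1 / (√(Fintype.card F : ℝ) : ℝ) : ℂ) * chi x y

variable (F) in
/-- The reflection `I - 2 |v⟩⟨v| / ⟨v|v⟩` with `|v⟩ = |0⟩ - |ψ⟩`, `|ψ⟩` having the amplitudes
`noiseAmp ω` (the identity if `v = 0`). -/
def noiseMatrix (ω : ℝ) : Matrix F F ℂ :=
  let v : F → ℝ := fun x => (if x = 0 then 1 else 0) - noiseAmp ω x
  fun y x => (((if y = x then 1 else 0) - 2 / (∑ t, v t ^ 2) * (v y * v x) : ℝ) : ℂ)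

/-- Matrix of `|x⟩|y⟩ ↦ |x⟩|y + a x⟩`. -/
def caddMatrix (a : F) : Matrix (F × F) (F × F) ℂ := fun y x =>
  if y = (x.1, x.2 + a * x.1) then 1 else 0

variable (F) in
/-- `rot u` on the levels `|0⟩`, `|1⟩` of a cell, identity on the other levels. -/
def rotLevels (u : ℝ) : Matrix F F ℝ := fun y x =>
  if x = 0 then (if y = 0 then rot u 0 0 else if y = 1 then rot u 1 0 else 0)
  else if x = 1 then (if y = 0 then rot u 0 1 else if y = 1 then rot u 1 1 else 0)
  else if y = x then 1 else 0

variable (F) in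
/-- Matrix of `rotLevels u` on the second cell, controlled by the first cell being `|0⟩`, where
`u = usdCos F ω`. -/
def crotMatrix (ω : ℝ) : Matrix (F × F) (F × F) ℂ := fun y x =>
  if y.1 = x.1 then
    (if x.1 = 0 then ((rotLevels F (usdCos F ω) y.2 x.2 : ℝ) : ℂ) else if y.2 = x.2 then 1 else 0)
  else 0

namespace Cfg

/-- One more step. -/
def tick (s : Cfg F) : Cfg F := { s with time := s.time + 1 }

/-- One step, which sets a counter. -/
def setVar (s : Cfg F) (x m : ℕ) : Cfg F :=
  { s.tick with var := Function.update s.var x m }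

/-- Read a classical cell. -/
def get (s : Cfg F) (a : CLoc) : F := s.mem a.arr (s.var a.row) (s.var a.col)

/-- One step, which sets a classical cell. -/
def set (s : Cfg F) (a : CLoc) (v : F) : Cfg F :=
  { s.tick with
    mem := fun b i j => if b = a.arr ∧ i = s.var a.row ∧ j = s.var a.col then v else s.mem b i j }

/-- Address of a quantum cell. -/
def addr (s : Cfg F) (l : QLoc) : ℕ × ℕ := (l.arr, s.var l.idx)

/-- One step, which replaces the quantum state. -/
def setKet (s : Cfg F) (ψ : (ℕ × ℕ → F) →₀ ℂ) : Cfg F := { s.tick with ket := ψ }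

/-- Probability of the branch. -/
def weight (s : Cfg F) : ℝ := s.ket.sum fun _ a => ‖a‖ ^ 2

end Cfg

/-- Run `body` for `var x = 0, …, m - 1`; every iteration takes one step for the loop counter. -/
def iter (body : Cfg F → Multiset (Cfg F)) (x : ℕ) : ℕ → Cfg F → Multiset (Cfg F)
  | 0, s => {s}
  | m + 1, s => (iter body x m s).bind fun t => body (t.setVar x m)

/-- The final configurations of a program, one for every sequence of measurement outcomes; `ω` is the
parameter of the gates `noise` and `crot`. -/
def run (ω : ℝ) : Cmd → Cfg F → Multiset (Cfg F)
  | .skip, s => {s.tick}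
  | .zero x, s => {s.setVar x 0}
  | .copy x y, s => {s.setVar x (s.var y)}
  | .succ x, s => {s.setVar x (s.var x + 1)}
  | .pred x, s => {s.setVar x (s.var x - 1)}
  | .fzero a, s => {s.set a 0}
  | .fone a, s => {s.set a 1}
  | .fadd a b c, s => {s.set a (s.get b + s.get c)}
  | .fneg a b, s => {s.set a (-s.get b)}
  | .fmul a b c, s => {s.set a (s.get b * s.get c)}
  | .finv a b, s => {s.set a (s.get b)⁻¹}
  | .qft l, s => {s.setKet (gate1 (qftMatrix F) (s.addr l) s.ket)}
  | .noise l, s => {s.setKet (gate1 (noiseMatrix F ω) (s.addr l) s.ket)}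
  | .cadd a l r, s => {s.setKet (gate2 (caddMatrix (s.get a)) (s.addr l) (s.addr r) s.ket)}
  | .crot l r, s => {s.setKet (gate2 (crotMatrix F ω) (s.addr l) (s.addr r) s.ket)}
  | .meas a l, s => (Finset.univ : Finset F).val.map fun v =>
      { s.set a v with ket := s.ket.filter fun w => w (s.addr l) = v }
  | .seq c d, s => (run ω c s).bind (run ω d)
  | .ifZero a c d, s => if s.get a = 0 then run ω c s.tick else run ω d s.tick
  | .ifLt x y c d, s => if s.var x < s.var y then run ω c s.tick else run ω d s.tick
  | .loop x y c, s => iter (run ω c) x (s.var y) s.tick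

variable {n k : ℕ}

/-- Initial configuration on input `n`, `k` (counters `0` and `1`) and the matrix `H` (array `0`);
everything else is zero and all quantum cells are in the state `|0⟩`. -/
def initCfg (H : Matrix (Fin k) (Fin n) F) : Cfg F where
  time := 0
  var := fun x => if x = 0 then n else if x = 1 then k else 0
  mem := fun a i j =>
    if h : a = 0 ∧ i < k ∧ j < n then H ⟨i, h.2.1⟩ ⟨j, h.2.2⟩ else 0
  ket := Finsupp.single (fun _ => 0) 1

/-- The output is row `0` of array `1`. -/
def output (n : ℕ) (s : Cfg F) : Fin n → F := fun i => s.mem 1 0 i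

/-- Probability that the program outputs `z` on input `H`. -/
def outProb (ω : ℝ) (prog : Cmd) (H : Matrix (Fin k) (Fin n) F) (z : Fin n → F) : ℝ :=
  ((run ω prog (initCfg H)).map fun s => if output n s = z then s.weight else 0).sum

/-- On input `H` the program halts within `T` steps, whatever the measurement outcomes. -/
def HaltsWithin (ω : ℝ) (prog : Cmd) (H : Matrix (Fin k) (Fin n) F) (T : ℕ) : Prop :=
  ∀ s ∈ run ω prog (initCfg H), s.time ≤ T

/-! ### The short codeword problem -/

/-- `z` is a solution of the instance `H`: a nonzero word of weight at most `w n` in the code with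
parity-check matrix `H`. -/
def IsShortCodeword (w : ℝ) (H : Matrix (Fin k) (Fin n) F) (z : Fin n → F) : Prop :=
  z ≠ 0 ∧ H *ᵥ z = 0 ∧ (hammingNorm z : ℝ) ≤ w * n

variable (F) in
open scoped Classical in
/-- Success probability of a program for `SCP(q, n, k', w)`, over a uniformly random parity-check
matrix `H ∈ F^{(n-k') × n}` and the measurements. -/
def scpSuccess (ω : ℝ) (prog : Cmd) (n k' : ℕ) (w : ℝ) : ℝ :=
  (∑ H : Matrix (Fin (n - k')) (Fin n) F,
      ∑ z : Fin n → F, if IsShortCodeword w H z then outProb ω prog H z else 0) /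
    (Fintype.card (Matrix (Fin (n - k')) (Fin n) F) : ℝ)

end Machine

end RegevUSD

end

noncomputable section

namespace RegevUSD

universe u

set_option linter.unusedSectionVars false

/-! ### Additive characters -/

section Characters

variable (F : Type u) [Field F] [Fintype F]

/-! Write `p = q ω^⊥ / (q - 1)` (`usdProb`). The Fourier transform of the noise state shifted by a
symbol `c` has modulus `√(1 - ω^⊥)` at frequency zero and the common smaller modulus `dualAmp` at
all others, with the phases of `χ_c`. The rotation lowers the amplitude at frequency zero to
`dualAmp`. On flag `0` the result is therefore `√p` times the exact Fourier transform of `|c⟩`; on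
flag `1` only frequency zero survives, with no trace of `c`. Hence each position is independently
either read off perfectly, with probability `p`, or lost (`sum_usd_zero`, `sum_usd_one`).

Let `J` be the set of surviving positions. If `H_J` has rank `k`, the codeword is a function of its
restriction to `J`, so its register can be erased. What remains on `J` is the uniform superposition
of the row space of `H_J`, and its Fourier transform is the uniform superposition of the kernel of
`H_J`. So, given `J`, the output is uniform among the words supported in `J` with zero syndrome, and
the output law is the average of `condLaw` over a random set `J` with inclusion probability `p`
(`outputLaw_eq`).

The program stores a message `t` in place of the codeword `t H`. If `H` is rank deficient this is a
different state, but then every `H_J` is rank deficient too and both procedures output zero. Lost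
columns are cleared in the classical matrix. Gauss-Jordan elimination is carried out together with
the inverse substitution on the messages, which leaves the words unchanged (`cadd_codeKet`). It ends
with a right inverse, used to erase the message, or with a left dependency of the rows. Once the
message is erased, the amplitudes of different messages interfere, and the resulting character sum
is exactly `condLaw` (`sum_prod_symAmp`, `expect_elim`). Summation over all flag vectors gives
`outProb_regevProg`. The time bound holds because the program never increments a counter: all
counters, hence all loop lengths, stay at most `n` (`run_time_le`).

For the success probability the average over `H` is taken first, with `J` and a word `z` fixed. If
`z ≠ 0` is supported in `J` and `|J| ≥ k + 2`, a union bound shows that, among the `H` with `H z =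
0`, at least half have `H_J` of full rank (`card_le_card_rank_eq`). Up to a factor `2` the pair `(J,
z)` thus behaves as `n` independent symbols, each lost with probability `1 - p` and uniform
otherwise (`le_scpSuccess_regevProg`). Since `⊥` is an involution on `[0, (q-1)/q]`, the choice `ω =
τ^⊥` makes a symbol nonzero with probability exactly `τ`, while `n p ≥ n - k' + δ n`. It remains to
show that a binomial variable is at most its mean `n τ ≤ ω' n` with probability bounded below,
uniformly in `q`. This follows from a quartic lower bound for the indicator of a half-line and the
first four moments; Chebyshev's inequality excludes `z = 0` and a too small `J`
(`sum_prod_weight_event_ge`). -/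

/-- `traceChar` as an additive character. -/
def traceAddChar : AddChar F ℂ :=
  haveI : Fact (ringChar F).Prime := ⟨CharP.char_is_prime F (ringChar F)⟩
  letI : Algebra (ZMod (ringChar F)) F := ZMod.algebra F (ringChar F)
  (ZMod.stdAddChar (N := ringChar F)).compAddMonoidHom
    (Algebra.trace (ZMod (ringChar F)) F).toAddMonoidHom

theorem traceAddChar_apply (a : F) : traceAddChar F a = traceChar F a := rfl

/-- Over a field a nontrivial character is primitive. It is nontrivial because the trace form is
nondegenerate and the standard character of `ZMod p` is faithful. -/
theorem isPrimitive_traceAddChar : (traceAddChar F).IsPrimitive := by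
  have : Fact (ringChar F).Prime := ⟨CharP.char_is_prime F (ringChar F)⟩
  let : Algebra (ZMod (ringChar F)) F := ZMod.algebra F (ringChar F)
  apply AddChar.IsPrimitive.of_ne_one
  obtain ⟨a, ha⟩ := FiniteField.trace_to_zmod_nondegenerate F one_ne_zero
  rw [one_mul] at ha
  refine AddChar.ne_one_iff.2 ⟨a, fun hf => ha ?_⟩
  exact ((ZMod.isPrimitive_stdAddChar _).zmod_char_eq_one_iff _ _).mp hf

variable {F}

@[simp] theorem traceChar_zero : traceChar F 0 = 1 := (traceAddChar F).map_zero_eq_one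

theorem traceChar_add (a b : F) : traceChar F (a + b) = traceChar F a * traceChar F b :=
  (traceAddChar F).map_add_eq_mul a b

theorem traceChar_sum {ι : Type*} (s : Finset ι) (f : ι → F) :
    traceChar F (∑ i ∈ s, f i) = ∏ i ∈ s, traceChar F (f i) := by
  classical
  induction s using Finset.induction_on with
  | empty => simp
  | insert a s ha ih => rw [Finset.sum_insert ha, Finset.prod_insert ha, traceChar_add, ih]

variable [DecidableEq F]

theorem sum_traceChar_mul (a : F) :
    ∑ x : F, traceChar F (x * a) = if a = 0 then (Fintype.card F : ℂ) else 0 := by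
  simpa [traceAddChar_apply] using AddChar.sum_mulShift a (isPrimitive_traceAddChar F)

/-- Orthogonality of characters, one coordinate at a time. Applied to a sum over messages, it is
what forces the measured word to have zero syndrome. -/
theorem sum_traceChar_dotProduct {ι : Type*} [Fintype ι] [DecidableEq ι] (w : ι → F) :
    ∑ m : ι → F, traceChar F (m ⬝ᵥ w) =
      if w = 0 then (Fintype.card F : ℂ) ^ Fintype.card ι else 0 := by
  simp only [dotProduct, traceChar_sum]
  rw [← Fintype.prod_sum (fun i x => traceChar F (x * w i))]
  simp only [sum_traceChar_mul]
  split_ifs with h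
  · subst h; simp
  · obtain ⟨i, hi⟩ := Function.ne_iff.mp h
    exact Finset.prod_eq_zero (Finset.mem_univ i) (by simpa using hi)

end Characters

/-! ### Amplitudes -/

section Amplitudes

variable (F : Type u) [Field F] [Fintype F]

theorem one_lt_card_real : (1 : ℝ) < Fintype.card F := by
  exact_mod_cast Fintype.one_lt_card

/-- The amplitude `√(ω^⊥/(q-1))` of the Fourier transform of the noise at nonzero symbols. -/
def dualAmp (ω : ℝ) : ℝ := √(perp F ω / ((Fintype.card F : ℝ) - 1))

/-- The probability that unambiguous state discrimination succeeds. -/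
def usdProb (ω : ℝ) : ℝ := Fintype.card F * perp F ω / ((Fintype.card F : ℝ) - 1)

theorem perp_nonneg (ω : ℝ) : 0 ≤ perp F ω := by
  unfold perp; positivity

variable {F}

variable {ω : ℝ}

theorem lt_one_of_le_card (h1 : ω ≤ ((Fintype.card F : ℝ) - 1) / Fintype.card F) : ω < 1 := by
  have hq := one_lt_card_real F
  refine lt_of_le_of_lt h1 ?_
  rw [div_lt_one (by linarith)]; linarith

theorem sqrt_le_sqrt_dual (h1 : ω ≤ ((Fintype.card F : ℝ) - 1) / Fintype.card F) :
    √ω ≤ √(((Fintype.card F : ℝ) - 1) * (1 - ω)) := by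
  have hq := one_lt_card_real F
  apply Real.sqrt_le_sqrt
  rw [le_div_iff₀ (by linarith)] at h1
  nlinarith

theorem sqrt_perp (h1 : ω ≤ ((Fintype.card F : ℝ) - 1) / Fintype.card F) :
    √(perp F ω) = (√(((Fintype.card F : ℝ) - 1) * (1 - ω)) - √ω) / √(Fintype.card F) := by
  unfold perp
  rw [Real.sqrt_div (sq_nonneg _), Real.sqrt_sq (sub_nonneg.2 (sqrt_le_sqrt_dual h1))]

/-- With `a = √(1 - ω)`, `b = √ω` and `r = √(q - 1)`, one has `(r a - b)² + (a + r b)² = (r² + 1)(a²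
+ b²) = q`. -/
theorem one_sub_perp (h0 : 0 ≤ ω) (h1 : ω ≤ ((Fintype.card F : ℝ) - 1) / Fintype.card F) :
    1 - perp F ω = (√(1 - ω) + √(((Fintype.card F : ℝ) - 1) * ω)) ^ 2 / Fintype.card F := by
  have hq := one_lt_card_real F
  have hω := lt_one_of_le_card h1
  have hq0 : (0 : ℝ) < Fintype.card F := by linarith
  have hq1 : (0 : ℝ) ≤ (Fintype.card F : ℝ) - 1 := by linarith
  unfold perp
  rw [eq_div_iff hq0.ne', sub_mul, div_mul_cancel₀ _ hq0.ne', Real.sqrt_mul hq1, Real.sqrt_mul hq1]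
  have a := Real.sq_sqrt hq1
  have b := Real.sq_sqrt h0
  have c := Real.sq_sqrt (show 0 ≤ 1 - ω by linarith)
  generalize √((Fintype.card F : ℝ) - 1) = r at *
  generalize √ω = s at *
  generalize √(1 - ω) = t at *
  have : (Fintype.card F : ℝ) = r ^ 2 + 1 := by linarith
  rw [this]
  have : s ^ 2 + t ^ 2 = 1 := by linarith
  linear_combination (-r^2 - 1) * this

theorem sqrt_one_sub_perp (h0 : 0 ≤ ω) (h1 : ω ≤ ((Fintype.card F : ℝ) - 1) / Fintype.card F) :
    √(1 - perp F ω) = (√(1 - ω) + √(((Fintype.card F : ℝ) - 1) * ω)) / √(Fintype.card F) := by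
  rw [one_sub_perp h0 h1, Real.sqrt_div (sq_nonneg _), Real.sqrt_sq (by positivity)]

theorem perp_le (h0 : 0 ≤ ω) (h1 : ω ≤ ((Fintype.card F : ℝ) - 1) / Fintype.card F) :
    perp F ω ≤ ((Fintype.card F : ℝ) - 1) / Fintype.card F := by
  have hq := one_lt_card_real F
  have hω := lt_one_of_le_card h1
  have hq1 : (0 : ℝ) ≤ (Fintype.card F : ℝ) - 1 := by linarith
  unfold perp
  have h2 := sqrt_le_sqrt_dual h1
  rw [div_le_div_iff_of_pos_right (by linarith)]
  have h3 : (√(((Fintype.card F : ℝ) - 1) * (1 - ω)) - √ω) ^ 2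
      ≤ √(((Fintype.card F : ℝ) - 1) * (1 - ω)) ^ 2 := by
    apply pow_le_pow_left₀ (by linarith)
    linarith [Real.sqrt_nonneg ω]
  rw [Real.sq_sqrt (by nlinarith)] at h3
  nlinarith

theorem one_sub_perp_pos (h0 : 0 ≤ ω) (h1 : ω ≤ ((Fintype.card F : ℝ) - 1) / Fintype.card F) :
    0 < 1 - perp F ω := by
  linarith [lt_one_of_le_card (perp_le h0 h1)]

/-- On this interval `(√(1 - ω), √ω) ↦ (√(1 - ω^⊥), √ω^⊥)` is an orthogonal reflection of the plane,
hence an involution. This allows the noise rate to be chosen as `τ^⊥` for a prescribed dual rate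
`τ`. -/
theorem perp_perp (h0 : 0 ≤ ω) (h1 : ω ≤ ((Fintype.card F : ℝ) - 1) / Fintype.card F) :
    perp F (perp F ω) = ω := by
  have hq := one_lt_card_real F
  have hω := lt_one_of_le_card h1
  have hq0 : (0 : ℝ) < Fintype.card F := by linarith
  have hq1 : (0 : ℝ) ≤ (Fintype.card F : ℝ) - 1 := by linarith
  rw [perp.eq_def F (perp F ω), Real.sqrt_mul hq1, sqrt_one_sub_perp h0 h1, sqrt_perp h1, Real.sqrt_mul hq1,
    Real.sqrt_mul hq1]
  have a := Real.sq_sqrt hq1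
  have b := Real.sq_sqrt h0
  have e := Real.sq_sqrt hq0.le
  have f : √(Fintype.card F : ℝ) ≠ 0 := (Real.sqrt_pos.2 hq0).ne'
  generalize √((Fintype.card F : ℝ) - 1) = r at *
  generalize √ω = s at *
  generalize √(1 - ω) = t at *
  generalize √(Fintype.card F : ℝ) = v at *
  rw [← e, ← b]
  field_simp
  have : r ^ 2 + 1 = v ^ 2 := by linarith
  rw [show r * (t + r * s) - (r * t - s) = (r ^ 2 + 1) * s by ring, this]
  ring

theorem dualAmp_nonneg : 0 ≤ dualAmp F ω := Real.sqrt_nonneg _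

theorem usdProb_eq : usdProb F ω = Fintype.card F * dualAmp F ω ^ 2 := by
  have hq := one_lt_card_real F
  have := perp_nonneg F ω
  unfold usdProb dualAmp
  rw [Real.sq_sqrt (div_nonneg this (by linarith)), mul_div_assoc]

theorem usdProb_nonneg : 0 ≤ usdProb F ω := by
  rw [usdProb_eq]; positivity

theorem usdProb_le_one (h0 : 0 ≤ ω) (h1 : ω ≤ ((Fintype.card F : ℝ) - 1) / Fintype.card F) :
    usdProb F ω ≤ 1 := by
  have hq := one_lt_card_real F
  have := perp_le h0 h1
  unfold usdProb
  rw [div_le_one (by linarith)]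
  rw [le_div_iff₀ (by linarith)] at this
  linarith

/-- The choice of the angle: the rotation lowers the amplitude at frequency zero to the common
amplitude of the other frequencies. -/
theorem usdCos_mul (h0 : 0 ≤ ω) (h1 : ω ≤ ((Fintype.card F : ℝ) - 1) / Fintype.card F) :
    usdCos F ω * √(1 - perp F ω) = dualAmp F ω := by
  have hq := one_lt_card_real F
  have h2 := one_sub_perp_pos h0 h1
  have h3 := perp_nonneg F ω
  have h4 : (0 : ℝ) < (Fintype.card F : ℝ) - 1 := by linarith
  unfold usdCos dualAmp
  rw [← Real.sqrt_mul (by positivity)]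
  congr 1
  field_simp

theorem usdSin_mul (h0 : 0 ≤ ω) (h1 : ω ≤ ((Fintype.card F : ℝ) - 1) / Fintype.card F) :
    √(1 - usdCos F ω ^ 2) * √(1 - perp F ω) = √(1 - usdProb F ω) := by
  have hq := one_lt_card_real F
  have h2 := one_sub_perp_pos h0 h1
  have h3 := perp_nonneg F ω
  have h4 : (0 : ℝ) < (Fintype.card F : ℝ) - 1 := by linarith
  rw [← Real.sqrt_mul' _ h2.le]
  congr 1
  unfold usdCos usdProb
  rw [Real.sq_sqrt (by positivity)]
  field_simp
  ring

variable [DecidableEq F]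

theorem noiseAmp_zero : noiseAmp ω (0 : F) = √(1 - ω) := if_pos rfl

theorem noiseAmp_of_ne {x : F} (hx : x ≠ 0) :
    noiseAmp ω x = √(ω / ((Fintype.card F : ℝ) - 1)) := if_neg hx

theorem sum_ite_eq_zero (a b : ℝ) :
    ∑ x : F, (if x = 0 then a else b) = a + ((Fintype.card F : ℝ) - 1) * b := by
  rw [← Finset.add_sum_erase _ _ (Finset.mem_univ (0 : F)), if_pos rfl]
  congr 1
  rw [Finset.sum_congr rfl (fun x hx => if_neg (Finset.ne_of_mem_erase hx)), Finset.sum_const,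
    Finset.card_erase_of_mem (Finset.mem_univ _), Finset.card_univ, nsmul_eq_mul,
    Nat.cast_sub Fintype.card_pos, Nat.cast_one]

theorem sum_noiseAmp (h0 : 0 ≤ ω) (h1 : ω ≤ ((Fintype.card F : ℝ) - 1) / Fintype.card F) :
    ∑ x : F, noiseAmp ω x = √(Fintype.card F) * √(1 - perp F ω) := by
  have hq := one_lt_card_real F
  have h4 : (0 : ℝ) < (Fintype.card F : ℝ) - 1 := by linarith
  unfold noiseAmp
  rw [sum_ite_eq_zero, sqrt_one_sub_perp h0 h1, mul_div_cancel₀ _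
    (Real.sqrt_pos.2 (by linarith : (0:ℝ) < Fintype.card F)).ne', Real.sqrt_div h0,
    Real.sqrt_mul h4.le]
  have a := Real.sq_sqrt h4.le
  have b := (Real.sqrt_pos.2 h4).ne'
  field_simp
  linear_combination (-√ω) * a

/-- This is `√q` times the Fourier coefficient of the noise at a nonzero frequency: the noise is a
constant plus a point mass at `0`, and the constant only contributes at frequency zero. -/
theorem noiseAmp_zero_sub {x : F} (hx : x ≠ 0) (h0 : 0 ≤ ω)
    (h1 : ω ≤ ((Fintype.card F : ℝ) - 1) / Fintype.card F) :
    noiseAmp ω (0 : F) - noiseAmp ω x = √(Fintype.card F) * dualAmp F ω := by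
  have hq := one_lt_card_real F
  have h4 : (0 : ℝ) < (Fintype.card F : ℝ) - 1 := by linarith
  unfold dualAmp
  rw [noiseAmp_zero, noiseAmp_of_ne hx, Real.sqrt_div (perp_nonneg F ω), sqrt_perp h1,
    Real.sqrt_div h0, Real.sqrt_mul h4.le]
  have b := (Real.sqrt_pos.2 h4).ne'
  have c := (Real.sqrt_pos.2 (by linarith : (0:ℝ) < Fintype.card F)).ne'
  field_simp

/-- Coherent discrimination of the symbol `c`: flag `0`. -/
theorem sum_usd_zero (h0 : 0 ≤ ω) (h1 : ω ≤ ((Fintype.card F : ℝ) - 1) / Fintype.card F)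
    (c x : F) :
    ∑ y : F, usd ω (x, 0) (y, 0) * (noiseAmp ω (y - c) : ℂ) =
      if x = c then (√(usdProb F ω) : ℂ) else 0 := by
  have hq := one_lt_card_real F
  have hq0 : (0 : ℝ) < Fintype.card F := by linarith
  have hs : ∑ y : F, noiseAmp ω (y - c) = √(Fintype.card F) * √(1 - perp F ω) := by
    rw [← sum_noiseAmp h0 h1]
    exact Fintype.sum_equiv (Equiv.subRight c) _ _ (fun y => rfl)
  have key : ∑ y : F, usd ω (x, 0) (y, 0) * (noiseAmp ω (y - c) : ℂ) =
      ((noiseAmp ω (x - c) + 1 / (Fintype.card F : ℝ) * (usdCos F ω - 1) *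
        ∑ y : F, noiseAmp ω (y - c) : ℝ) : ℂ) := by
    push_cast
    simp only [usd, add_mul, Finset.sum_add_distrib, Prod.mk.injEq, and_true, ite_mul, one_mul,
      zero_mul, Finset.sum_ite_eq, Finset.mem_univ, if_true, ← Finset.mul_sum]
    simp [rot]
  rw [key, hs]
  have e1 : 1 / (Fintype.card F : ℝ) * (usdCos F ω - 1) *
      (√(Fintype.card F) * √(1 - perp F ω)) =
      (√(Fintype.card F) * dualAmp F ω - √(Fintype.card F) * √(1 - perp F ω)) / Fintype.card F := by
    rw [← usdCos_mul h0 h1]; field_simp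
  have e2 : √(usdProb F ω) = √(Fintype.card F) * dualAmp F ω := by
    rw [usdProb_eq, Real.sqrt_mul hq0.le, Real.sqrt_sq dualAmp_nonneg]
  have e3 := noiseAmp_zero_sub (one_ne_zero (α := F)) h0 h1
  have e4 := sum_noiseAmp (F := F) h0 h1
  have e5 : ∑ x : F, noiseAmp ω x =
      noiseAmp ω (0 : F) + ((Fintype.card F : ℝ) - 1) * noiseAmp ω (1 : F) := by
    rw [noiseAmp_zero, noiseAmp_of_ne (one_ne_zero (α := F))]
    exact sum_ite_eq_zero _ _
  -- Everything is now expressed through the two amplitudes `noiseAmp ω 0` and `noiseAmp ω 1`, so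
  -- that both cases become rational identities.
  rw [e1, ← e4, e5, ← e3]
  have sq := Real.mul_self_sqrt hq0.le
  split_ifs with h
  · subst h
    rw [sub_self, e2, ← e3]
    congr 1
    field_simp
    ring
  · rw [← Complex.ofReal_zero]
    congr 1
    rw [noiseAmp_of_ne (sub_ne_zero.2 h), ← noiseAmp_of_ne (one_ne_zero (α := F))]
    field_simp
    ring

/-- Coherent discrimination of the symbol `c`: flag `1`. -/
theorem sum_usd_one (h0 : 0 ≤ ω) (h1 : ω ≤ ((Fintype.card F : ℝ) - 1) / Fintype.card F)
    (c x : F) :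
    ∑ y : F, usd ω (x, 1) (y, 0) * (noiseAmp ω (y - c) : ℂ) =
      (√((1 - usdProb F ω) / Fintype.card F) : ℝ) := by
  have hq := one_lt_card_real F
  have hq0 : (0 : ℝ) < Fintype.card F := by linarith
  have hs : ∑ y : F, noiseAmp ω (y - c) = √(Fintype.card F) * √(1 - perp F ω) := by
    rw [← sum_noiseAmp h0 h1]
    exact Fintype.sum_equiv (Equiv.subRight c) _ _ (fun y => rfl)
  have key : ∑ y : F, usd ω (x, 1) (y, 0) * (noiseAmp ω (y - c) : ℂ) =
      ((1 / (Fintype.card F : ℝ) * √(1 - usdCos F ω ^ 2) *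
        ∑ y : F, noiseAmp ω (y - c) : ℝ) : ℂ) := by
    push_cast
    simp only [usd, Prod.mk.injEq, one_ne_zero, and_false, if_false, zero_add, ← Finset.mul_sum]
    simp [rot]
  rw [key, hs]
  congr 1
  rw [Real.sqrt_div (by linarith [usdProb_le_one h0 h1]), ← usdSin_mul h0 h1]
  have b := (Real.sqrt_pos.2 hq0).ne'
  have c := Real.sq_sqrt hq0.le
  field_simp
  rw [c]
  ring

end Amplitudes

/-! ### The output law in closed form -/

section ClosedForm

variable {F : Type u} [Field F] [Fintype F] [DecidableEq F] {n k : ℕ} {ω : ℝ}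

theorem rank_eq_iff_exists_right_inverse {ι : Type*} [Fintype ι] [DecidableEq ι]
    (A : Matrix (Fin k) ι F) : A.rank = k ↔ ∃ M : Matrix ι (Fin k) F, A * M = 1 := by
  rw [← Matrix.mulVec_surjective_iff_exists_right_inverse]
  have : Function.Surjective A.mulVec ↔ LinearMap.range A.mulVecLin = ⊤ :=
    (LinearMap.range_eq_top (f := A.mulVecLin)).symm
  rw [this]
  constructor
  · intro h
    apply Submodule.eq_top_of_finrank_eq
    rw [Module.finrank_fin_fun]
    exact h
  · intro h
    rw [Matrix.rank, h, finrank_top, Module.finrank_fin_fun]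

theorem vecMul_injective_of_rank_eq {ι : Type*} [Fintype ι] [DecidableEq ι]
    {A : Matrix (Fin k) ι F} (h : A.rank = k) : Function.Injective fun m : Fin k → F => m ᵥ* A := by
  obtain ⟨M, hM⟩ := (rank_eq_iff_exists_right_inverse A).1 h
  intro m m' hm
  simpa [Matrix.vecMul_vecMul, hM] using congrArg (fun v => v ᵥ* M) hm

theorem decode_vecMul {G : Matrix (Fin k) (Fin n) F} {J : Finset (Fin n)}
    (h : (cols G J).rank = k) (m : Fin k → F) : decode G J (m ᵥ* cols G J) = m ᵥ* G := by
  have h' := (rank_eq_iff_exists_right_inverse _).1 h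
  rw [decode, pinv, dif_pos h', Matrix.vecMul_vecMul m, h'.choose_spec, Matrix.vecMul_one]

theorem mem_code {G : Matrix (Fin k) (Fin n) F} {c : Fin n → F} :
    c ∈ code G ↔ ∃ m, m ᵥ* G = c := by
  simp [code]

theorem decode_mem_code (G : Matrix (Fin k) (Fin n) F) (J : Finset (Fin n)) (v : J → F) :
    decode G J v ∈ code G := mem_code.2 ⟨_, rfl⟩

/-- Full rank of the columns in `J` makes encoding injective already on `J`, so codewords correspond
to messages. -/
theorem card_code {G : Matrix (Fin k) (Fin n) F} {J : Finset (Fin n)}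
    (h : (cols G J).rank = k) : (Nat.card (code G) : ℝ) = (Fintype.card F : ℝ) ^ k := by
  have inj : Function.Injective (Matrix.vecMulLinear G) := by
    intro m m' hm
    apply vecMul_injective_of_rank_eq h
    funext j
    exact congrFun hm j
  rw [code, ← Nat.card_congr (LinearEquiv.ofInjective _ inj).toEquiv, Nat.card_eq_fintype_card]
  simp

-- For fixed `c` the state is a product over the positions, so the sum over words factors into
-- single-symbol sums, evaluated by `sum_usd_zero` and `sum_usd_one`.
open scoped Classical in
theorem omega4_eq (h0 : 0 ≤ ω) (h1 : ω ≤ ((Fintype.card F : ℝ) - 1) / Fintype.card F)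
    (G : Matrix (Fin k) (Fin n) F) (J : Finset (Fin n)) (c x : Fin n → F) :
    omega4 ω G J c x =
      if c ∈ code G then (((1 / √(Nat.card (code G) : ℝ)) * ∏ i, (if i ∈ J then
        (if x i = c i then √(usdProb F ω) else 0) else √((1 - usdProb F ω) / Fintype.card F)) : ℝ) : ℂ)
      else 0 := by
  unfold omega4 omega2 omega1 omega0
  split_ifs with hc
  · push_cast
    simp only [← mul_assoc, mul_right_comm _ _ (∏ i, (noiseAmp _ _ : ℂ))]
    simp only [mul_comm _ (1 / _ : ℂ)]
    simp only [← Finset.mul_sum, ← Finset.prod_mul_distrib]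
    congr 1
    have := Fintype.prod_sum (fun (i : Fin n) (y : F) =>
      usd ω (x i, if i ∈ J then 0 else 1) (y, 0) * (noiseAmp ω (y - c i) : ℂ))
    simp only [Pi.sub_apply, ← this]
    refine Finset.prod_congr rfl fun i _ => ?_
    split_ifs with hi hx
    · rw [sum_usd_zero h0 h1, if_pos hx]
    · rw [sum_usd_zero h0 h1, if_neg hx]; simp
    · rw [sum_usd_one h0 h1]
  · simp

theorem sum_sq_norm_omega4 (h0 : 0 ≤ ω)
    (h1 : ω ≤ ((Fintype.card F : ℝ) - 1) / Fintype.card F)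
    (G : Matrix (Fin k) (Fin n) F) (J : Finset (Fin n)) :
    ∑ c : Fin n → F, ∑ x : Fin n → F, ‖omega4 ω G J c x‖ ^ 2 =
      ∏ i, if i ∈ J then usdProb F ω else 1 - usdProb F ω := by
  classical
  have hq := one_lt_card_real F
  have hp := usdProb_le_one h0 h1
  have hp0 := usdProb_nonneg (F := F) (ω := ω)
  have hC : (0 : ℝ) < Nat.card (code G) := by exact_mod_cast Nat.card_pos
  have step : ∀ c : Fin n → F, ∑ x : Fin n → F, ‖omega4 ω G J c x‖ ^ 2 =
      if c ∈ code G then 1 / (Nat.card (code G) : ℝ) *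
        ∏ i, (if i ∈ J then usdProb F ω else 1 - usdProb F ω) else 0 := by
    intro c
    split_ifs with hc
    · have : ∀ x, ‖omega4 ω G J c x‖ ^ 2 = 1 / (Nat.card (code G) : ℝ) *
          ∏ i, (if i ∈ J then (if x i = c i then usdProb F ω else 0)
            else (1 - usdProb F ω) / Fintype.card F) := by
        intro x
        rw [omega4_eq h0 h1, if_pos hc, Complex.norm_real, Real.norm_eq_abs, sq_abs, mul_pow,
          div_pow, Real.sq_sqrt hC.le, one_pow, ← Finset.prod_pow]
        congr 1
        refine Finset.prod_congr rfl fun i _ => ?_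
        split_ifs
        · exact Real.sq_sqrt hp0
        · simp
        · exact Real.sq_sqrt (div_nonneg (by linarith) (by linarith))
      simp only [this, ← Finset.mul_sum]
      rw [← Fintype.prod_sum (fun (i : Fin n) (y : F) => if i ∈ J then
        (if y = c i then usdProb F ω else 0) else (1 - usdProb F ω) / Fintype.card F)]
      congr 1
      refine Finset.prod_congr rfl fun i _ => ?_
      split_ifs
      · simp
      · rw [Finset.sum_const, Finset.card_univ, nsmul_eq_mul]
        field_simp
    · simp [omega4_eq h0 h1, hc]
  simp only [step]
  rw [← Finset.sum_filter, Finset.sum_const, nsmul_eq_mul]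
  have : ((Finset.univ.filter (· ∈ code G)).card : ℝ) = Nat.card (code G) := by
    rw [Nat.card_eq_fintype_card, Fintype.card_subtype]
  rw [this]
  field_simp

-- On `J` the word carries `c_J` itself, and `decode` recovers `c` from it. The first register is
-- therefore `0` in every surviving branch, and all codewords share one amplitude.
open scoped Classical in
theorem omega5_eq (h0 : 0 ≤ ω) (h1 : ω ≤ ((Fintype.card F : ℝ) - 1) / Fintype.card F)
    {G : Matrix (Fin k) (Fin n) F} {J : Finset (Fin n)} (h : (cols G J).rank = k)
    (c x : Fin n → F) :
    omega5 ω G J c x =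
      if c = 0 ∧ ∃ m, m ᵥ* cols G J = fun j : J => x j then
        (((1 / √((Fintype.card F : ℝ) ^ k)) * ∏ i, (if i ∈ J then √(usdProb F ω)
          else √((1 - usdProb F ω) / Fintype.card F)) : ℝ) : ℂ)
      else 0 := by
  unfold omega5
  rw [omega4_eq h0 h1, card_code h]
  by_cases hx : ∃ m, m ᵥ* cols G J = fun j : J => x j
  · obtain ⟨m, hm⟩ := hx
    have hd : decode G J (fun j => x j) = m ᵥ* G := by rw [← hm, decode_vecMul h]
    by_cases hc : c = 0
    · rw [hc, zero_add, if_pos (decode_mem_code G J _), if_pos ⟨rfl, m, hm⟩]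
      congr 2
      refine Finset.prod_congr rfl fun i _ => ?_
      split_ifs with hi hx
      · rfl
      · refine absurd ?_ hx
        rw [hd]
        exact (congrFun hm ⟨i, hi⟩).symm
      · rfl
    · rw [if_neg (c := c = 0 ∧ _) (fun h => hc h.1)]
      split_ifs with hcode
      · suffices ∃ i ∈ J, x i ≠ (c + decode G J fun j => x j) i by
          obtain ⟨i, hi, hxi⟩ := this
          rw [Finset.prod_eq_zero (Finset.mem_univ i) (by rw [if_pos hi, if_neg hxi])]
          simp
        -- If `x` agreed with `c + decode x_J` on `J`, both this codeword and `m G` would restrict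
        -- to `x_J`; injectivity on `J` would force `c = 0`.
        by_contra! hcon
        apply hc
        obtain ⟨m', hm'⟩ := mem_code.1 hcode
        have : m' = m := by
          apply vecMul_injective_of_rank_eq h
          change m' ᵥ* cols G J = m ᵥ* cols G J
          rw [hm]
          funext j
          rw [hcon j j.2, ← hm']; rfl
        rw [this, ← hd] at hm'
        simpa using hm'.symm
      · rfl
  · rw [if_neg (c := c = 0 ∧ _) (fun h => hx h.2)]
    split_ifs with hcode
    · suffices ∃ i ∈ J, x i ≠ (c + decode G J fun j => x j) i by
        obtain ⟨i, hi, hxi⟩ := this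
        rw [Finset.prod_eq_zero (Finset.mem_univ i) (by rw [if_pos hi, if_neg hxi])]
        simp
      by_contra! hcon
      apply hx
      obtain ⟨m', hm'⟩ := mem_code.1 hcode
      refine ⟨m', funext fun j => ?_⟩
      rw [hcon j j.2, ← hm']; rfl
    · rfl

theorem cols_mulVec (G : Matrix (Fin k) (Fin n) F) (J : Finset (Fin n)) (x : Fin n → F) :
    (cols G J *ᵥ fun j : J => x j) = G *ᵥ extendZero J x := by
  funext i
  simp only [Matrix.mulVec, dotProduct, cols, Matrix.submatrix_apply, id, extendZero, mul_ite,
    mul_zero]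
  rw [Finset.sum_ite_mem, Finset.univ_inter, Finset.univ_eq_attach,
    Finset.sum_attach J (fun j => G i j * x j)]

/-- The row space of `G_J` is parametrised injectively by messages. The transform is then a sum of
characters over messages, which vanishes unless the outcome on `J` is orthogonal to every row. -/
theorem omega6_eq (h0 : 0 ≤ ω) (h1 : ω ≤ ((Fintype.card F : ℝ) - 1) / Fintype.card F)
    {G : Matrix (Fin k) (Fin n) F} {J : Finset (Fin n)} (h : (cols G J).rank = k)
    (c x : Fin n → F) :
    omega6 ω G J c x =
      if c = 0 ∧ G *ᵥ extendZero J x = 0 then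
        ((1 / √((Fintype.card F : ℝ) ^ J.card) * (Fintype.card F : ℝ) ^ k *
          ((1 / √((Fintype.card F : ℝ) ^ k)) * ∏ i, (if i ∈ J then √(usdProb F ω)
          else √((1 - usdProb F ω) / Fintype.card F))) : ℝ) : ℂ)
      else 0 := by
  classical
  unfold omega6
  have hm : ∀ v : J → F, (fun j : J => (fun i => if h : i ∈ J then v ⟨i, h⟩ else x i) j) = v := by
    intro v; funext j; simp
  simp only [omega5_eq h0 h1 h, hm]
  by_cases hc : c = 0
  · simp only [hc, true_and]
    generalize (((1 / √((Fintype.card F : ℝ) ^ k)) * ∏ i, (if i ∈ J then √(usdProb F ω)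
          else √((1 - usdProb F ω) / Fintype.card F)) : ℝ)) = K
    have inj := vecMul_injective_of_rank_eq h
    have e1 : ∑ v : J → F, (∏ j : J, chi (x j) (v j)) *
        (if ∃ m, m ᵥ* cols G J = v then (K : ℂ) else 0) =
        ∑ m : Fin k → F, traceChar F (m ⬝ᵥ (cols G J *ᵥ fun j => x j)) * K := by
      simp only [mul_ite, mul_zero]
      rw [← Finset.sum_filter]
      have : Finset.univ.filter (fun v => ∃ m, m ᵥ* cols G J = v) =
          Finset.univ.image (fun m : Fin k → F => m ᵥ* cols G J) := by
        ext v; simp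
      rw [this, Finset.sum_image (fun a _ b _ hab => inj hab)]
      refine Finset.sum_congr rfl fun m _ => ?_
      rw [Matrix.dotProduct_mulVec, dotProduct, traceChar_sum]
      rfl
    rw [e1, ← Finset.sum_mul, sum_traceChar_dotProduct, cols_mulVec, Fintype.card_fin]
    split_ifs
    · push_cast; ring
    · simp
  · simp [hc]

/-- The law of the output, given that unambiguous state discrimination succeeds at the set `J`. -/
def condLaw (G : Matrix (Fin k) (Fin n) F) (J : Finset (Fin n)) (z : Fin n → F) : ℝ :=
  if (cols G J).rank = k then
    if (∀ i, i ∉ J → z i = 0) ∧ G *ᵥ z = 0 then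
      (Fintype.card F : ℝ) ^ k / (Fintype.card F : ℝ) ^ J.card else 0
  else if z = 0 then 1 else 0

/-- The probability that unambiguous state discrimination succeeds exactly at the positions in
`J`, if it succeeds at every position with probability `p`. -/
def subsetProb (p : ℝ) (J : Finset (Fin n)) : ℝ := ∏ i, if i ∈ J then p else 1 - p

theorem sum_sq_norm_omega6 (h0 : 0 ≤ ω)
    (h1 : ω ≤ ((Fintype.card F : ℝ) - 1) / Fintype.card F)
    {G : Matrix (Fin k) (Fin n) F} {J : Finset (Fin n)} (h : (cols G J).rank = k)
    (z : Fin n → F) :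
    (∑ c : Fin n → F, ∑ x : Fin n → F, if extendZero J x = z then ‖omega6 ω G J c x‖ ^ 2 else 0) =
      subsetProb (usdProb F ω) J * condLaw G J z := by
  classical
  have hq := one_lt_card_real F
  have hq0 : (0 : ℝ) < Fintype.card F := by linarith
  have hp := usdProb_le_one h0 h1
  have hp0 := usdProb_nonneg (F := F) (ω := ω)
  rw [Finset.sum_eq_single 0 (fun c _ hc => by simp [omega6_eq h0 h1 h, hc]) (by simp)]
  rw [condLaw, if_pos h]
  by_cases hz : G *ᵥ z = 0
  · have e : ∀ x, (if extendZero J x = z then ‖omega6 ω G J 0 x‖ ^ 2 else 0) =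
        (Fintype.card F : ℝ) ^ k / (Fintype.card F : ℝ) ^ J.card *
          ∏ i, (if i ∈ J then (if x i = z i then usdProb F ω else 0)
            else (if z i = 0 then (1 - usdProb F ω) / Fintype.card F else 0)) := by
      intro x
      split_ifs with hx
      · rw [omega6_eq h0 h1 h, if_pos ⟨rfl, by rw [hx, hz]⟩, Complex.norm_real, Real.norm_eq_abs,
          sq_abs, mul_pow, mul_pow, mul_pow, div_pow, div_pow, Real.sq_sqrt (by positivity),
          Real.sq_sqrt (by positivity), ← Finset.prod_pow, one_pow]
        have : ∏ i, (if i ∈ J then √(usdProb F ω)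
            else √((1 - usdProb F ω) / Fintype.card F)) ^ 2 =
            ∏ i, (if i ∈ J then (if x i = z i then usdProb F ω else 0)
            else (if z i = 0 then (1 - usdProb F ω) / Fintype.card F else 0)) := by
          refine Finset.prod_congr rfl fun i _ => ?_
          have hi := congrFun hx i
          simp only [extendZero] at hi
          by_cases a : i ∈ J
          · rw [if_pos a] at hi
            rw [if_pos a, if_pos a, if_pos hi, Real.sq_sqrt hp0]
          · rw [if_neg a] at hi
            rw [if_neg a, if_neg a, if_pos hi.symm, Real.sq_sqrt (div_nonneg (by linarith) hq0.le)]
        rw [this]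
        field_simp
      · rw [eq_comm, mul_eq_zero]
        right
        obtain ⟨i, hi⟩ := Function.ne_iff.mp hx
        apply Finset.prod_eq_zero (Finset.mem_univ i)
        simp only [extendZero] at hi
        by_cases a : i ∈ J
        · rw [if_pos a] at hi
          rw [if_pos a, if_neg hi]
        · rw [if_neg a] at hi
          rw [if_neg a, if_neg (Ne.symm hi)]
    simp only [e, ← Finset.mul_sum]
    rw [← Fintype.prod_sum (fun (i : Fin n) (y : F) =>
      (if i ∈ J then (if y = z i then usdProb F ω else 0)
            else (if z i = 0 then (1 - usdProb F ω) / Fintype.card F else 0)))]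
    split_ifs with hs
    · rw [mul_comm, subsetProb]
      congr 1
      refine Finset.prod_congr rfl fun i _ => ?_
      split_ifs with hi hzi
      · simp
      · rw [Finset.sum_const, Finset.card_univ, nsmul_eq_mul]; field_simp
      · exact absurd (hs.1 i hi) hzi
    · rw [mul_zero, mul_eq_zero]
      right
      have : ∃ i, i ∉ J ∧ z i ≠ 0 := by
        by_contra! hcon
        exact hs ⟨hcon, hz⟩
      obtain ⟨i, hi, hzi⟩ := this
      apply Finset.prod_eq_zero (Finset.mem_univ i)
      simp [hi, hzi]
  · rw [if_neg (fun h => hz h.2), mul_zero]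
    refine Finset.sum_eq_zero fun x _ => ?_
    split_ifs with hx
    · rw [omega6_eq h0 h1 h, hx, if_neg (fun h => hz h.2)]; simp
    · rfl

theorem outputLaw_eq (h0 : 0 ≤ ω) (h1 : ω ≤ ((Fintype.card F : ℝ) - 1) / Fintype.card F)
    (G : Matrix (Fin k) (Fin n) F) (z : Fin n → F) :
    outputLaw ω G z = ∑ J : Finset (Fin n), subsetProb (usdProb F ω) J * condLaw G J z := by
  unfold outputLaw
  refine Finset.sum_congr rfl fun J _ => ?_
  by_cases h : (cols G J).rank = k
  · rw [if_pos h, sum_sq_norm_omega6 h0 h1 h]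
  · rw [if_neg h, sum_sq_norm_omega4 h0 h1, condLaw, if_neg h, subsetProb]
    split_ifs <;> simp

theorem sum_subsetProb (p : ℝ) : ∑ J : Finset (Fin n), subsetProb p J = 1 := by
  have := Finset.prod_add (fun _ : Fin n => p) (fun _ => 1 - p) Finset.univ
  simp only [add_sub_cancel, Finset.prod_const_one, Finset.powerset_univ] at this
  rw [this]
  refine Finset.sum_congr rfl fun J _ => ?_
  rw [subsetProb, Finset.prod_ite]
  simp only [Finset.prod_const]
  congr 2
  · simp
  · congr 1; ext; simp

theorem card_kernel {ι : Type*} [Fintype ι] [DecidableEq ι] {A : Matrix (Fin k) ι F}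
    (h : A.rank = k) :
    ((Finset.univ.filter fun v : ι → F => A *ᵥ v = 0).card : ℝ) * (Fintype.card F : ℝ) ^ k =
      (Fintype.card F : ℝ) ^ Fintype.card ι := by
  have e : (Finset.univ.filter fun v : ι → F => A *ᵥ v = 0).card =
      Nat.card (LinearMap.ker A.mulVecLin) := by
    rw [← Fintype.card_subtype, ← Nat.card_eq_fintype_card]
    rfl
  rw [e, Module.natCard_eq_pow_finrank (K := F), Nat.card_eq_fintype_card]
  have := LinearMap.finrank_range_add_finrank_ker A.mulVecLin
  rw [Module.finrank_fintype_fun_eq_card] at this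
  rw [← this]
  change A.rank + _ = _ at this
  rw [show Module.finrank F (LinearMap.range A.mulVecLin) = k from h]
  push_cast
  ring

/-- In the full rank case the words supported in `J` with zero syndrome are the kernel of `G_J`
extended by zero, so there are `q ^ (|J| - k)` of them. -/
theorem sum_condLaw (G : Matrix (Fin k) (Fin n) F) (J : Finset (Fin n)) :
    ∑ z : Fin n → F, condLaw G J z = 1 := by
  classical
  have hq := one_lt_card_real F
  have hq0 : (0 : ℝ) < Fintype.card F := by linarith
  unfold condLaw
  by_cases h : (cols G J).rank = k
  · simp only [if_pos h]
    rw [← Finset.sum_filter, Finset.sum_const, nsmul_eq_mul]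
    have := card_kernel h
    rw [Fintype.card_coe] at this
    rw [← this]
    have hc : (Finset.univ.filter fun z : Fin n → F => (∀ i, i ∉ J → z i = 0) ∧ G *ᵥ z = 0).card =
        (Finset.univ.filter fun v : J → F => cols G J *ᵥ v = 0).card := by
      have ez : ∀ z : Fin n → F, (∀ i, i ∉ J → z i = 0) → extendZero J z = z := by
        intro z hz
        funext i
        unfold extendZero
        split_ifs with hi
        · rfl
        · exact (hz i hi).symm
      refine Finset.card_bij' (fun z _ j => z j) (fun v _ i => if h : i ∈ J then v ⟨i, h⟩ else 0)
        ?_ ?_ ?_ ?_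
      · intro z hz
        simp only [Finset.mem_filter, Finset.mem_univ, true_and] at hz ⊢
        rw [cols_mulVec, ez z hz.1, hz.2]
      · intro v hv
        simp only [Finset.mem_filter, Finset.mem_univ, true_and] at hv ⊢
        refine ⟨fun i hi => dif_neg hi, ?_⟩
        rw [← ez _ (fun i hi => dif_neg hi), ← cols_mulVec, ← hv]
        congr 1
        funext j
        simp
      · intro z hz
        simp only [Finset.mem_filter, Finset.mem_univ, true_and] at hz ⊢
        funext i
        split_ifs with hi
        · rfl
        · exact (hz.1 i hi).symm
      · intro v hv
        funext j
        simp
    rw [hc]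
    have hpos : ((Finset.univ.filter fun v : J → F => cols G J *ᵥ v = 0).card : ℝ) ≠ 0 := by
      have : 0 < (Finset.univ.filter fun v : J → F => cols G J *ᵥ v = 0).card :=
        Finset.card_pos.2 ⟨0, by simp⟩
      exact_mod_cast this.ne'
    field_simp
  · simp [if_neg h]

theorem sum_outputLaw (h0 : 0 ≤ ω) (h1 : ω ≤ ((Fintype.card F : ℝ) - 1) / Fintype.card F)
    (G : Matrix (Fin k) (Fin n) F) : ∑ z : Fin n → F, outputLaw ω G z = 1 := by
  simp only [outputLaw_eq h0 h1]
  rw [Finset.sum_comm]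
  simp only [← Finset.mul_sum, sum_condLaw, mul_one, sum_subsetProb]

end ClosedForm

/-! ### Product states -/

section ProductStates

variable {F : Type u} [Field F] [Fintype F] [DecidableEq F]

theorem single_finset_sum {α T : Type*} (s : Finset T) (a : α) (f : T → ℂ) :
    Finsupp.single a (∑ t ∈ s, f t) = ∑ t ∈ s, Finsupp.single a (f t) :=
  map_sum (Finsupp.singleAddHom a) f s

theorem gate1_single (M : Matrix F F ℂ) (l : ℕ × ℕ) (v : ℕ × ℕ → F) (a : ℂ) :
    gate1 M l (Finsupp.single v a) =
      ∑ y : F, Finsupp.single (Function.update v l y) (M y (v l) * a) := by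
  unfold gate1
  rw [Finsupp.sum_single_index]
  simp

theorem gate1_add (M : Matrix F F ℂ) (l : ℕ × ℕ) (ψ ψ' : (ℕ × ℕ → F) →₀ ℂ) :
    gate1 M l (ψ + ψ') = gate1 M l ψ + gate1 M l ψ' := by
  unfold gate1
  rw [Finsupp.sum_add_index' (by simp)]
  intro v a b
  simp [mul_add, Finset.sum_add_distrib]

theorem gate1_smul (M : Matrix F F ℂ) (l : ℕ × ℕ) (c : ℂ) (ψ : (ℕ × ℕ → F) →₀ ℂ) :
    gate1 M l (c • ψ) = c • gate1 M l ψ := by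
  unfold gate1
  rw [Finsupp.sum_smul_index (by simp), Finsupp.smul_sum]
  refine Finsupp.sum_congr fun v _ => ?_
  rw [Finset.smul_sum]
  refine Finset.sum_congr rfl fun y _ => ?_
  rw [Finsupp.smul_single, smul_eq_mul]
  congr 1
  ring

/-- `gate1` as a linear map. -/
def gate1Lin (M : Matrix F F ℂ) (l : ℕ × ℕ) :
    ((ℕ × ℕ → F) →₀ ℂ) →ₗ[ℂ] ((ℕ × ℕ → F) →₀ ℂ) where
  toFun := gate1 M l
  map_add' := gate1_add M l
  map_smul' := gate1_smul M l

theorem gate1_sum_smul {T : Type*} (s : Finset T) (M : Matrix F F ℂ) (l : ℕ × ℕ) (c : T → ℂ)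
    (ψ : T → (ℕ × ℕ → F) →₀ ℂ) :
    gate1 M l (∑ t ∈ s, c t • ψ t) = ∑ t ∈ s, c t • gate1 M l (ψ t) := by
  exact (map_sum (gate1Lin M l) (fun t => c t • ψ t) s).trans
    (Finset.sum_congr rfl fun t _ => map_smul (gate1Lin M l) (c t) (ψ t))

/-- `gate2`, with distinct cells, as a linear map. -/
def gate2Lin (M : Matrix (F × F) (F × F) ℂ) (l r : ℕ × ℕ) :
    ((ℕ × ℕ → F) →₀ ℂ) →ₗ[ℂ] ((ℕ × ℕ → F) →₀ ℂ) where
  toFun := gate2 M l r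
  map_add' ψ ψ' := by
    unfold gate2
    split_ifs
    · rfl
    rw [Finsupp.sum_add_index' (by simp)]
    intro v a b
    simp [mul_add, Finset.sum_add_distrib]
  map_smul' c ψ := by
    unfold gate2
    split_ifs
    · rfl
    rw [Finsupp.sum_smul_index (by simp), RingHom.id_apply, Finsupp.smul_sum]
    refine Finsupp.sum_congr fun v _ => ?_
    rw [Finset.smul_sum]
    refine Finset.sum_congr rfl fun y _ => ?_
    rw [Finsupp.smul_single, smul_eq_mul]
    congr 1
    ring

theorem gate2_sum_smul {T : Type*} (s : Finset T) (M : Matrix (F × F) (F × F) ℂ) (l r : ℕ × ℕ)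
    (c : T → ℂ) (ψ : T → (ℕ × ℕ → F) →₀ ℂ) :
    gate2 M l r (∑ t ∈ s, c t • ψ t) = ∑ t ∈ s, c t • gate2 M l r (ψ t) := by
  exact (map_sum (gate2Lin M l r) (fun t => c t • ψ t) s).trans
    (Finset.sum_congr rfl fun t _ => map_smul (gate2Lin M l r) (c t) (ψ t))

theorem filter_sum_smul {T : Type*} (s : Finset T) (p : (ℕ × ℕ → F) → Prop) [DecidablePred p]
    (c : T → ℂ) (ψ : T → (ℕ × ℕ → F) →₀ ℂ) :
    (∑ t ∈ s, c t • ψ t).filter p = ∑ t ∈ s, c t • (ψ t).filter p := by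
  rw [Finsupp.filter_sum]
  exact Finset.sum_congr rfl fun t _ => Finsupp.filter_smul ..

/-- A controlled two-cell gate. -/
theorem gate2_single_of_controlled (M : Matrix (F × F) (F × F) ℂ) (N : F → Matrix F F ℂ)
    (hM : ∀ y x, M y x = if y.1 = x.1 then N x.1 y.2 x.2 else 0) {l r : ℕ × ℕ} (h : l ≠ r)
    (v : ℕ × ℕ → F) (a : ℂ) :
    gate2 M l r (Finsupp.single v a) = gate1 (N (v l)) r (Finsupp.single v a) := by
  rw [gate1_single]
  unfold gate2
  rw [if_neg h, Finsupp.sum_single_index (by simp), Fintype.sum_prod_type,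
    Finset.sum_eq_single (v l)]
  · refine Finset.sum_congr rfl fun y _ => ?_
    rw [hM, if_pos rfl, Function.update_eq_self]
  · intro b _ hb
    refine Finset.sum_eq_zero fun y _ => ?_
    rw [hM, if_neg hb]
    simp
  · simp

variable {ι : Type*} [Fintype ι] [DecidableEq ι] (e : ι → ℕ × ℕ)

/-- The basis state which assigns the symbol `v i` to the address `e i` and `0` to the other
addresses. -/
def basisAt (v : ι → F) : ℕ × ℕ → F := Function.extend e v 0

/-- The product state with the state `φ i` in the cell at the address `e i`, and `|0⟩` in the other
cells. -/
def prodKet (φ : ι → F → ℂ) : (ℕ × ℕ → F) →₀ ℂ :=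
  ∑ v : ι → F, Finsupp.single (basisAt e v) (∏ i, φ i (v i))

variable {e} (he : Function.Injective e)

include he

theorem basisAt_apply (v : ι → F) (i : ι) : basisAt e v (e i) = v i := he.extend_apply _ _ _

theorem basisAt_injective : Function.Injective (basisAt (F := F) e) := fun v w h => by
  funext i
  rw [← basisAt_apply he v, h, basisAt_apply he]

theorem update_basisAt (v : ι → F) (i : ι) (y : F) :
    Function.update (basisAt e v) (e i) y = basisAt e (Function.update v i y) := by
  funext a
  by_cases ha : ∃ j, e j = a
  · obtain ⟨j, rfl⟩ := ha
    rw [basisAt_apply he]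
    by_cases hj : j = i
    · subst hj; simp
    · rw [Function.update_of_ne (he.ne hj), Function.update_of_ne hj, basisAt_apply he]
  · rw [Function.update_of_ne (fun h => ha ⟨i, h.symm⟩)]
    simp [basisAt, Function.extend_apply' _ _ _ ha]

omit he in
theorem prod_update (φ : ι → F → ℂ) (i : ι) (f : F → ℂ) (v : ι → F) :
    ∏ j, Function.update φ i f j (v j) = f (v i) * ∏ j ∈ Finset.univ.erase i, φ j (v j) := by
  rw [← Finset.mul_prod_erase _ _ (Finset.mem_univ i), Function.update_self]
  congr 1
  refine Finset.prod_congr rfl fun j hj => ?_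
  rw [Function.update_of_ne (Finset.ne_of_mem_erase hj)]

theorem gate1_prodKet (M : Matrix F F ℂ) (φ : ι → F → ℂ) (i : ι) :
    gate1 M (e i) (prodKet e φ) =
      prodKet e (Function.update φ i fun y => ∑ x, M y x * φ i x) := by
  have h1 : gate1 M (e i) (prodKet e φ) =
      ∑ p : (ι → F) × F, Finsupp.single (basisAt e (Function.update p.1 i p.2))
        (M p.2 (p.1 i) * ∏ j, φ j (p.1 j)) := by
    have := map_sum (gate1Lin M (e i)) (fun v => Finsupp.single (basisAt e v) (∏ j, φ j (v j)))
      Finset.univ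
    rw [Fintype.sum_prod_type]
    refine this.trans (Finset.sum_congr rfl fun v _ => ?_)
    refine (gate1_single _ _ _ _).trans (Finset.sum_congr rfl fun y _ => ?_)
    rw [update_basisAt he, basisAt_apply he]
  have h2 : prodKet e (Function.update φ i fun y => ∑ x, M y x * φ i x) =
      ∑ p : (ι → F) × F, Finsupp.single (basisAt e p.1)
        (M (p.1 i) p.2 * φ i p.2 * ∏ j ∈ Finset.univ.erase i, φ j (p.1 j)) := by
    rw [prodKet, Fintype.sum_prod_type]
    refine Finset.sum_congr rfl fun v _ => ?_
    rw [prod_update, Finset.sum_mul, single_finset_sum]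
  rw [h1, h2]
  -- Exchanging the old and the new symbol of cell `i` turns the sum over (old configuration, new
  -- symbol) into one over (new configuration, old symbol).
  have inv : Function.Involutive
      (fun p : (ι → F) × F => (Function.update p.1 i p.2, p.1 i)) := by
    rintro ⟨v, y⟩
    simp
  refine Fintype.sum_equiv inv.toPerm _ _ fun p => ?_
  simp only [Function.Involutive.coe_toPerm, Function.update_self]
  rw [← Finset.mul_prod_erase _ _ (Finset.mem_univ i), mul_assoc]
  congr 3
  refine Finset.prod_congr rfl fun j hj => ?_
  rw [Function.update_of_ne (Finset.ne_of_mem_erase hj)]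

omit he in
theorem prodKet_update_smul (φ : ι → F → ℂ) (i : ι) (c : ℂ) (f : F → ℂ) :
    prodKet e (Function.update φ i (c • f)) = c • prodKet e (Function.update φ i f) := by
  unfold prodKet
  rw [Finset.smul_sum]
  refine Finset.sum_congr rfl fun v _ => ?_
  rw [prod_update, prod_update, Finsupp.smul_single, smul_eq_mul, Pi.smul_apply, smul_eq_mul,
    mul_assoc]

omit he in
theorem prodKet_update_sum {T : Type*} (s : Finset T) (φ : ι → F → ℂ) (i : ι) (f : T → F → ℂ) :
    prodKet e (Function.update φ i (∑ t ∈ s, f t)) =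
      ∑ t ∈ s, prodKet e (Function.update φ i (f t)) := by
  unfold prodKet
  rw [Finset.sum_comm]
  refine Finset.sum_congr rfl fun v _ => ?_
  simp only [prod_update]
  rw [Finset.sum_apply, Finset.sum_mul, single_finset_sum]

omit he in
-- Expands one cell in the computational basis, so that a controlled gate need only be understood
-- with its control in a basis state.
theorem prodKet_eq_sum (φ : ι → F → ℂ) (i : ι) :
    prodKet e φ = ∑ a : F, φ i a • prodKet e (Function.update φ i (Pi.single a 1)) := by
  simp only [← prodKet_update_smul]
  rw [← prodKet_update_sum]
  congr 1
  conv_lhs => rw [← Function.update_eq_self i φ]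
  congr 1
  funext y
  simp [Finset.sum_apply, Pi.single_apply]

theorem filter_prodKet (φ : ι → F → ℂ) (i : ι) (y : F) :
    (prodKet e φ).filter (fun w => w (e i) = y) =
      φ i y • prodKet e (Function.update φ i (Pi.single y 1)) := by
  unfold prodKet
  rw [Finsupp.filter_sum, Finset.smul_sum]
  refine Finset.sum_congr rfl fun v _ => ?_
  rw [prod_update]
  by_cases h : v i = y
  · rw [Finsupp.filter_single_of_pos _ (by rw [basisAt_apply he, h]), ← h, Pi.single_eq_same,
      one_mul, Finsupp.smul_single, smul_eq_mul, Finset.mul_prod_erase _ (fun j => φ j (v j))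
      (Finset.mem_univ i)]
  · rw [Finsupp.filter_single_of_neg _ (by rwa [basisAt_apply he]), Pi.single_eq_of_ne h, zero_mul,
      Finsupp.single_zero, smul_zero]

/-- A controlled gate, with the control in a basis state. -/
theorem gate2_prodKet_of_controlled (M : Matrix (F × F) (F × F) ℂ) (N : F → Matrix F F ℂ)
    (hM : ∀ y x, M y x = if y.1 = x.1 then N x.1 y.2 x.2 else 0) {i j : ι} (hij : i ≠ j)
    (φ : ι → F → ℂ) (a : F) (ha : φ i = Pi.single a 1) :
    gate2 M (e i) (e j) (prodKet e φ) =
      prodKet e (Function.update φ j fun y => ∑ x, N a y x * φ j x) := by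
  rw [← gate1_prodKet he]
  have h1 := map_sum (gate2Lin M (e i) (e j))
    (fun v => Finsupp.single (basisAt e v) (∏ j, φ j (v j))) Finset.univ
  have h2 := map_sum (gate1Lin (N a) (e j))
    (fun v => Finsupp.single (basisAt e v) (∏ j, φ j (v j))) Finset.univ
  refine h1.trans (Eq.trans ?_ h2.symm)
  refine Finset.sum_congr rfl fun v _ => ?_
  refine (gate2_single_of_controlled M N hM (he.ne hij) _ _).trans ?_
  change _ = gate1 _ _ _
  rw [basisAt_apply he]
  by_cases h : v i = a
  · rw [h]
  · have : ∏ j, φ j (v j) = 0 :=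
      Finset.prod_eq_zero (Finset.mem_univ i) (by rw [ha, Pi.single_eq_of_ne h])
    simp [this, gate1]

theorem cadd_prodKet {i j : ι} (hij : i ≠ j) (b : F) (φ : ι → F → ℂ) (a : F)
    (ha : φ i = Pi.single a 1) :
    gate2 (caddMatrix b) (e i) (e j) (prodKet e φ) =
      prodKet e (Function.update φ j fun y => φ j (y - b * a)) := by
  rw [gate2_prodKet_of_controlled he (caddMatrix b) (fun a y x => if y = x + b * a then 1 else 0)
    ?_ hij φ a ha]
  · congr 2
    funext y
    rw [Finset.sum_eq_single (y - b * a)]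
    · simp
    · intro x _ hx
      rw [if_neg (fun h => hx (by rw [h]; ring)), zero_mul]
    · simp
  · intro y x
    simp only [caddMatrix, Prod.ext_iff]
    split_ifs <;> tauto

/-- A controlled gate, with the target in the state `|0⟩`, followed by a measurement of the
target. -/
theorem filter_gate2_prodKet (M : Matrix (F × F) (F × F) ℂ) (N : F → Matrix F F ℂ)
    (hM : ∀ y x, M y x = if y.1 = x.1 then N x.1 y.2 x.2 else 0) {i j : ι} (hij : i ≠ j)
    (φ : ι → F → ℂ) (hj : φ j = Pi.single 0 1) (y : F) :
    (gate2 M (e i) (e j) (prodKet e φ)).filter (fun w => w (e j) = y) =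
      prodKet e (Function.update (Function.update φ i fun a => N a y 0 * φ i a) j
        (Pi.single y 1)) := by
  rw [prodKet_eq_sum φ i, gate2_sum_smul, filter_sum_smul,
    prodKet_eq_sum (Function.update _ j _) i]
  refine Finset.sum_congr rfl fun a _ => ?_
  rw [gate2_prodKet_of_controlled he M N hM hij _ a (Function.update_self ..), filter_prodKet he,
    smul_smul]
  congr 1
  · rw [Function.update_self, Function.update_of_ne hij, Function.update_self,
      Function.update_of_ne hij.symm, hj, mul_comm]
    simp [Pi.single_apply]
  · congr 1
    rw [Function.update_idem, Function.update_comm hij.symm, Function.update_idem,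
      Function.update_comm hij]

omit he in
-- Distinct basis states do not interfere; injectivity of `w` is what rules out collisions.
theorem weight_sum_single {T : Type*} [Fintype T] (s : Cfg F) {w : T → ℕ × ℕ → F}
    (inj : Function.Injective w) (g : T → ℂ)
    (h : s.ket = ∑ t, Finsupp.single (w t) (g t)) : s.weight = ∑ t, ‖g t‖ ^ 2 := by
  classical
  unfold Cfg.weight
  have ev : ∀ t, s.ket (w t) = g t := by
    intro t
    rw [h, Finsupp.finsetSum_apply, Finset.sum_eq_single t]
    · simp
    · intro r _ hr
      rw [Finsupp.single_apply, if_neg (fun hh => hr (inj hh))]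
    · simp
  rw [Finsupp.sum_of_support_subset (s := Finset.univ.image w),
    Finset.sum_image (fun a _ b _ hab => inj hab)]
  · simp only [ev]
  · intro v hv
    by_contra hcon
    rw [Finsupp.mem_support_iff] at hv
    apply hv
    rw [h, Finsupp.finsetSum_apply]
    refine Finset.sum_eq_zero fun t _ => ?_
    rw [Finsupp.single_apply, if_neg]
    rintro rfl
    exact hcon (Finset.mem_image_of_mem _ (Finset.mem_univ _))
  · simp

omit he in
theorem sum_smul_prodKet {T : Type*} (s : Finset T) (c : T → ℂ) (φ : T → ι → F → ℂ) :
    ∑ t ∈ s, c t • prodKet e (φ t) =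
      ∑ v : ι → F, Finsupp.single (basisAt e v) (∑ t ∈ s, c t * ∏ i, φ t i (v i)) := by
  unfold prodKet
  simp only [Finset.smul_sum, Finsupp.smul_single, smul_eq_mul]
  rw [Finset.sum_comm]
  simp only [single_finset_sum]

end ProductStates

/-! ### The program

Counters: `0` and `1` hold `n` and `k`, `6` stays `0`, `2`, `4` range over rows, `3`, `5` over
columns, `7` holds the column of a pivot.  Classical arrays: `0` is the matrix, `1` the output,
`3` the flags, `7` a right inverse of the reduced matrix (transposed), `4`, `5`, `9` scratch cells,
and `8` records that the rank is less than `k`.  Quantum arrays: `0` is a message `m`, the codeword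
register in the coordinates given by the rows of the matrix; `1` the noisy codeword; `2` the
flags. -/

section Program

/-- Prepare the superposition of all noisy codewords. -/
def prepProg : Cmd :=
  .seq (.loop 2 1 (.qft ⟨0, 2⟩)) <|
  .seq (.loop 3 0 (.noise ⟨1, 3⟩)) <|
  .loop 2 1 (.loop 3 0 (.cadd ⟨0, 2, 3⟩ ⟨0, 2⟩ ⟨1, 3⟩))

/-- Coherent unambiguous state discrimination of one symbol: rotate the flag in the Fourier basis,
measure it, return to the computational basis; a column that is lost is removed from the matrix. -/
def usdBody : Cmd :=
  .seq (.qft ⟨1, 3⟩) <|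
  .seq (.crot ⟨1, 3⟩ ⟨2, 3⟩) <|
  .seq (.meas ⟨3, 6, 3⟩ ⟨2, 3⟩) <|
  .ifZero ⟨3, 6, 3⟩ (.seq (.qft ⟨1, 3⟩) (.seq (.qft ⟨1, 3⟩) (.qft ⟨1, 3⟩)))
    (.loop 2 1 (.fzero ⟨0, 2, 3⟩))

def usdProg : Cmd := .loop 3 0 usdBody

/-- Find a nonzero entry of a row. -/
def searchProg : Cmd :=
  .seq (.fzero ⟨9, 6, 6⟩) <|
  .loop 3 0 (.ifZero ⟨0, 2, 3⟩ .skip (.seq (.copy 7 3) (.fone ⟨9, 6, 6⟩)))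

/-- Subtract a multiple of the pivot row from a row, and update the message accordingly. -/
def rowOp : Cmd :=
  .seq (.fmul ⟨4, 6, 6⟩ ⟨0, 4, 7⟩ ⟨7, 2, 7⟩) <|
  .seq (.cadd ⟨4, 6, 6⟩ ⟨0, 4⟩ ⟨0, 2⟩) <|
  .seq (.fneg ⟨4, 6, 6⟩ ⟨4, 6, 6⟩) <|
  .loop 5 0 (.seq (.fmul ⟨5, 6, 6⟩ ⟨4, 6, 6⟩ ⟨0, 2, 5⟩) (.fadd ⟨0, 4, 5⟩ ⟨0, 4, 5⟩ ⟨5, 6, 6⟩))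

/-- Clear the column of the pivot in all other rows. -/
def pivotProg : Cmd :=
  .seq (.finv ⟨7, 2, 7⟩ ⟨0, 2, 7⟩) <|
  .loop 4 1 (.ifLt 4 2 rowOp (.ifLt 2 4 rowOp .skip))

/-- Gauss-Jordan elimination. -/
def elimProg : Cmd :=
  .loop 2 1 (.seq searchProg (.ifZero ⟨9, 6, 6⟩ (.fone ⟨8, 6, 6⟩) pivotProg))

/-- Erase the message by coherent decoding. -/
def eraseProg : Cmd :=
  .loop 2 1 (.loop 3 0 (.seq (.fneg ⟨4, 6, 6⟩ ⟨7, 2, 3⟩) (.cadd ⟨4, 6, 6⟩ ⟨1, 3⟩ ⟨0, 2⟩)))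

/-- Fourier transform on the positions with flag `0`, and measurement. -/
def measBody : Cmd :=
  .seq (.ifZero ⟨3, 6, 3⟩ (.qft ⟨1, 3⟩) .skip) (.meas ⟨1, 6, 3⟩ ⟨1, 3⟩)

def measProg : Cmd := .loop 3 0 measBody

/-- Regev's reduction with coherent unambiguous state discrimination. -/
def regevProg : Cmd :=
  .seq prepProg <| .seq usdProg <| .seq elimProg <|
  .ifZero ⟨8, 6, 6⟩ (.seq eraseProg measProg) .skip

end Program

/-! ### Running time -/

section Time

/-- The program contains no incrementation. -/
def NoIncrement : Cmd → Prop
  | .succ _ => False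
  | .seq c d => NoIncrement c ∧ NoIncrement d
  | .ifZero _ c d => NoIncrement c ∧ NoIncrement d
  | .ifLt _ _ c d => NoIncrement c ∧ NoIncrement d
  | .loop _ _ c => NoIncrement c
  | _ => True

/-- Bound for the number of steps, in terms of a bound for the counters. -/
def costPoly : Cmd → Polynomial ℕ
  | .seq c d => costPoly c + costPoly d
  | .ifZero _ c d => 1 + (costPoly c + costPoly d)
  | .ifLt _ _ c d => 1 + (costPoly c + costPoly d)
  | .loop _ _ c => 1 + Polynomial.X * (1 + costPoly c)
  | _ => 1

variable {F : Type u} [Field F] [Fintype F] [DecidableEq F]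

theorem update_le {N : ℕ} {v : ℕ → ℕ} (h : ∀ x, v x ≤ N) (x : ℕ) {m : ℕ} (hm : m ≤ N) :
    ∀ y, Function.update v x m y ≤ N := by
  intro y
  by_cases hy : y = x
  · subst hy; simpa using hm
  · simpa [hy] using h y

theorem iter_time_le {body : Cfg F → Multiset (Cfg F)} {N T : ℕ} (x : ℕ)
    (hb : ∀ s, (∀ x, s.var x ≤ N) → ∀ t ∈ body s, (∀ x, t.var x ≤ N) ∧ t.time ≤ s.time + T)
    (m : ℕ) (hm : m ≤ N) (s : Cfg F) (hs : ∀ x, s.var x ≤ N) :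
    ∀ t ∈ iter body x m s, (∀ x, t.var x ≤ N) ∧ t.time ≤ s.time + m * (1 + T) := by
  induction m with
  | zero => intro t ht; rw [iter, Multiset.mem_singleton] at ht; subst ht; simpa using hs
  | succ m ih =>
    intro t ht
    rw [iter, Multiset.mem_bind] at ht
    obtain ⟨r, hr, ht⟩ := ht
    obtain ⟨h1, h2⟩ := ih (by omega) r hr
    obtain ⟨h3, h4⟩ := hb (r.setVar x m) (update_le h1 x (by omega)) t ht
    refine ⟨h3, ?_⟩
    have : (r.setVar x m).time = r.time + 1 := rfl
    rw [this] at h4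
    rw [Nat.succ_mul]
    omega

/-- Without increments a bound on the counters is preserved: a loop counter runs below its bound,
and every other operation resets, copies or decreases. Each loop thus has at most `N` iterations. -/
theorem run_time_le (ω : ℝ) (N : ℕ) (c : Cmd) (hc : NoIncrement c) (s : Cfg F)
    (hs : ∀ x, s.var x ≤ N) :
    ∀ t ∈ run ω c s, (∀ x, t.var x ≤ N) ∧ t.time ≤ s.time + (costPoly c).eval N := by
  induction c generalizing s with
  | succ x => exact hc.elim
  | zero x =>
    simp only [run, Multiset.mem_singleton, forall_eq, costPoly, Polynomial.eval_one]
    exact ⟨update_le hs x (Nat.zero_le _), le_rfl⟩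
  | copy x y =>
    simp only [run, Multiset.mem_singleton, forall_eq, costPoly, Polynomial.eval_one]
    exact ⟨update_le hs x (hs y), le_rfl⟩
  | pred x =>
    simp only [run, Multiset.mem_singleton, forall_eq, costPoly, Polynomial.eval_one]
    exact ⟨update_le hs x ((Nat.sub_le _ _).trans (hs x)), le_rfl⟩
  | meas a l =>
    simp only [run, Multiset.mem_map, costPoly, Polynomial.eval_one]
    rintro t ⟨v, -, rfl⟩
    exact ⟨hs, le_rfl⟩
  | seq c d ihc ihd =>
    intro t ht
    simp only [run, Multiset.mem_bind] at ht
    obtain ⟨r, hr, ht⟩ := ht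
    obtain ⟨h1, h2⟩ := ihc hc.1 s hs r hr
    obtain ⟨h3, h4⟩ := ihd hc.2 r h1 t ht
    refine ⟨h3, ?_⟩
    rw [costPoly, Polynomial.eval_add]
    omega
  | ifZero a c d ihc ihd =>
    intro t ht
    simp only [run] at ht
    rw [costPoly, Polynomial.eval_add, Polynomial.eval_add, Polynomial.eval_one]
    split_ifs at ht
    · obtain ⟨h1, h2⟩ := ihc hc.1 s.tick hs t ht
      refine ⟨h1, ?_⟩
      have : s.tick.time = s.time + 1 := rfl
      omega
    · obtain ⟨h1, h2⟩ := ihd hc.2 s.tick hs t ht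
      refine ⟨h1, ?_⟩
      have : s.tick.time = s.time + 1 := rfl
      omega
  | ifLt x y c d ihc ihd =>
    intro t ht
    simp only [run] at ht
    rw [costPoly, Polynomial.eval_add, Polynomial.eval_add, Polynomial.eval_one]
    split_ifs at ht
    · obtain ⟨h1, h2⟩ := ihc hc.1 s.tick hs t ht
      refine ⟨h1, ?_⟩
      have : s.tick.time = s.time + 1 := rfl
      omega
    · obtain ⟨h1, h2⟩ := ihd hc.2 s.tick hs t ht
      refine ⟨h1, ?_⟩
      have : s.tick.time = s.time + 1 := rfl
      omega
  | loop x y c ih =>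
    intro t ht
    simp only [run] at ht
    obtain ⟨h1, h2⟩ := iter_time_le x (fun s hs => ih hc s hs) (s.var y) (hs y) s.tick hs t ht
    refine ⟨h1, h2.trans ?_⟩
    have h3 : s.tick.time = s.time + 1 := rfl
    have h4 := Nat.mul_le_mul_right (1 + (costPoly c).eval N) (hs y)
    rw [costPoly, Polynomial.eval_add, Polynomial.eval_mul, Polynomial.eval_add,
      Polynomial.eval_one, Polynomial.eval_X]
    omega
  | _ =>
    simp only [run, Multiset.mem_singleton, forall_eq, costPoly, Polynomial.eval_one]
    exact ⟨hs, le_rfl⟩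

theorem haltsWithin_regevProg (ω : ℝ) {n k : ℕ} (hk : k ≤ n) (G : Matrix (Fin k) (Fin n) F) :
    HaltsWithin ω regevProg G ((costPoly regevProg).eval n) := by
  intro s hs
  have := (run_time_le ω n regevProg ?_ (initCfg G) ?_ s hs).2
  · simpa [initCfg] using this
  · simp [regevProg, prepProg, usdProg, usdBody, elimProg, searchProg, pivotProg, rowOp, eraseProg,
      measProg, measBody, NoIncrement]
  · intro x
    simp only [initCfg]
    split_ifs <;> omega

end Time

/-! ### Deterministic and branching execution -/

section Execution

variable {F : Type u} [Field F] [Fintype F] [DecidableEq F] {ω : ℝ}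

/-- The program `c`, started in `s`, does not branch, and its final configuration satisfies `Q`. -/
def Det (ω : ℝ) (c : Cmd) (s : Cfg F) (Q : Cfg F → Prop) : Prop :=
  ∃ t, run ω c s = {t} ∧ Q t

theorem Det.mono {c : Cmd} {s : Cfg F} {Q R : Cfg F → Prop} (h : Det ω c s Q)
    (hQ : ∀ t, Q t → R t) : Det ω c s R := by
  obtain ⟨t, ht, hq⟩ := h
  exact ⟨t, ht, hQ t hq⟩

theorem Det.seq {c d : Cmd} {s : Cfg F} {Q R : Cfg F → Prop} (hc : Det ω c s Q)
    (hd : ∀ t, Q t → Det ω d t R) : Det ω (.seq c d) s R := by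
  obtain ⟨t, ht, hq⟩ := hc
  obtain ⟨r, hr, hrr⟩ := hd t hq
  exact ⟨r, by rw [run, ht, Multiset.singleton_bind, hr], hrr⟩

theorem Det.ifZero_pos {a : CLoc} {c d : Cmd} {s : Cfg F} {Q : Cfg F → Prop} (h : s.get a = 0)
    (hc : Det ω c s.tick Q) : Det ω (.ifZero a c d) s Q := by
  obtain ⟨t, ht, hq⟩ := hc
  exact ⟨t, by rw [run, if_pos h, ht], hq⟩

theorem Det.ifZero_neg {a : CLoc} {c d : Cmd} {s : Cfg F} {Q : Cfg F → Prop} (h : s.get a ≠ 0)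
    (hd : Det ω d s.tick Q) : Det ω (.ifZero a c d) s Q := by
  obtain ⟨t, ht, hq⟩ := hd
  exact ⟨t, by rw [run, if_neg h, ht], hq⟩

theorem Det.ifLt_pos {x y : ℕ} {c d : Cmd} {s : Cfg F} {Q : Cfg F → Prop} (h : s.var x < s.var y)
    (hc : Det ω c s.tick Q) : Det ω (.ifLt x y c d) s Q := by
  obtain ⟨t, ht, hq⟩ := hc
  exact ⟨t, by rw [run, if_pos h, ht], hq⟩

theorem Det.ifLt_neg {x y : ℕ} {c d : Cmd} {s : Cfg F} {Q : Cfg F → Prop}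
    (h : ¬ s.var x < s.var y) (hd : Det ω d s.tick Q) : Det ω (.ifLt x y c d) s Q := by
  obtain ⟨t, ht, hq⟩ := hd
  exact ⟨t, by rw [run, if_neg h, ht], hq⟩

/-- The invariant rule for loops. `I j` describes the state before iteration `j`, when the loop
counter has not yet been set to `j`. -/
theorem Det.loop {x y : ℕ} {c : Cmd} {s : Cfg F} {m : ℕ} (hm : s.var y = m)
    (I : ℕ → Cfg F → Prop) (h0 : I 0 s.tick)
    (hs : ∀ j < m, ∀ t, I j t → Det ω c (t.setVar x j) (I (j + 1))) :
    Det ω (.loop x y c) s (I m) := by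
  have : ∀ j ≤ m, ∃ t, iter (run ω c) x j s.tick = {t} ∧ I j t := by
    intro j
    induction j with
    | zero => exact fun _ => ⟨_, rfl, h0⟩
    | succ j ih =>
      intro hj
      obtain ⟨t, ht, hI⟩ := ih (by omega)
      obtain ⟨r, hr, hrr⟩ := hs j (by omega) t hI
      exact ⟨r, by rw [iter, ht, Multiset.singleton_bind, hr], hrr⟩
  obtain ⟨t, ht, hI⟩ := this m le_rfl
  exact ⟨t, by rw [run, hm, ht], hI⟩

/-- The sum of `Φ` over the final configurations. -/
def expect (ω : ℝ) (c : Cmd) (Φ : Cfg F → ℝ) (s : Cfg F) : ℝ := ((run ω c s).map Φ).sum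

theorem expect_seq (c d : Cmd) (Φ : Cfg F → ℝ) (s : Cfg F) :
    expect ω (.seq c d) Φ s = expect ω c (expect ω d Φ) s := by
  unfold expect
  rw [run, Multiset.map_bind, Multiset.sum_bind]

theorem Det.expect_eq {c : Cmd} {s : Cfg F} {Q : Cfg F → Prop} (h : Det ω c s Q) {Φ : Cfg F → ℝ}
    {a : ℝ} (hΦ : ∀ t, Q t → Φ t = a) : expect ω c Φ s = a := by
  obtain ⟨t, ht, hq⟩ := h
  rw [expect, ht, Multiset.map_singleton, Multiset.sum_singleton, hΦ t hq]

/-- The program `c`, started in `s`, has one branch for every symbol `v`, whose final configuration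
satisfies `Q v`. -/
def Branches (ω : ℝ) (c : Cmd) (s : Cfg F) (Q : F → Cfg F → Prop) : Prop :=
  ∃ τ : F → Cfg F, run ω c s = (Finset.univ : Finset F).val.map τ ∧ ∀ v, Q v (τ v)

theorem Det.seq_branches {c d : Cmd} {s : Cfg F} {Q : Cfg F → Prop} {R : F → Cfg F → Prop}
    (hc : Det ω c s Q) (hd : ∀ t, Q t → Branches ω d t R) : Branches ω (.seq c d) s R := by
  obtain ⟨t, ht, hq⟩ := hc
  obtain ⟨r, hr, hrr⟩ := hd t hq
  exact ⟨r, by rw [run, ht, Multiset.singleton_bind, hr], hrr⟩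

theorem Branches.seq {c d : Cmd} {s : Cfg F} {Q R : F → Cfg F → Prop}
    (hc : Branches ω c s Q) (hd : ∀ v t, Q v t → Det ω d t (R v)) : Branches ω (.seq c d) s R := by
  obtain ⟨τ, ht, hq⟩ := hc
  choose ρ hρ hR using fun v => hd v (τ v) (hq v)
  refine ⟨ρ, ?_, hR⟩
  rw [run, ht, Multiset.bind_map]
  simp only [hρ, Multiset.bind_singleton]

/-- A loop with one measurement per iteration, whose outcomes are collected in `y`. -/
theorem expect_loop {n x z : ℕ} {c : Cmd} {s : Cfg F} (hz : s.var z = n)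
    (I : ℕ → (Fin n → F) → Cfg F → Prop) (h0 : I 0 0 s.tick)
    (hs : ∀ j (hj : j < n) y t, (∀ i : Fin n, j ≤ i → y i = 0) → I j y t →
      Branches ω c (t.setVar x j) fun v => I (j + 1) (Function.update y ⟨j, hj⟩ v))
    {Φ : Cfg F → ℝ} {g : (Fin n → F) → ℝ} (hg : ∀ y t, I n y t → Φ t = g y) :
    expect ω (.loop x z c) Φ s = ∑ y, g y := by
  -- After `m` iterations the branches are indexed by outcome vectors that vanish from position `m`
  -- on. `Φ` and `g` are quantified here because the induction step replaces `Φ` by its expectation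
  -- over one further iteration.
  have key : ∀ m ≤ n, ∀ (Φ : Cfg F → ℝ) (g : (Fin n → F) → ℝ),
      (∀ y t, (∀ i : Fin n, m ≤ i → y i = 0) → I m y t → Φ t = g y) →
      ((iter (run ω c) x m s.tick).map Φ).sum =
        ∑ y ∈ Finset.univ.filter (fun y : Fin n → F => ∀ i : Fin n, m ≤ i → y i = 0), g y := by
    intro m
    induction m with
    | zero =>
      intro _ Φ g h
      have : Finset.univ.filter (fun y : Fin n → F => ∀ i : Fin n, 0 ≤ (i : ℕ) → y i = 0) = {0} := by
        ext y
        simp only [Finset.mem_filter, Finset.mem_univ, true_and, Finset.mem_singleton,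
          Nat.zero_le, forall_true_left]
        exact funext_iff.symm
      rw [this, Finset.sum_singleton, iter, Multiset.map_singleton, Multiset.sum_singleton]
      exact h 0 _ (fun _ _ => rfl) h0
    | succ m ih =>
      intro hm Φ g h
      rw [iter, Multiset.map_bind, Multiset.sum_bind]
      rw [ih (by omega) (fun t => ((run ω c (t.setVar x m)).map Φ).sum)
        (fun y => ∑ v, g (Function.update y ⟨m, hm⟩ v))]
      · rw [← Finset.sum_product']
        refine Finset.sum_bij' (fun p _ => Function.update p.1 ⟨m, hm⟩ p.2)
          (fun y _ => (Function.update y ⟨m, hm⟩ 0, y ⟨m, hm⟩)) ?_ ?_ ?_ ?_ ?_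
        · rintro ⟨y, v⟩ hp
          simp only [Finset.mem_product, Finset.mem_filter, Finset.mem_univ, true_and, and_true]
            at hp ⊢
          intro i hi
          rw [Function.update_of_ne (by rintro rfl; simp at hi)]
          exact hp i (by omega)
        · intro y hy
          simp only [Finset.mem_product, Finset.mem_filter, Finset.mem_univ, true_and, and_true]
            at hy ⊢
          intro i hi
          by_cases him : i = ⟨m, hm⟩
          · subst him; simp
          · rw [Function.update_of_ne him]
            refine hy i ?_
            have : (i : ℕ) ≠ m := fun hh => him (Fin.ext hh)
            omega
        · rintro ⟨y, v⟩ hp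
          simp only [Finset.mem_product, Finset.mem_filter, Finset.mem_univ, true_and, and_true]
            at hp
          ext1
          · simp only [Function.update_idem]
            rw [← hp ⟨m, hm⟩ le_rfl, Function.update_eq_self]
          · simp
        · intro y hy
          simp
        · rintro ⟨y, v⟩ hp
          rfl
      · intro y t hy hI
        obtain ⟨τ, hτ, hQ⟩ := hs m hm y t hy hI
        rw [hτ, Multiset.map_map]
        refine Finset.sum_congr rfl fun v _ => h _ _ ?_ (hQ v)
        intro i hi
        rw [Function.update_of_ne (by rintro rfl; simp at hi)]
        exact hy i (by omega)
  have := key n le_rfl Φ g (fun y t _ hI => hg y t hI)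
  rw [expect, run, hz, this]
  congr 1
  ext y
  simp only [Finset.mem_filter, Finset.mem_univ, true_and, iff_true]
  intro i hi
  exact absurd i.2 (by omega)

end Execution

/-! ### The quantum memory of the program -/

section Ensemble

variable {F : Type u} [Field F] [Fintype F] [DecidableEq F] {n k : ℕ} {ω : ℝ}

/-- The quantum cells which the program uses: message, word, flags. -/
abbrev Cell (n k : ℕ) : Type := Fin k ⊕ Fin n ⊕ Fin n

/-- The address of a cell. -/
def cellAddr : Cell n k → ℕ × ℕ
  | .inl i => (0, i)
  | .inr (.inl j) => (1, j)
  | .inr (.inr j) => (2, j)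

theorem cellAddr_injective : Function.Injective (cellAddr (n := n) (k := k)) := by
  rintro (a | a | a) (b | b | b) h <;> simp [cellAddr, Fin.ext_iff] at h ⊢ <;> exact h

/-- The message `m`, the states `f j` of the symbols of the word, the flags `b`. -/
def cellState (m : Fin k → F) (f : Fin n → F → ℂ) (b : Fin n → F) : Cell n k → F → ℂ :=
  Sum.elim (fun i => Pi.single (m i) 1) (Sum.elim f fun j => Pi.single (b j) 1)

theorem update_cellState_msg (m : Fin k → F) (f : Fin n → F → ℂ) (b : Fin n → F) (i : Fin k)
    (a : F) : Function.update (cellState m f b) (.inl i) (Pi.single a 1) =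
      cellState (Function.update m i a) f b := by
  unfold cellState
  rw [Sum.update_elim_inl]
  congr 1
  funext c
  exact (Function.apply_update (fun _ a => (Pi.single a 1 : F → ℂ)) m i a c).symm

theorem update_cellState_word (m : Fin k → F) (f : Fin n → F → ℂ) (b : Fin n → F) (j : Fin n)
    (g : F → ℂ) : Function.update (cellState m f b) (.inr (.inl j)) g =
      cellState m (Function.update f j g) b := by
  unfold cellState
  rw [Sum.update_elim_inr, Sum.update_elim_inl]

theorem update_cellState_flag (m : Fin k → F) (f : Fin n → F → ℂ) (b : Fin n → F) (j : Fin n)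
    (a : F) : Function.update (cellState m f b) (.inr (.inr j)) (Pi.single a 1) =
      cellState m f (Function.update b j a) := by
  unfold cellState
  rw [Sum.update_elim_inr, Sum.update_elim_inr]
  congr 2
  funext c
  exact (Function.apply_update (fun _ a => (Pi.single a 1 : F → ℂ)) b j a c).symm

/-- A superposition, over `t ∈ F^k` with amplitudes `c t`, of product states with message `μ t`
and flags `b`. -/
def ensemble (c : (Fin k → F) → ℂ) (μ : (Fin k → F) → Fin k → F)
    (f : (Fin k → F) → Fin n → F → ℂ) (b : Fin n → F) : (ℕ × ℕ → F) →₀ ℂ :=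
  ∑ t, c t • prodKet cellAddr (cellState (μ t) (f t) b)

variable (c : (Fin k → F) → ℂ) (μ : (Fin k → F) → Fin k → F)
  (f : (Fin k → F) → Fin n → F → ℂ) (b : Fin n → F)

theorem gate1_ensemble (M : Matrix F F ℂ) (j : Fin n) :
    gate1 M (1, (j : ℕ)) (ensemble c μ f b) =
      ensemble c μ (fun t => Function.update (f t) j fun y => ∑ x, M y x * f t j x) b := by
  unfold ensemble
  rw [gate1_sum_smul]
  refine Finset.sum_congr rfl fun t _ => ?_
  have := gate1_prodKet cellAddr_injective M (cellState (μ t) (f t) b) (.inr (.inl j))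
  rw [update_cellState_word] at this
  exact congrArg _ this

theorem shift_single (a d : F) :
    (fun y => (Pi.single a 1 : F → ℂ) (y - d)) = Pi.single (a + d) 1 := by
  funext y
  simp [Pi.single_apply, sub_eq_iff_eq_add]

theorem cadd_ensemble_msg_word (a : F) (i : Fin k) (j : Fin n) :
    gate2 (caddMatrix a) (0, (i : ℕ)) (1, (j : ℕ)) (ensemble c μ f b) =
      ensemble c μ (fun t => Function.update (f t) j fun y => f t j (y - a * μ t i)) b := by
  unfold ensemble
  rw [gate2_sum_smul]
  refine Finset.sum_congr rfl fun t _ => ?_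
  have := cadd_prodKet cellAddr_injective (i := Sum.inl i) (j := .inr (.inl j)) (by simp) a
    (cellState (μ t) (f t) b) (μ t i) rfl
  rw [update_cellState_word] at this
  exact congrArg _ this

theorem cadd_ensemble_msg (a : F) {i' i : Fin k} (h : i' ≠ i) :
    gate2 (caddMatrix a) (0, (i' : ℕ)) (0, (i : ℕ)) (ensemble c μ f b) =
      ensemble c (fun t => Function.update (μ t) i (μ t i + a * μ t i')) f b := by
  unfold ensemble
  rw [gate2_sum_smul]
  refine Finset.sum_congr rfl fun t _ => ?_
  have := cadd_prodKet cellAddr_injective (i := Sum.inl i') (j := .inl i) (by simpa using h) a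
    (cellState (μ t) (f t) b) (μ t i') rfl
  have e : cellState (μ t) (f t) b (Sum.inl i) = Pi.single (μ t i) 1 := rfl
  rw [e, shift_single, update_cellState_msg] at this
  exact congrArg _ this

theorem cadd_ensemble_word_msg (a : F) (j : Fin n) (i : Fin k) (ξ : (Fin k → F) → F)
    (h : ∀ t, f t j = Pi.single (ξ t) 1) :
    gate2 (caddMatrix a) (1, (j : ℕ)) (0, (i : ℕ)) (ensemble c μ f b) =
      ensemble c (fun t => Function.update (μ t) i (μ t i + a * ξ t)) f b := by
  unfold ensemble
  rw [gate2_sum_smul]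
  refine Finset.sum_congr rfl fun t _ => ?_
  have := cadd_prodKet cellAddr_injective (i := .inr (.inl j)) (j := .inl i) (by simp) a
    (cellState (μ t) (f t) b) (ξ t) (h t)
  have e : cellState (μ t) (f t) b (Sum.inl i) = Pi.single (μ t i) 1 := rfl
  rw [e, shift_single, update_cellState_msg] at this
  exact congrArg _ this

theorem filter_ensemble_word (j : Fin n) (y : F) :
    (ensemble c μ f b).filter (fun w => w (1, (j : ℕ)) = y) =
      ensemble (fun t => c t * f t j y) μ
        (fun t => Function.update (f t) j (Pi.single y 1)) b := by
  unfold ensemble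
  rw [filter_sum_smul]
  refine Finset.sum_congr rfl fun t _ => ?_
  have := filter_prodKet cellAddr_injective (cellState (μ t) (f t) b) (.inr (.inl j)) y
  rw [update_cellState_word] at this
  rw [mul_smul]
  exact congrArg _ this

theorem ensemble_update_smul (j : Fin n) (d : (Fin k → F) → ℂ) (g : (Fin k → F) → F → ℂ) :
    ensemble c μ (fun t => Function.update (f t) j (d t • g t)) b =
      ensemble (fun t => c t * d t) μ (fun t => Function.update (f t) j (g t)) b := by
  unfold ensemble
  refine Finset.sum_congr rfl fun t _ => ?_
  rw [← update_cellState_word, ← update_cellState_word, prodKet_update_smul, smul_smul]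

variable (F) in
/-- The rotation of the flag, given the symbol `a`. -/
def flagGate (ω : ℝ) (a : F) : Matrix F F ℂ := fun y x =>
  if a = 0 then ((rotLevels F (usdCos F ω) y x : ℝ) : ℂ) else if y = x then 1 else 0

theorem filter_crot_ensemble (j : Fin n) (y : F) (hb : b j = 0) :
    (gate2 (crotMatrix F ω) (1, (j : ℕ)) (2, (j : ℕ)) (ensemble c μ f b)).filter
        (fun w => w (2, (j : ℕ)) = y) =
      ensemble c μ (fun t => Function.update (f t) j fun a => flagGate F ω a y 0 * f t j a)
        (Function.update b j y) := by
  unfold ensemble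
  rw [gate2_sum_smul, filter_sum_smul]
  refine Finset.sum_congr rfl fun t _ => ?_
  have := filter_gate2_prodKet cellAddr_injective (crotMatrix F ω) (flagGate F ω)
    (fun y x => rfl) (i := .inr (.inl j)) (j := .inr (.inr j)) (by simp)
    (cellState (μ t) (f t) b) (by simp [cellState, hb]) y
  rw [update_cellState_word, update_cellState_flag] at this
  exact congrArg _ this

/-- Rewrites an unentangled message register as a superposition over messages, the form in which the
register can then be entangled with the word. -/
theorem sum_smul_cellState (α : Fin k → F → ℂ) (f : Fin n → F → ℂ) :
    prodKet cellAddr (Sum.elim α (Sum.elim f fun j => Pi.single (b j) 1)) =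
      ∑ t : Fin k → F, (∏ i, α i (t i)) • prodKet cellAddr (cellState t f b) := by
  rw [sum_smul_prodKet, prodKet]
  refine Finset.sum_congr rfl fun v _ => ?_
  congr 1
  rw [Fintype.prod_sum_type, Finset.sum_eq_single (fun i => v (.inl i))]
  · rw [Fintype.prod_sum_type]
    simp [cellState]
  · intro t _ ht
    obtain ⟨i, hi⟩ := Function.ne_iff.mp ht
    rw [Finset.prod_eq_zero (Finset.mem_univ (Sum.inl i)), mul_zero]
    simp only [cellState, Sum.elim_inl]
    exact Pi.single_eq_of_ne (Ne.symm hi) _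
  · simp

theorem prodKet_basis {ι : Type*} [Fintype ι] [DecidableEq ι] (e : ι → ℕ × ℕ) (w : ι → F) :
    prodKet e (fun i => Pi.single (w i) 1) = Finsupp.single (basisAt e w) 1 := by
  unfold prodKet
  rw [Finset.sum_eq_single w]
  · simp
  · intro v _ hv
    obtain ⟨i, hi⟩ := Function.ne_iff.mp hv
    rw [Finset.prod_eq_zero (Finset.mem_univ i) (Pi.single_eq_of_ne hi _), Finsupp.single_zero]
  · simp

end Ensemble

/-! ### Gates on single symbols -/

section Symbols

variable {F : Type u} [Field F] [Fintype F] [DecidableEq F] {ω : ℝ}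

theorem noise_single (h0 : 0 ≤ ω) (h1 : ω ≤ ((Fintype.card F : ℝ) - 1) / Fintype.card F) (y : F) :
    ∑ x, noiseMatrix F ω y x * (Pi.single 0 1 : F → ℂ) x = (noiseAmp ω y : ℂ) := by
  have hq := one_lt_card_real F
  have hω := lt_one_of_le_card h1
  have hs := Real.sq_sqrt (show 0 ≤ 1 - ω by linarith)
  have hv : ∑ t : F, ((if t = 0 then 1 else 0) - noiseAmp ω t) ^ 2 = 2 * (1 - √(1 - ω)) := by
    have e : ∀ t : F, ((if t = 0 then 1 else 0) - noiseAmp ω t) ^ 2 =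
        if t = 0 then (1 - √(1 - ω)) ^ 2 else ω / ((Fintype.card F : ℝ) - 1) := by
      intro t
      split_ifs with ht
      · rw [ht, noiseAmp_zero]
      · rw [noiseAmp_of_ne ht, zero_sub, neg_sq,
          Real.sq_sqrt (div_nonneg h0 (by linarith))]
    simp only [e]
    rw [sum_ite_eq_zero, mul_div_cancel₀ _ (by linarith)]
    linear_combination hs
  rw [Finset.sum_eq_single 0 (fun x _ hx => by rw [Pi.single_eq_of_ne hx, mul_zero]) (by simp),
    Pi.single_eq_same, mul_one]
  simp only [noiseMatrix]
  rw [hv, noiseAmp_zero, if_true]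
  congr 1
  -- The degenerate case is `ω = 0`: the two states coincide, the vector of the reflection is zero,
  -- and the convention `2 / 0 = 0` makes the gate the identity.
  by_cases hz : 1 - √(1 - ω) = 0
  · have hω0 : ω = 0 := by
      have : √(1 - ω) = 1 := by linarith
      rw [this] at hs
      linarith
    rw [hz, noiseAmp, hω0]
    simp
  · field_simp
    ring

/-- The Fourier transform of the state of one symbol. -/
def qftOp (g : F → ℂ) : F → ℂ := fun y => ∑ x, qftMatrix F y x * g x

theorem qftOp_single (c : F) : qftOp (Pi.single c 1) = fun y => qftMatrix F y c := by
  funext y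
  simp [qftOp, Pi.single_apply]

theorem qftMatrix_apply (y x : F) :
    qftMatrix F y x = ((1 / √(Fintype.card F : ℝ) : ℝ) : ℂ) * traceChar F (y * x) := by
  simp [qftMatrix, chi]

theorem qftMatrix_zero (y : F) : qftMatrix F y 0 = ((1 / √(Fintype.card F : ℝ) : ℝ) : ℂ) := by
  simp [qftMatrix_apply]

theorem sqrt_card_mul_self : ((1 / √(Fintype.card F : ℝ) : ℝ) : ℂ) *
    ((1 / √(Fintype.card F : ℝ) : ℝ) : ℂ) * (Fintype.card F : ℂ) = 1 := by
  have hq := one_lt_card_real F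
  have : (1 / √(Fintype.card F : ℝ)) * (1 / √(Fintype.card F : ℝ)) * (Fintype.card F : ℝ) = 1 := by
    rw [div_mul_div_comm, Real.mul_self_sqrt (by linarith)]
    field_simp
  exact_mod_cast this

theorem qftOp_qftOp (g : F → ℂ) (y : F) : qftOp (qftOp g) y = g (-y) := by
  unfold qftOp
  simp only [Finset.mul_sum]
  rw [Finset.sum_comm, Finset.sum_eq_single (-y)]
  · have e : ∀ x : F, qftMatrix F y x * (qftMatrix F x (-y) * g (-y)) =
        ((1 / √(Fintype.card F : ℝ) : ℝ) : ℂ) * ((1 / √(Fintype.card F : ℝ) : ℝ) : ℂ) *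
          g (-y) := by
      intro x
      have : traceChar F (y * x) * traceChar F (x * -y) = 1 := by
        rw [← traceChar_add, show y * x + x * -y = 0 by ring, traceChar_zero]
      rw [qftMatrix_apply, qftMatrix_apply]
      linear_combination ((1 / √(Fintype.card F : ℝ) : ℝ) : ℂ) *
        ((1 / √(Fintype.card F : ℝ) : ℝ) : ℂ) * g (-y) * this
    simp only [e]
    rw [Finset.sum_const, Finset.card_univ, nsmul_eq_mul]
    linear_combination g (-y) * sqrt_card_mul_self (F := F)
  · intro z _ hz
    have h := sum_traceChar_mul (y + z)
    rw [if_neg (fun h => hz (eq_neg_of_add_eq_zero_right h))] at h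
    calc ∑ x, qftMatrix F y x * (qftMatrix F x z * g z)
        = ((1 / √(Fintype.card F : ℝ) : ℝ) : ℂ) * ((1 / √(Fintype.card F : ℝ) : ℝ) : ℂ) * g z *
          ∑ x, traceChar F (x * (y + z)) := by
          rw [Finset.mul_sum]
          refine Finset.sum_congr rfl fun x _ => ?_
          rw [qftMatrix_apply, qftMatrix_apply, mul_add, traceChar_add, mul_comm y x]
          ring
      _ = 0 := by rw [h, mul_zero]
  · simp

/-- The square of the transform is `x ↦ -x`. Three further transforms therefore undo a first one,
and the machine needs no inverse gate. -/
theorem qftOp_four (g : F → ℂ) : qftOp (qftOp (qftOp (qftOp g))) = g := by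
  funext y
  rw [qftOp_qftOp, qftOp_qftOp, neg_neg]

/-- The shift by `c` becomes the phase; what is left is the transform of the unshifted noise, a
constant plus a point mass at `0`. -/
theorem qftOp_noise (h0 : 0 ≤ ω) (h1 : ω ≤ ((Fintype.card F : ℝ) - 1) / Fintype.card F) (c y : F) :
    qftOp (fun x => (noiseAmp ω (x - c) : ℂ)) y =
      (if y = 0 then (√(1 - perp F ω) : ℂ) else (dualAmp F ω : ℂ)) * traceChar F (y * c) := by
  have hq := one_lt_card_real F
  have hs : √(Fintype.card F : ℝ) ≠ 0 := (Real.sqrt_pos.2 (by linarith)).ne'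
  have e1 : qftOp (fun x => (noiseAmp ω (x - c) : ℂ)) y =
      ((1 / √(Fintype.card F : ℝ) : ℝ) : ℂ) * traceChar F (y * c) *
        ∑ z : F, traceChar F (z * y) * (noiseAmp ω z : ℂ) := by
    rw [qftOp, Finset.mul_sum]
    refine Fintype.sum_equiv (Equiv.subRight c) _ _ fun x => ?_
    rw [qftMatrix_apply, Equiv.subRight_apply]
    have : traceChar F (y * x) = traceChar F (y * c) * traceChar F ((x - c) * y) := by
      rw [← traceChar_add]; congr 1; ring
    rw [this]; ring
  rw [e1]
  split_ifs with hy
  · subst hy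
    have : ∑ z : F, traceChar F (z * 0) * (noiseAmp ω z : ℂ) =
        ((√(Fintype.card F) * √(1 - perp F ω) : ℝ) : ℂ) := by
      rw [← sum_noiseAmp h0 h1]; simp
    rw [this, mul_right_comm, ← Complex.ofReal_mul]
    congr 2
    field_simp
  · have : ∑ z : F, traceChar F (z * y) * (noiseAmp ω z : ℂ) =
        ((√(Fintype.card F) * dualAmp F ω : ℝ) : ℂ) := by
      rw [← noiseAmp_zero_sub (one_ne_zero (α := F)) h0 h1]
      have e : ∀ z : F, traceChar F (z * y) * (noiseAmp ω z : ℂ) =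
          traceChar F (z * y) * (noiseAmp ω (1 : F) : ℂ) +
          if z = 0 then ((noiseAmp ω (0 : F) - noiseAmp ω (1 : F) : ℝ) : ℂ) else 0 := by
        intro z
        split_ifs with hz
        · subst hz; simp
        · rw [noiseAmp_of_ne hz, noiseAmp_of_ne (one_ne_zero (α := F)), add_zero]
      simp only [e]
      rw [Finset.sum_add_distrib, ← Finset.sum_mul, sum_traceChar_mul, if_neg hy]
      simp
    rw [this, mul_right_comm, ← Complex.ofReal_mul]
    congr 2
    field_simp

variable (F) in
/-- The square root of the probability of the flag `v`. -/
def flagAmp (ω : ℝ) (v : F) : ℝ :=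
  if v = 0 then √(usdProb F ω) else if v = 1 then √(1 - usdProb F ω) else 0

theorem sqrt_usdProb : √(usdProb F ω) = √(Fintype.card F) * dualAmp F ω := by
  have hq := one_lt_card_real F
  rw [usdProb_eq, Real.sqrt_mul (by linarith), Real.sqrt_sq dualAmp_nonneg]

/-- State discrimination seen in the Fourier basis. Flag `0` flattens all amplitudes to `dualAmp`,
giving the transform of `|c⟩`. A nonzero flag can arise only at frequency zero, where the phase of
`c` is trivial. -/
theorem flagGate_qftOp_noise (h0 : 0 ≤ ω) (h1 : ω ≤ ((Fintype.card F : ℝ) - 1) / Fintype.card F)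
    (c v : F) :
    (fun a => flagGate F ω a v 0 * qftOp (fun x => (noiseAmp ω (x - c) : ℂ)) a) =
      (flagAmp F ω v : ℂ) • if v = 0 then qftOp (Pi.single c 1) else Pi.single 0 1 := by
  have hq := one_lt_card_real F
  have hs : √(Fintype.card F : ℝ) ≠ 0 := (Real.sqrt_pos.2 (by linarith)).ne'
  funext a
  rw [qftOp_noise h0 h1, Pi.smul_apply, smul_eq_mul]
  unfold flagGate flagAmp
  by_cases hv : v = 0
  · subst hv
    rw [if_pos rfl, if_pos rfl, if_pos rfl, qftOp_single, sqrt_usdProb]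
    beta_reduce
    rw [qftMatrix_apply]
    rw [← mul_assoc, ← mul_assoc, ← Complex.ofReal_mul]
    congr 1
    have e : √(Fintype.card F : ℝ) * dualAmp F ω * (1 / √(Fintype.card F : ℝ)) = dualAmp F ω := by
      field_simp
    rw [e]
    split_ifs with ha
    · rw [← usdCos_mul h0 h1]
      simp [rotLevels, rot]
    · simp
  · rw [if_neg hv, if_neg hv]
    by_cases ha : a = 0
    · subst ha
      simp only [if_true, rotLevels, hv, if_false, zero_mul, traceChar_zero, mul_one,
        Pi.single_eq_same]
      split_ifs with hv1
      · rw [← usdSin_mul h0 h1]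
        simp [rot]
      · simp
    · rw [if_neg ha, if_neg hv, Pi.single_eq_of_ne ha]
      simp

end Symbols

/-! ### Preparation of the state and state discrimination -/

section Preparation

variable {F : Type u} [Field F] [Fintype F] [DecidableEq F] {n k : ℕ} {ω : ℝ}

/-- The classical memory: matrix `A`, pivots `E`, flags `b`, output `y`, and `β ≠ 0` if the rank has
been found to be less than `k`. -/
structure Frame (A E : Matrix (Fin k) (Fin n) F) (b y : Fin n → F) (β : F) (s : Cfg F) : Prop where
  var_n : s.var 0 = n
  var_k : s.var 1 = k
  var_z : s.var 6 = 0
  mat : ∀ (i : Fin k) (j : Fin n), s.mem 0 i j = A i j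
  out : ∀ j : Fin n, s.mem 1 0 j = y j
  flag : ∀ j : Fin n, s.mem 3 0 j = b j
  piv : ∀ (i : Fin k) (j : Fin n), s.mem 7 i j = E i j
  bad : s.mem 8 0 0 = β

variable {A E : Matrix (Fin k) (Fin n) F} {b y : Fin n → F} {β : F} {s : Cfg F}

theorem Frame.tick (h : Frame A E b y β s) : Frame A E b y β s.tick :=
  ⟨h.1, h.2, h.3, h.4, h.5, h.6, h.7, h.8⟩

theorem Frame.setKet (h : Frame A E b y β s) (ψ : (ℕ × ℕ → F) →₀ ℂ) :
    Frame A E b y β (s.setKet ψ) :=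
  ⟨h.1, h.2, h.3, h.4, h.5, h.6, h.7, h.8⟩

theorem Frame.setVar (h : Frame A E b y β s) {x : ℕ} (m : ℕ) (hx : x ≠ 0 ∧ x ≠ 1 ∧ x ≠ 6) :
    Frame A E b y β (s.setVar x m) :=
  ⟨(Function.update_of_ne hx.1.symm _ _).trans h.1,
    (Function.update_of_ne hx.2.1.symm _ _).trans h.2,
    (Function.update_of_ne hx.2.2.symm _ _).trans h.3, h.4, h.5, h.6, h.7, h.8⟩

theorem mem_set_of_ne (s : Cfg F) (a : CLoc) (v : F) {c : ℕ} (hc : c ≠ a.arr) (i j : ℕ) :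
    (s.set a v).mem c i j = s.mem c i j := if_neg fun h => hc h.1

theorem Frame.set_scratch (h : Frame A E b y β s) {a : CLoc} (v : F)
    (ha : a.arr = 4 ∨ a.arr = 5 ∨ a.arr = 9) : Frame A E b y β (s.set a v) := by
  refine ⟨h.1, h.2, h.3, fun i j => ?_, fun j => ?_, fun j => ?_, fun i j => ?_, ?_⟩ <;>
    rw [mem_set_of_ne _ _ _ (by rcases ha with ha | ha | ha <;> rw [ha] <;> decide)]
  · exact h.mat i j
  · exact h.out j
  · exact h.flag j
  · exact h.piv i j
  · exact h.bad

theorem Frame.set_mat (h : Frame A E b y β s) {r c : ℕ} (v : F) {i : Fin k} {j : Fin n}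
    (hr : s.var r = i) (hc : s.var c = j) :
    Frame (fun i' j' => if i' = i ∧ j' = j then v else A i' j') E b y β (s.set ⟨0, r, c⟩ v) := by
  refine ⟨h.1, h.2, h.3, fun i' j' => ?_, fun j => ?_, fun j => ?_, fun i j => ?_, ?_⟩
  · simp only [Cfg.set, hr, hc, h.mat, true_and, Fin.val_inj]
  · exact (mem_set_of_ne _ _ _ (by simp) _ _).trans (h.out j)
  · exact (mem_set_of_ne _ _ _ (by simp) _ _).trans (h.flag j)
  · exact (mem_set_of_ne _ _ _ (by simp) _ _).trans (h.piv i j)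
  · exact (mem_set_of_ne _ _ _ (by simp) _ _).trans h.bad

theorem Frame.set_piv (h : Frame A E b y β s) {r c : ℕ} (v : F) {i : Fin k} {j : Fin n}
    (hr : s.var r = i) (hc : s.var c = j) :
    Frame A (fun i' j' => if i' = i ∧ j' = j then v else E i' j') b y β (s.set ⟨7, r, c⟩ v) := by
  refine ⟨h.1, h.2, h.3, fun i j => ?_, fun j => ?_, fun j => ?_, fun i' j' => ?_, ?_⟩
  · exact (mem_set_of_ne _ _ _ (by simp) _ _).trans (h.mat i j)
  · exact (mem_set_of_ne _ _ _ (by simp) _ _).trans (h.out j)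
  · exact (mem_set_of_ne _ _ _ (by simp) _ _).trans (h.flag j)
  · simp only [Cfg.set, hr, hc, h.piv, true_and, Fin.val_inj]
  · exact (mem_set_of_ne _ _ _ (by simp) _ _).trans h.bad

theorem Frame.set_flag (h : Frame A E b y β s) {c : ℕ} (v : F) {j : Fin n} (hc : s.var c = j) :
    Frame A E (Function.update b j v) y β (s.set ⟨3, 6, c⟩ v) := by
  refine ⟨h.1, h.2, h.3, fun i j => ?_, fun j => ?_, fun j' => ?_, fun i' j' => ?_, ?_⟩
  · exact (mem_set_of_ne _ _ _ (by simp) _ _).trans (h.mat i j)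
  · exact (mem_set_of_ne _ _ _ (by simp) _ _).trans (h.out j)
  · simp only [Cfg.set, h.var_z, hc, h.flag, true_and]
    by_cases hj : j' = j
    · subst hj; simp
    · simp [hj, Fin.val_inj]
  · exact (mem_set_of_ne _ _ _ (by simp) _ _).trans (h.piv _ _)
  · exact (mem_set_of_ne _ _ _ (by simp) _ _).trans h.bad

theorem Frame.set_out (h : Frame A E b y β s) {c : ℕ} (v : F) {j : Fin n} (hc : s.var c = j) :
    Frame A E b (Function.update y j v) β (s.set ⟨1, 6, c⟩ v) := by
  refine ⟨h.1, h.2, h.3, fun i j => ?_, fun j' => ?_, fun j => ?_, fun i' j' => ?_, ?_⟩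
  · exact (mem_set_of_ne _ _ _ (by simp) _ _).trans (h.mat i j)
  · simp only [Cfg.set, h.var_z, hc, h.out, true_and]
    by_cases hj : j' = j
    · subst hj; simp
    · simp [hj, Fin.val_inj]
  · exact (mem_set_of_ne _ _ _ (by simp) _ _).trans (h.flag j)
  · exact (mem_set_of_ne _ _ _ (by simp) _ _).trans (h.piv _ _)
  · exact (mem_set_of_ne _ _ _ (by simp) _ _).trans h.bad

theorem Frame.set_bad (h : Frame A E b y β s) (v : F) :
    Frame A E b y v (s.set ⟨8, 6, 6⟩ v) := by
  refine ⟨h.1, h.2, h.3, fun i j => ?_, fun j' => ?_, fun j => ?_, fun i' j' => ?_, ?_⟩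
  · exact (mem_set_of_ne _ _ _ (by simp) _ _).trans (h.mat i j)
  · exact (mem_set_of_ne _ _ _ (by simp) _ _).trans (h.out _)
  · exact (mem_set_of_ne _ _ _ (by simp) _ _).trans (h.flag j)
  · exact (mem_set_of_ne _ _ _ (by simp) _ _).trans (h.piv _ _)
  · simp [Cfg.set, h.var_z]

theorem Frame.withKet {a : CLoc} {v : F} (h : Frame A E b y β (s.set a v))
    (ψ : (ℕ × ℕ → F) →₀ ℂ) : Frame A E b y β { s.set a v with ket := ψ } :=
  ⟨h.1, h.2, h.3, h.4, h.5, h.6, h.7, h.8⟩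

theorem Frame.congr (h : Frame A E b y β s) {A' : Matrix (Fin k) (Fin n) F} (hA : A = A') :
    Frame A' E b y β s := hA ▸ h

theorem var_setVar_self (s : Cfg F) (x m : ℕ) : (s.setVar x m).var x = m :=
  Function.update_self ..

theorem var_setVar_of_ne (s : Cfg F) {x x' : ℕ} (m : ℕ) (h : x' ≠ x) :
    (s.setVar x m).var x' = s.var x' := Function.update_of_ne h _ _

theorem addr_eq {s : Cfg F} {a x m : ℕ} (h : s.var x = m) : s.addr ⟨a, x⟩ = (a, m) := by
  simp [Cfg.addr, h]

/-- The induction step shared by the loop invariants of the form "the first `j` entries are new, the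
others old". -/
theorem update_ite_lt {α : Type*} {m j : ℕ} (hj : j < m) (f g : Fin m → α) {v : α}
    (hv : v = f ⟨j, hj⟩) :
    Function.update (fun i : Fin m => if (i : ℕ) < j then f i else g i) ⟨j, hj⟩ v =
      fun i : Fin m => if (i : ℕ) < j + 1 then f i else g i := by
  funext i
  by_cases h : i = ⟨j, hj⟩
  · subst h; simp [hv]
  · rw [Function.update_of_ne h]
    have : (i : ℕ) ≠ j := fun hh => h (Fin.ext hh)
    by_cases h2 : (i : ℕ) < j
    · rw [if_pos h2, if_pos (by omega)]
    · rw [if_neg h2, if_neg (by omega)]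

theorem ite_lt_top {α : Type*} {m : ℕ} (f g : Fin m → α) :
    (fun i : Fin m => if (i : ℕ) < m then f i else g i) = f := by
  funext i; rw [if_pos i.2]

variable (F) in
/-- `1/√q` -/
def invSqrtCard : ℂ := ((1 / √(Fintype.card F : ℝ) : ℝ) : ℂ)

theorem frame_initCfg (H : Matrix (Fin k) (Fin n) F) : Frame H 0 0 0 0 (initCfg H) := by
  refine ⟨rfl, rfl, rfl, fun i j => ?_, fun j => ?_, fun j => ?_, fun i j => ?_, ?_⟩ <;>
    simp [initCfg]

theorem ket_initCfg (H : Matrix (Fin k) (Fin n) F) :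
    (initCfg H).ket = prodKet (cellAddr (n := n) (k := k)) fun _ => Pi.single 0 1 := by
  rw [prodKet_basis cellAddr (fun _ => (0 : F))]
  simp only [initCfg]
  congr 1
  exact (Function.extend_const cellAddr (0 : F)).symm

theorem det_prepare_message (H : Matrix (Fin k) (Fin n) F) :
    Det ω (.loop 2 1 (.qft ⟨0, 2⟩)) (initCfg H) fun t => Frame H 0 0 0 0 t ∧
      t.ket = ensemble (fun _ : Fin k → F => invSqrtCard F ^ k) id (fun _ _ => Pi.single 0 1) (0 : Fin n → F) := by
  refine (Det.loop (y := 1) (m := k) rfl (fun i t => Frame H 0 0 0 0 t ∧ t.ket = prodKet cellAddr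
    (Sum.elim (fun i' : Fin k => if (i' : ℕ) < i then (fun _ => invSqrtCard F) else Pi.single 0 1)
      (Sum.elim (fun _ => Pi.single 0 1) fun j => Pi.single ((0 : Fin n → F) j) 1)))
    ⟨(frame_initCfg H).tick, ?_⟩ ?_).mono ?_
  · refine (ket_initCfg H).trans ?_
    congr 1
    funext c
    rcases c with c | c | c <;> simp
  · rintro i hi t ⟨hF, hk⟩
    refine ⟨_, rfl, (hF.setVar i (by decide)).setKet _, ?_⟩
    change gate1 (qftMatrix F) ((t.setVar 2 i).addr ⟨0, 2⟩) t.ket = _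
    rw [addr_eq (var_setVar_self t 2 i), hk]
    refine (gate1_prodKet cellAddr_injective _ _ (Sum.inl ⟨i, hi⟩)).trans ?_
    rw [Sum.update_elim_inl]
    congr 2
    apply update_ite_lt
    funext a
    simp [Pi.single_apply, qftMatrix_zero, invSqrtCard]
  · rintro t ⟨hF, hk⟩
    refine ⟨hF, ?_⟩
    rw [hk, ite_lt_top, sum_smul_cellState]
    simp [ensemble]

theorem det_prepare_noise (h0 : 0 ≤ ω) (h1 : ω ≤ ((Fintype.card F : ℝ) - 1) / Fintype.card F)
    {H : Matrix (Fin k) (Fin n) F} {c : (Fin k → F) → ℂ} (hF : Frame H 0 0 0 0 s)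
    (hk : s.ket = ensemble c id (fun _ _ => Pi.single 0 1) (0 : Fin n → F)) :
    Det ω (.loop 3 0 (.noise ⟨1, 3⟩)) s fun t => Frame H 0 0 0 0 t ∧
      t.ket = ensemble c id (fun _ _ x => (noiseAmp ω x : ℂ)) (0 : Fin n → F) := by
  refine (Det.loop hF.var_n (fun j t => Frame H 0 0 0 0 t ∧ t.ket = ensemble c id
    (fun _ j' => if (j' : ℕ) < j then (fun x => (noiseAmp ω x : ℂ)) else Pi.single 0 1) (0 : Fin n → F))
    ⟨hF.tick, hk.trans (by simp)⟩ ?_).mono ?_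
  · rintro j hj t ⟨hF, hk⟩
    refine ⟨_, rfl, (hF.setVar j (by decide)).setKet _, ?_⟩
    change gate1 (noiseMatrix F ω) ((t.setVar 3 j).addr ⟨1, 3⟩) t.ket = _
    rw [addr_eq (var_setVar_self t 3 j), hk]
    refine (gate1_ensemble _ _ _ _ _ ⟨j, hj⟩).trans ?_
    congr 1
    funext t
    apply update_ite_lt
    funext a
    simpa using noise_single h0 h1 a
  · rintro t ⟨hF, hk⟩
    exact ⟨hF, hk.trans (by simp)⟩

/-- The encoding of `t` by the first `i` rows of `H`. -/
def partialEncode (H : Matrix (Fin k) (Fin n) F) (i : ℕ) (t : Fin k → F) (j : Fin n) : F :=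
  ∑ i' : Fin k, if (i' : ℕ) < i then t i' * H i' j else 0

theorem partialEncode_succ (H : Matrix (Fin k) (Fin n) F) {i : ℕ} (hi : i < k) (t : Fin k → F)
    (j : Fin n) : partialEncode H (i + 1) t j = partialEncode H i t j + t ⟨i, hi⟩ * H ⟨i, hi⟩ j := by
  unfold partialEncode
  rw [← Finset.add_sum_erase Finset.univ (fun i' : Fin k =>
      if (i' : ℕ) < i + 1 then t i' * H i' j else 0) (Finset.mem_univ (⟨i, hi⟩ : Fin k)),
    ← Finset.add_sum_erase Finset.univ (fun i' : Fin k =>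
      if (i' : ℕ) < i then t i' * H i' j else 0) (Finset.mem_univ (⟨i, hi⟩ : Fin k))]
  simp only [lt_add_iff_pos_right, zero_lt_one, if_true, lt_irrefl, if_false, zero_add]
  rw [add_comm]
  congr 1
  refine Finset.sum_congr rfl fun i' hi' => ?_
  have : (i' : ℕ) ≠ i := fun h => Finset.ne_of_mem_erase hi' (Fin.ext h)
  by_cases h : (i' : ℕ) < i
  · rw [if_pos h, if_pos (by omega)]
  · rw [if_neg h, if_neg (by omega)]

theorem partialEncode_top (H : Matrix (Fin k) (Fin n) F) (t : Fin k → F) (j : Fin n) :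
    partialEncode H k t j = (t ᵥ* H) j := by
  simp [partialEncode, Matrix.vecMul, dotProduct]

theorem det_encode {H : Matrix (Fin k) (Fin n) F} {c : (Fin k → F) → ℂ} (hF : Frame H 0 0 0 0 s)
    (hk : s.ket = ensemble c id (fun _ _ x => (noiseAmp ω x : ℂ)) (0 : Fin n → F)) :
    Det ω (.loop 2 1 (.loop 3 0 (.cadd ⟨0, 2, 3⟩ ⟨0, 2⟩ ⟨1, 3⟩))) s fun t => Frame H 0 0 0 0 t ∧
      t.ket = ensemble c id (fun t j x => (noiseAmp ω (x - (t ᵥ* H) j) : ℂ)) (0 : Fin n → F) := by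
  refine (Det.loop hF.var_k (fun i t => Frame H 0 0 0 0 t ∧ t.ket = ensemble c id
    (fun t j x => (noiseAmp ω (x - partialEncode H i t j) : ℂ)) (0 : Fin n → F))
    ⟨hF.tick, hk.trans (by simp [partialEncode])⟩ ?_).mono ?_
  · rintro i hi s ⟨hF, hk⟩
    have hF' := hF.setVar (x := 2) i (by decide)
    refine (Det.loop hF'.var_n (fun j s => (Frame H 0 0 0 0 s ∧ s.ket = ensemble c id
      (fun t j' => if (j' : ℕ) < j then (fun x => (noiseAmp ω (x - partialEncode H (i + 1) t j') : ℂ))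
        else fun x => (noiseAmp ω (x - partialEncode H i t j') : ℂ)) (0 : Fin n → F)) ∧ s.var 2 = i)
      ⟨⟨hF'.tick, hk.trans (by simp)⟩, var_setVar_self s 2 i⟩ ?_).mono ?_
    · rintro j hj r ⟨⟨hF, hk⟩, hv⟩
      have hF' := hF.setVar (x := 3) j (by decide)
      have h2 : (r.setVar 3 j).var 2 = i := (var_setVar_of_ne r j (by decide)).trans hv
      refine ⟨_, rfl, ⟨hF'.setKet _, ?_⟩, h2⟩
      change gate2 (caddMatrix ((r.setVar 3 j).get ⟨0, 2, 3⟩)) ((r.setVar 3 j).addr ⟨0, 2⟩)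
        ((r.setVar 3 j).addr ⟨1, 3⟩) r.ket = _
      have hget : (r.setVar 3 j).get ⟨0, 2, 3⟩ = H ⟨i, hi⟩ ⟨j, hj⟩ := by
        simp only [Cfg.get, h2, var_setVar_self]
        exact hF'.mat ⟨i, hi⟩ ⟨j, hj⟩
      rw [addr_eq h2, addr_eq (var_setVar_self r 3 j), hget, hk]
      refine (cadd_ensemble_msg_word _ _ _ _ _ ⟨i, hi⟩ ⟨j, hj⟩).trans ?_
      congr 1
      funext t
      apply update_ite_lt
      funext x
      simp only [lt_irrefl, if_false, id]
      rw [partialEncode_succ H hi]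
      congr 2
      ring
    · rintro r ⟨⟨hF, hk⟩, -⟩
      exact ⟨hF, hk.trans (by simp)⟩
  · rintro t ⟨hF, hk⟩
    simp only [partialEncode_top] at hk
    exact ⟨hF, hk⟩

theorem det_prep (h0 : 0 ≤ ω) (h1 : ω ≤ ((Fintype.card F : ℝ) - 1) / Fintype.card F)
    (H : Matrix (Fin k) (Fin n) F) :
    Det ω prepProg (initCfg H) fun t => Frame H 0 0 0 0 t ∧
      t.ket = ensemble (fun _ : Fin k → F => invSqrtCard F ^ k) id
        (fun t j x => (noiseAmp ω (x - (t ᵥ* H) j) : ℂ)) (0 : Fin n → F) :=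
  (det_prepare_message H).seq fun _ h => (det_prepare_noise h0 h1 h.1 h.2).seq fun _ h =>
    det_encode h.1 h.2

/-- The matrix with the columns with nonzero flag replaced by zero. -/
def maskCols (b : Fin n → F) (H : Matrix (Fin k) (Fin n) F) : Matrix (Fin k) (Fin n) F :=
  fun i j => if b j = 0 then H i j else 0

theorem vecMul_maskCols (b : Fin n → F) (H : Matrix (Fin k) (Fin n) F) (t : Fin k → F)
    (j : Fin n) : (t ᵥ* maskCols b H) j = if b j = 0 then (t ᵥ* H) j else 0 := by
  simp only [Matrix.vecMul, dotProduct, maskCols]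
  split_ifs <;> simp

theorem det_clear_column (hF : Frame A E b y β s) {j : Fin n} (hj : s.var 3 = j) :
    Det ω (.loop 2 1 (.fzero ⟨0, 2, 3⟩)) s fun t =>
      Frame (fun i j' => if j' = j then 0 else A i j') E b y β t ∧ t.ket = s.ket := by
  refine (Det.loop hF.var_k (fun i t => (Frame (fun i' => if (i' : ℕ) < i then
    (fun j' => if j' = j then 0 else A i' j') else A i') E b y β t ∧ t.ket = s.ket) ∧
    t.var 3 = j) ⟨⟨hF.tick.congr (by simp), rfl⟩, hj⟩ ?_).mono ?_
  · rintro i hi t ⟨⟨hF, hk⟩, hj⟩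
    have h3 : (t.setVar 2 i).var 3 = j := (var_setVar_of_ne t i (by decide)).trans hj
    refine ⟨_, rfl, ⟨Frame.congr ((hF.setVar i (by decide)).set_mat 0 (i := ⟨i, hi⟩)
      (var_setVar_self t 2 i) h3) ?_, hk⟩, h3⟩
    funext i' j'
    by_cases hi' : i' = ⟨i, hi⟩
    · subst hi'
      simp
    · have : (i' : ℕ) ≠ i := fun hh => hi' (Fin.ext hh)
      by_cases h : (i' : ℕ) < i
      · simp [hi', h, h.trans (Nat.lt_succ_self i)]
      · simp [hi', h, show ¬ (i' : ℕ) < i + 1 by omega]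
  · rintro t ⟨⟨hF, hk⟩, -⟩
    exact ⟨hF.congr (ite_lt_top _ _), hk⟩

variable (F) in
/-- The amplitude after the flags at the first `j` positions have been measured. -/
def flagCoeff (ω : ℝ) (k j : ℕ) (b : Fin n → F) : ℂ :=
  invSqrtCard F ^ k * ∏ i : Fin n, if (i : ℕ) < j then (flagAmp F ω (b i) : ℂ) else 1

theorem flagCoeff_update {j : ℕ} (hj : j < n) (b : Fin n → F) (v : F) :
    flagCoeff F ω k j b * (flagAmp F ω v : ℂ) =
      flagCoeff F ω k (j + 1) (Function.update b ⟨j, hj⟩ v) := by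
  unfold flagCoeff
  rw [mul_assoc]
  congr 1
  rw [← Finset.mul_prod_erase Finset.univ (fun i : Fin n =>
      if (i : ℕ) < j then (flagAmp F ω (b i) : ℂ) else 1) (Finset.mem_univ (⟨j, hj⟩ : Fin n)),
    ← Finset.mul_prod_erase Finset.univ (fun i : Fin n =>
      if (i : ℕ) < j + 1 then (flagAmp F ω (Function.update b ⟨j, hj⟩ v i) : ℂ) else 1)
      (Finset.mem_univ (⟨j, hj⟩ : Fin n))]
  simp only [lt_add_iff_pos_right, zero_lt_one, if_true, lt_irrefl, if_false, one_mul,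
    Function.update_self]
  rw [mul_comm]
  congr 1
  refine Finset.prod_congr rfl fun i hi => ?_
  have hne := Finset.ne_of_mem_erase hi
  have : (i : ℕ) ≠ j := fun h => hne (Fin.ext h)
  rw [Function.update_of_ne hne]
  by_cases h : (i : ℕ) < j
  · rw [if_pos h, if_pos (by omega)]
  · rw [if_neg h, if_neg (by omega)]

/-- The configuration after the flags at the first `j` positions have been measured. -/
def UsdInv (ω : ℝ) (H : Matrix (Fin k) (Fin n) F) (j : ℕ) (b : Fin n → F) (s : Cfg F) : Prop :=
  Frame (maskCols b H) 0 b 0 0 s ∧ s.ket = ensemble (fun _ => flagCoeff F ω k j b) id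
    (fun t j' => if (j' : ℕ) < j then Pi.single ((t ᵥ* maskCols b H) j') 1
      else fun x => (noiseAmp ω (x - (t ᵥ* H) j') : ℂ)) b

theorem branches_usdBody (h0 : 0 ≤ ω) (h1 : ω ≤ ((Fintype.card F : ℝ) - 1) / Fintype.card F)
    {H : Matrix (Fin k) (Fin n) F} {j : ℕ} (hj : j < n) {b : Fin n → F}
    (hb : ∀ i : Fin n, j ≤ i → b i = 0) (h : UsdInv ω H j b s) :
    Branches ω usdBody (s.setVar 3 j) fun v => UsdInv ω H (j + 1) (Function.update b ⟨j, hj⟩ v) := by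
  obtain ⟨hF, hk⟩ := h
  have hbj : b ⟨j, hj⟩ = 0 := hb _ le_rfl
  set f : (Fin k → F) → Fin n → F → ℂ := fun t j' =>
    if (j' : ℕ) < j then Pi.single ((t ᵥ* maskCols b H) j') 1
      else fun x => (noiseAmp ω (x - (t ᵥ* H) j') : ℂ) with hf
  -- Fourier transform
  have D1 : Det ω (.qft ⟨1, 3⟩) (s.setVar 3 j) fun t => (Frame (maskCols b H) 0 b 0 0 t ∧
      t.ket = ensemble (fun _ => flagCoeff F ω k j b) id (fun t => Function.update (f t) ⟨j, hj⟩
        (qftOp fun x => (noiseAmp ω (x - (t ᵥ* H) ⟨j, hj⟩) : ℂ))) b) ∧ t.var 3 = j := by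
    refine ⟨_, rfl, ⟨(hF.setVar j (by decide)).setKet _, ?_⟩, var_setVar_self s 3 j⟩
    change gate1 (qftMatrix F) ((s.setVar 3 j).addr ⟨1, 3⟩) s.ket = _
    rw [addr_eq (var_setVar_self s 3 j), hk]
    refine (gate1_ensemble _ _ _ _ _ ⟨j, hj⟩).trans ?_
    congr 1
    funext t
    congr 1
    funext a
    simp [qftOp, hf]
  -- the invariants for a given outcome
  have D2 : ∀ t : Cfg F, ((Frame (maskCols b H) 0 b 0 0 t ∧
      t.ket = ensemble (fun _ => flagCoeff F ω k j b) id (fun t => Function.update (f t) ⟨j, hj⟩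
        (qftOp fun x => (noiseAmp ω (x - (t ᵥ* H) ⟨j, hj⟩) : ℂ))) b) ∧ t.var 3 = j) →
      Branches ω (.seq (.crot ⟨1, 3⟩ ⟨2, 3⟩) (.meas ⟨3, 6, 3⟩ ⟨2, 3⟩)) t fun v r =>
        (Frame (maskCols b H) 0 (Function.update b ⟨j, hj⟩ v) 0 0 r ∧
        r.ket = ensemble (fun _ => flagCoeff F ω k (j + 1) (Function.update b ⟨j, hj⟩ v)) id
          (fun t => Function.update (f t) ⟨j, hj⟩
            (if v = 0 then qftOp (Pi.single ((t ᵥ* H) ⟨j, hj⟩) 1) else Pi.single 0 1))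
          (Function.update b ⟨j, hj⟩ v)) ∧ r.var 3 = j := by
    rintro t ⟨⟨hF, hk⟩, hv⟩
    refine Det.seq_branches (Q := fun r => r = t.setKet (gate2 (crotMatrix F ω) (t.addr ⟨1, 3⟩)
      (t.addr ⟨2, 3⟩) t.ket)) ⟨_, rfl, rfl⟩ ?_
    rintro r rfl
    refine ⟨_, rfl, fun v => ⟨⟨?_, ?_⟩, hv⟩⟩
    · exact ((hF.setKet _).set_flag v (j := ⟨j, hj⟩) hv).withKet _
    · change (gate2 (crotMatrix F ω) (t.addr ⟨1, 3⟩) (t.addr ⟨2, 3⟩) t.ket).filter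
        (fun w => w (t.addr ⟨2, 3⟩) = v) = _
      rw [addr_eq hv, addr_eq hv, hk]
      refine (filter_crot_ensemble _ _ _ _ ⟨j, hj⟩ v hbj).trans ?_
      simp only [Function.update_self, Function.update_idem, flagGate_qftOp_noise h0 h1]
      rw [← flagCoeff_update hj]
      exact ensemble_update_smul _ _ f _ _ (fun _ => (flagAmp F ω v : ℂ)) _
  -- Flag `0`: three more transforms give `|c⟩`. Other flags: the cell is deliberately left at `|0⟩`
  -- in the Fourier basis, which is the symbol that the masked matrix assigns to this position. In
  -- both cases the symbol is that of `t` times the masked matrix.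
  have D3 : ∀ (v : F) (r : Cfg F),
      ((Frame (maskCols b H) 0 (Function.update b ⟨j, hj⟩ v) 0 0 r ∧
        r.ket = ensemble (fun _ => flagCoeff F ω k (j + 1) (Function.update b ⟨j, hj⟩ v)) id
          (fun t => Function.update (f t) ⟨j, hj⟩
            (if v = 0 then qftOp (Pi.single ((t ᵥ* H) ⟨j, hj⟩) 1) else Pi.single 0 1))
          (Function.update b ⟨j, hj⟩ v)) ∧ r.var 3 = j) →
      Det ω (.ifZero ⟨3, 6, 3⟩ (.seq (.qft ⟨1, 3⟩) (.seq (.qft ⟨1, 3⟩) (.qft ⟨1, 3⟩)))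
        (.loop 2 1 (.fzero ⟨0, 2, 3⟩))) r (UsdInv ω H (j + 1) (Function.update b ⟨j, hj⟩ v)) := by
    rintro v r ⟨⟨hF, hk⟩, hv⟩
    have hget : r.get ⟨3, 6, 3⟩ = v := by
      simp only [Cfg.get, hv, hF.var_z]
      simpa using hF.flag ⟨j, hj⟩
    have hmask : ∀ (t : Fin k → F) (j' : Fin n), (j' : ℕ) < j →
        (t ᵥ* maskCols (Function.update b ⟨j, hj⟩ v) H) j' = (t ᵥ* maskCols b H) j' := by
      intro t j' hj'
      rw [vecMul_maskCols, vecMul_maskCols, Function.update_of_ne (by rintro rfl; simp at hj')]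
    have hfin : ∀ t : Fin k → F, Function.update (f t) ⟨j, hj⟩
        (Pi.single ((t ᵥ* maskCols (Function.update b ⟨j, hj⟩ v) H) ⟨j, hj⟩) 1) =
        fun j' : Fin n => if (j' : ℕ) < j + 1 then
          Pi.single ((t ᵥ* maskCols (Function.update b ⟨j, hj⟩ v) H) j') 1
          else fun x => (noiseAmp ω (x - (t ᵥ* H) j') : ℂ) := by
      intro t
      rw [← update_ite_lt hj _ _ rfl]
      congr 1
      funext j'
      simp only [hf]
      split_ifs with hlt
      · rw [hmask t j' hlt]
      · rfl
    by_cases hv0 : v = 0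
    · subst hv0
      refine Det.ifZero_pos hget ⟨_, rfl, ?_, ?_⟩
      · have : Function.update b ⟨j, hj⟩ 0 = b := by
          conv_rhs => rw [← Function.update_eq_self ⟨j, hj⟩ b, hbj]
        rw [this] at hF ⊢
        exact ((hF.tick.setKet _).setKet _).setKet _
      · change gate1 (qftMatrix F) (r.addr ⟨1, 3⟩) (gate1 (qftMatrix F) (r.addr ⟨1, 3⟩)
          (gate1 (qftMatrix F) (r.addr ⟨1, 3⟩) r.ket)) = _
        rw [addr_eq hv, hk]
        have g := fun (c : (Fin k → F) → ℂ) μ f' b' =>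
          gate1_ensemble (F := F) c μ f' b' (qftMatrix F) ⟨j, hj⟩
        rw [g, g, g]
        congr 1
        funext t
        rw [← hfin]
        simp only [Function.update_idem, Function.update_self, if_true]
        congr 1
        rw [vecMul_maskCols, Function.update_self, if_pos rfl]
        exact qftOp_four _
    · refine Det.ifZero_neg (by rwa [hget]) ((det_clear_column hF.tick (j := ⟨j, hj⟩) hv).mono ?_)
      rintro r' ⟨hF', hk'⟩
      refine ⟨hF'.congr ?_, ?_⟩
      · funext i j'
        by_cases hjj : j' = ⟨j, hj⟩
        · subst hjj; simp [maskCols, hv0]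
        · simp [maskCols, hjj]
      · rw [hk']
        refine hk.trans ?_
        congr 1
        funext t
        rw [← hfin, if_neg hv0, vecMul_maskCols, Function.update_self, if_neg hv0]
  refine D1.seq_branches fun t ht => ?_
  obtain ⟨τ, hτ, hQ⟩ := (D2 t ht).seq D3
  refine ⟨τ, ?_, hQ⟩
  rw [← hτ]
  simp only [run, Multiset.bind_assoc]

end Preparation

/-! ### Elimination -/

section Elimination

variable {F : Type u} [Field F] [Fintype F] [DecidableEq F] {n k : ℕ} {ω : ℝ}

/-- Subtract `a` times row `i` from row `r`. -/
def rowSub (A : Matrix (Fin k) (Fin n) F) (r i : Fin k) (a : F) : Matrix (Fin k) (Fin n) F :=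
  fun i' j => if i' = r then A r j - a * A i j else A i' j

/-- `B` is obtained from `A` by multiplication with an invertible matrix from the left. -/
def RowEquiv (A B : Matrix (Fin k) (Fin n) F) : Prop :=
  ∃ T T' : Matrix (Fin k) (Fin k) F, T * T' = 1 ∧ B = T * A

theorem RowEquiv.refl (A : Matrix (Fin k) (Fin n) F) : RowEquiv A A := ⟨1, 1, by simp, by simp⟩

theorem rowSub_eq_mul (A : Matrix (Fin k) (Fin n) F) (r i : Fin k) (a : F) :
    rowSub A r i a = Matrix.transvection r i (-a) * A := by
  ext i' j
  rw [Matrix.transvection, Matrix.add_mul, Matrix.one_mul, Matrix.add_apply, rowSub]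
  split_ifs with h
  · subst h
    rw [Matrix.single_mul_apply_same]; ring
  · rw [Matrix.single_mul_apply_of_ne _ _ _ _ _ h, add_zero]

theorem RowEquiv.rowSub {A B : Matrix (Fin k) (Fin n) F} (h : RowEquiv A B) {r i : Fin k}
    (hri : r ≠ i) (a : F) : RowEquiv A (rowSub B r i a) := by
  obtain ⟨T, T', hT, rfl⟩ := h
  refine ⟨Matrix.transvection r i (-a) * T, T' * Matrix.transvection r i a, ?_, ?_⟩
  · rw [Matrix.mul_assoc, ← Matrix.mul_assoc T, hT, Matrix.one_mul,
      Matrix.transvection_mul_transvection_same _ _ hri, neg_add_cancel, Matrix.transvection_zero]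
  · rw [rowSub_eq_mul, Matrix.mul_assoc]

/-- Only multiples of `(A e) i = 0` are subtracted. Applied to earlier columns of the right inverse,
this keeps them valid during later pivots. -/
theorem rowSub_mulVec (A : Matrix (Fin k) (Fin n) F) (r i : Fin k) (a : F) (e : Fin n → F)
    (h : (A *ᵥ e) i = 0) : rowSub A r i a *ᵥ e = A *ᵥ e := by
  funext i'
  by_cases hi : i' = r
  · subst hi
    simp only [Matrix.mulVec, dotProduct, rowSub, if_true, sub_mul, Finset.sum_sub_distrib] at h ⊢
    rw [sub_eq_self]
    simp only [mul_assoc, ← Finset.mul_sum, h, mul_zero]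
  · simp [Matrix.mulVec, dotProduct, rowSub, hi]

/-- The contragredient substitution: removing `a` times row `i` from row `r` is compensated by
adding `a t_r` to `t_i`, so the encoded word does not change. -/
theorem update_vecMul_rowSub (A : Matrix (Fin k) (Fin n) F) {r i : Fin k} (hri : r ≠ i) (a : F)
    (t : Fin k → F) : Function.update t i (t i + a * t r) ᵥ* rowSub A r i a = t ᵥ* A := by
  have h1 : Function.update t i (t i + a * t r) = t + Pi.single i (a * t r) := by
    funext i'
    by_cases h : i' = i
    · subst h; simp
    · simp [h]
  rw [h1, Matrix.add_vecMul, Matrix.single_vecMul]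
  have h2 : t ᵥ* rowSub A r i a = t ᵥ* A - (a * t r) • A i := by
    funext j
    simp only [Matrix.vecMul, dotProduct, rowSub, Pi.sub_apply, Pi.smul_apply, smul_eq_mul]
    rw [← Finset.add_sum_erase Finset.univ _ (Finset.mem_univ r), if_pos rfl,
      ← Finset.add_sum_erase Finset.univ (fun i' => t i' * A i' j) (Finset.mem_univ r)]
    rw [Finset.sum_congr rfl fun i' hi' => by rw [if_neg (Finset.ne_of_mem_erase hi')]]
    ring
  rw [h2]
  funext j
  simp [rowSub, hri.symm, Matrix.row]

/-- The superposition of all codewords `t A`, with the message `t`. -/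
def codeKet (κ : ℂ) (A : Matrix (Fin k) (Fin n) F) (b : Fin n → F) : (ℕ × ℕ → F) →₀ ℂ :=
  ensemble (fun _ => κ) id (fun t j => Pi.single ((t ᵥ* A) j) 1) b

/-- Row operations, done coherently on the messages, preserve the superposition of codewords. -/
theorem cadd_codeKet (κ : ℂ) (A : Matrix (Fin k) (Fin n) F) (b : Fin n → F) (a : F) {r i : Fin k}
    (h : r ≠ i) :
    gate2 (caddMatrix a) (0, (r : ℕ)) (0, (i : ℕ)) (codeKet κ A b) =
      codeKet κ (rowSub A r i a) b := by
  unfold codeKet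
  rw [cadd_ensemble_msg _ _ _ _ _ h]
  let e : (Fin k → F) ≃ (Fin k → F) :=
    { toFun := fun t => Function.update t i (t i + a * t r)
      invFun := fun t => Function.update t i (t i - a * t r)
      left_inv := fun t => by simp [h]
      right_inv := fun t => by simp [h] }
  unfold ensemble
  refine Fintype.sum_equiv e _ _ fun t => ?_
  have : e t ᵥ* rowSub A r i a = t ᵥ* A := update_vecMul_rowSub A h a t
  show _ = κ • prodKet cellAddr (cellState (e t) (fun j => Pi.single ((e t ᵥ* rowSub A r i a) j) 1) b)
  rw [this]
  rfl

variable {A E : Matrix (Fin k) (Fin n) F} {b y : Fin n → F} {β : F} {s : Cfg F} {κ : ℂ}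

theorem mem_set_scratch {s : Cfg F} (hz : s.var 6 = 0) (a : ℕ) (v : F) :
    (s.set ⟨a, 6, 6⟩ v).mem a 0 0 = v := by
  simp [Cfg.set, hz]

theorem get_scratch {s : Cfg F} (hz : s.var 6 = 0) (a : ℕ) : s.get ⟨a, 6, 6⟩ = s.mem a 0 0 := by
  simp [Cfg.get, hz]

theorem Frame.get_mat (h : Frame A E b y β s) {r c : ℕ} {i : Fin k} {j : Fin n}
    (hr : s.var r = i) (hc : s.var c = j) : s.get ⟨0, r, c⟩ = A i j := by
  simp [Cfg.get, hr, hc, h.mat]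

theorem Frame.get_piv (h : Frame A E b y β s) {r c : ℕ} {i : Fin k} {j : Fin n}
    (hr : s.var r = i) (hc : s.var c = j) : s.get ⟨7, r, c⟩ = E i j := by
  simp [Cfg.get, hr, hc, h.piv]

theorem det_rowOp (hF : Frame A E b y β s) (hk : s.ket = codeKet κ A b) {i r : Fin k} {p : Fin n}
    (h2 : s.var 2 = i) (h4 : s.var 4 = r) (h7 : s.var 7 = p) (hri : r ≠ i) :
    Det ω rowOp s fun t => Frame (rowSub A r i (A r p * E i p)) E b y β t ∧
      t.ket = codeKet κ (rowSub A r i (A r p * E i p)) b ∧ t.var 2 = i ∧ t.var 7 = p := by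
  set a := A r p * E i p with ha
  refine Det.seq (Q := fun t => Frame A E b y β t ∧ t.ket = codeKet κ A b ∧ t.var = s.var ∧
    t.mem 4 0 0 = a) ⟨_, rfl, hF.set_scratch _ (by simp), hk, rfl, ?_⟩ ?_
  · rw [mem_set_scratch hF.var_z, hF.get_mat h4 h7, hF.get_piv h2 h7]
  rintro t ⟨hF, hk, hv, hc⟩
  refine Det.seq (Q := fun t => Frame A E b y β t ∧ t.ket = codeKet κ (rowSub A r i a) b ∧
    t.var = s.var ∧ t.mem 4 0 0 = a) ⟨_, rfl, hF.setKet _, ?_, hv, hc⟩ ?_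
  · change gate2 (caddMatrix (t.get ⟨4, 6, 6⟩)) (t.addr ⟨0, 4⟩) (t.addr ⟨0, 2⟩) t.ket = _
    rw [get_scratch hF.var_z, hc, addr_eq ((congrFun hv 4).trans h4),
      addr_eq ((congrFun hv 2).trans h2), hk, cadd_codeKet _ _ _ _ hri]
  rintro t ⟨hF, hk, hv, hc⟩
  refine Det.seq (Q := fun t => Frame A E b y β t ∧ t.ket = codeKet κ (rowSub A r i a) b ∧
    t.var = s.var ∧ t.mem 4 0 0 = -a) ⟨_, rfl, hF.set_scratch _ (by simp), hk, hv, ?_⟩ ?_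
  · rw [mem_set_scratch hF.var_z, get_scratch hF.var_z, hc]
  rintro t ⟨hF, hk, hv, hc⟩
  -- The coefficient was computed in advance because the loop overwrites the entry `(r, p)` from
  -- which it came. Row `i` is read unchanged since `r ≠ i`.
  refine (Det.loop hF.var_n (fun j t => Frame (fun i' j' => if i' = r ∧ (j' : ℕ) < j then
      A r j' - a * A i j' else A i' j') E b y β t ∧ t.ket = codeKet κ (rowSub A r i a) b ∧
      (t.var 2 = i ∧ t.var 4 = r ∧ t.var 7 = p) ∧ t.mem 4 0 0 = -a)
    ⟨hF.tick.congr (by simp), hk, ⟨(congrFun hv 2).trans h2, (congrFun hv 4).trans h4,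
      (congrFun hv 7).trans h7⟩, hc⟩ ?_).mono ?_
  · rintro j hj t ⟨hF, hk, ⟨h2, h4, h7⟩, hc⟩
    have hF1 := hF.setVar (x := 5) j (by decide)
    have h2' : (t.setVar 5 j).var 2 = i := h2
    have h4' : (t.setVar 5 j).var 4 = r := h4
    have h5' : (t.setVar 5 j).var 5 = (⟨j, hj⟩ : Fin n) := var_setVar_self t 5 j
    refine Det.seq (Q := fun r' => r' = (t.setVar 5 j).set ⟨5, 6, 6⟩ (-a * A i ⟨j, hj⟩))
      ⟨_, rfl, ?_⟩ ?_
    · rw [get_scratch hF1.var_z, hF1.get_mat h2' h5', if_neg (fun h => hri h.1.symm)]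
      exact congrArg (fun x => (t.setVar 5 j).set ⟨5, 6, 6⟩ (x * A i ⟨j, hj⟩)) hc
    · rintro _ rfl
      have hF2 := hF1.set_scratch (a := ⟨5, 6, 6⟩) (-a * A i ⟨j, hj⟩) (by simp)
      refine ⟨_, rfl, (hF2.set_mat _ (r := 4) (c := 5) (i := r) (j := ⟨j, hj⟩) h4' h5').congr ?_, hk, ⟨h2, h4, h7⟩, ?_⟩
      · rw [hF2.get_mat (r := 4) (c := 5) (i := r) (j := ⟨j, hj⟩) h4' h5', get_scratch hF2.var_z,
          mem_set_scratch hF1.var_z, if_neg (by simp)]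
        funext i' j'
        by_cases hi : i' = r
        · subst hi
          by_cases hj' : j' = ⟨j, hj⟩
          · subst hj'
            simp; ring
          · have : (j' : ℕ) ≠ j := fun hh => hj' (Fin.ext hh)
            by_cases hlt : (j' : ℕ) < j
            · simp [hj', hlt, hlt.trans (Nat.lt_succ_self j)]
            · simp [hj', hlt, show ¬ (j' : ℕ) < j + 1 by omega]
        · simp [hi]
      · rw [mem_set_of_ne _ _ _ (by simp), mem_set_of_ne _ _ _ (by simp)]
        exact hc
  · rintro t ⟨hF, hk, ⟨h2, h4, h7⟩, hc⟩
    refine ⟨hF.congr ?_, hk, h2, h7⟩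
    funext i' j'
    simp [rowSub]

/-- What elimination with the pivot `(i, p)` achieves. -/
def PivotStep (A A' : Matrix (Fin k) (Fin n) F) (i : Fin k) : Prop :=
  RowEquiv A A' ∧ A' i = A i ∧
    ∀ (e : Fin n → F) (i' : Fin k), i' ≠ i → A *ᵥ e = Pi.single i' 1 → A' *ᵥ e = Pi.single i' 1

theorem PivotStep.rowSub {A A' : Matrix (Fin k) (Fin n) F} {i : Fin k} (h : PivotStep A A' i)
    {r : Fin k} (hri : r ≠ i) (a : F) : PivotStep A (rowSub A' r i a) i := by
  refine ⟨h.1.rowSub hri a, ?_, fun e i' hi' he => ?_⟩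
  · rw [← h.2.1]
    funext j
    simp [RegevUSD.rowSub, hri.symm]
  · have := h.2.2 e i' hi' he
    rw [rowSub_mulVec _ _ _ _ _ (by rw [this, Pi.single_eq_of_ne hi'.symm]), this]

theorem det_pivot (hF : Frame A E b y β s) (hk : s.ket = codeKet κ A b) {i : Fin k} {p : Fin n}
    (h2 : s.var 2 = i) (h7 : s.var 7 = p) (hp : A i p ≠ 0) :
    Det ω pivotProg s fun t => ∃ A', Frame A' (fun i' j => if i' = i ∧ j = p then (A i p)⁻¹
      else E i' j) b y β t ∧ t.ket = codeKet κ A' b ∧ PivotStep A A' i ∧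
      ∀ r ≠ i, A' r p = 0 := by
  set E' : Matrix (Fin k) (Fin n) F := fun i' j => if i' = i ∧ j = p then (A i p)⁻¹ else E i' j
    with hE'
  have hEip : E' i p = (A i p)⁻¹ := by simp [hE']
  refine Det.seq (Q := fun t => Frame A E' b y β t ∧ t.ket = codeKet κ A b ∧ t.var 2 = i ∧
    t.var 7 = p) ⟨_, rfl, ?_, hk, h2, h7⟩ ?_
  · rw [hF.get_mat h2 h7]
    exact hF.set_piv _ h2 h7
  rintro t ⟨hF, hk, h2, h7⟩
  refine (Det.loop hF.var_k (fun m t => ∃ A', Frame A' E' b y β t ∧ t.ket = codeKet κ A' b ∧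
    PivotStep A A' i ∧ (∀ r ≠ i, (r : ℕ) < m → A' r p = 0) ∧ t.var 2 = i ∧ t.var 7 = p)
    ⟨A, hF.tick, hk, ⟨RowEquiv.refl A, rfl, fun _ _ _ h => h⟩, by simp, h2, h7⟩ ?_).mono ?_
  · rintro m hm t ⟨A', hF, hk, hA, hz, h2, h7⟩
    have hF1 := hF.setVar (x := 4) m (by decide)
    have h2' : (t.setVar 4 m).var 2 = i := h2
    have h4' : (t.setVar 4 m).var 4 = m := var_setVar_self t 4 m
    have h7' : (t.setVar 4 m).var 7 = p := h7
    by_cases hmi : m = i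
    -- Two strict comparisons are the machine's way of testing `m ≠ i`; the pivot row falls through
    -- both and is left alone.
    · refine Det.ifLt_neg (by rw [h4', h2', hmi]; exact lt_irrefl _) (Det.ifLt_neg
        (show ¬ (t.setVar 4 m).var 2 < (t.setVar 4 m).var 4 by
          rw [h4', h2', hmi]; exact lt_irrefl _) ⟨_, rfl, A', hF1.tick.tick.tick, hk, hA, ?_, h2, h7⟩)
      intro r hr hrm
      refine hz r hr ?_
      have : (r : ℕ) ≠ i := fun h => hr (Fin.ext h)
      omega
    · have hne : (⟨m, hm⟩ : Fin k) ≠ i := fun h => hmi (by rw [← h])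
      have fin : ∀ t', (Frame (rowSub A' ⟨m, hm⟩ i (A' ⟨m, hm⟩ p * E' i p)) E' b y β t' ∧
          t'.ket = codeKet κ (rowSub A' ⟨m, hm⟩ i (A' ⟨m, hm⟩ p * E' i p)) b ∧
          t'.var 2 = i ∧ t'.var 7 = p) → ∃ A', Frame A' E' b y β t' ∧ t'.ket = codeKet κ A' b ∧
          PivotStep A A' i ∧ (∀ r ≠ i, (r : ℕ) < m + 1 → A' r p = 0) ∧
          t'.var 2 = i ∧ t'.var 7 = p := by
        rintro t' ⟨hF, hk, h2, h7⟩
        refine ⟨_, hF, hk, hA.rowSub hne _, fun r hr hrm => ?_, h2, h7⟩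
        rw [rowSub]
        split_ifs with h
        · rw [hEip, hA.2.1, mul_assoc, inv_mul_cancel₀ hp, mul_one, sub_self]
        · refine hz r hr ?_
          have : (r : ℕ) ≠ m := fun h' => h (Fin.ext h')
          omega
      by_cases hlt : m < i
      · exact Det.ifLt_pos (by rwa [h4', h2'])
          ((det_rowOp hF1.tick hk (r := ⟨m, hm⟩) h2' h4' h7' hne).mono fin)
      · exact Det.ifLt_neg (by rwa [h4', h2']) (Det.ifLt_pos
          (show (t.setVar 4 m).var 2 < (t.setVar 4 m).var 4 by rw [h4', h2']; omega)
          ((det_rowOp hF1.tick.tick hk (r := ⟨m, hm⟩) h2' h4' h7' hne).mono fin))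
  · rintro t ⟨A', hF, hk, hA, hz, -⟩
    exact ⟨A', hF, hk, hA, fun r hr => hz r hr r.2⟩

theorem det_search (hF : Frame A E b y β s) {i : Fin k} (h2 : s.var 2 = i) :
    Det ω searchProg s fun t => Frame A E b y β t ∧ t.ket = s.ket ∧ t.var 2 = i ∧
      ((t.mem 9 0 0 = 0 ∧ A i = 0) ∨ (t.mem 9 0 0 ≠ 0 ∧ ∃ p : Fin n, t.var 7 = p ∧ A i p ≠ 0)) := by
  refine Det.seq (Q := fun t => Frame A E b y β t ∧ t.ket = s.ket ∧ t.var 2 = i ∧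
    t.mem 9 0 0 = 0) ⟨_, rfl, hF.set_scratch _ (by simp), rfl, h2, mem_set_scratch hF.var_z _ _⟩ ?_
  rintro t ⟨hF, hk, h2, h9⟩
  refine (Det.loop hF.var_n (fun j t => Frame A E b y β t ∧ t.ket = s.ket ∧ t.var 2 = i ∧
    ((t.mem 9 0 0 = 0 ∧ ∀ j' : Fin n, (j' : ℕ) < j → A i j' = 0) ∨
      (t.mem 9 0 0 ≠ 0 ∧ ∃ p : Fin n, t.var 7 = p ∧ A i p ≠ 0)))
    ⟨hF.tick, hk, h2, Or.inl ⟨h9, by simp⟩⟩ ?_).mono ?_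
  · rintro j hj t ⟨hF, hk, h2, h9⟩
    have hF1 := hF.setVar (x := 3) j (by decide)
    have h2' : (t.setVar 3 j).var 2 = i := h2
    have h3' : (t.setVar 3 j).var 3 = (⟨j, hj⟩ : Fin n) := var_setVar_self t 3 j
    have hg := hF1.get_mat h2' h3'
    by_cases hA : A i ⟨j, hj⟩ = 0
    · refine Det.ifZero_pos (hg.trans hA) ⟨_, rfl, hF1.tick.tick, hk, h2, ?_⟩
      rcases h9 with ⟨h9, hz⟩ | h9
      · refine Or.inl ⟨h9, fun j' hj' => ?_⟩
        by_cases hjj : (j' : ℕ) = j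
        · have : j' = ⟨j, hj⟩ := Fin.ext hjj
          rw [this, hA]
        · exact hz j' (by omega)
      · exact Or.inr h9
    · refine Det.ifZero_neg (fun h => hA (hg.symm.trans h)) (Det.seq (Q := fun r =>
        r = (t.setVar 3 j).tick.setVar 7 j) ⟨_, rfl, ?_⟩ ?_)
      · exact congrArg (fun x => (t.setVar 3 j).tick.setVar 7 x) h3'
      · rintro _ rfl
        have hF2 := hF1.tick.setVar (x := 7) j (by decide)
        refine ⟨_, rfl, hF2.set_scratch _ (by simp), hk, h2, Or.inr ⟨?_, ⟨j, hj⟩, ?_, hA⟩⟩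
        · rw [mem_set_scratch hF2.var_z]; exact one_ne_zero
        · exact var_setVar_self (t.setVar 3 j).tick 7 j
  · rintro t ⟨hF, hk, h2, h9⟩
    refine ⟨hF, hk, h2, h9.imp (fun h => ⟨h.1, funext fun j => h.2 j j.2⟩) id⟩

/-- The configuration after `m` rows have been processed. -/
def ElimInv (κ : ℂ) (A₀ : Matrix (Fin k) (Fin n) F) (b : Fin n → F) (m : ℕ) (s : Cfg F) : Prop :=
  ∃ (A E : Matrix (Fin k) (Fin n) F) (β : F), Frame A E b 0 β s ∧ s.ket = codeKet κ A b ∧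
    RowEquiv A₀ A ∧ (∀ i : Fin k, m ≤ i → E i = 0) ∧
    (β = 0 → ∀ i : Fin k, (i : ℕ) < m → A *ᵥ E i = Pi.single i 1) ∧
    (β ≠ 0 → ∃ v ≠ 0, v ᵥ* A₀ = 0)

theorem RowEquiv.trans {A B C : Matrix (Fin k) (Fin n) F} (h : RowEquiv A B) (h' : RowEquiv B C) :
    RowEquiv A C := by
  obtain ⟨T, T', hT, rfl⟩ := h
  obtain ⟨S, S', hS, rfl⟩ := h'
  refine ⟨S * T, T' * S', ?_, by rw [Matrix.mul_assoc]⟩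
  rw [Matrix.mul_assoc, ← Matrix.mul_assoc T, hT, Matrix.one_mul, hS]

/-- The corresponding row of the transformation matrix is a dependency among the rows of `A`, and it
is nonzero because the matrix is invertible. This certifies failure of the rank condition. -/
theorem RowEquiv.exists_vecMul_eq_zero {A B : Matrix (Fin k) (Fin n) F} (h : RowEquiv A B)
    {i : Fin k} (hi : B i = 0) : ∃ v ≠ 0, v ᵥ* A = 0 := by
  obtain ⟨T, T', hT, rfl⟩ := h
  refine ⟨(Pi.single i 1 : Fin k → F) ᵥ* T, fun h0 => ?_, ?_⟩
  · have := congrArg (fun v => v ᵥ* T') h0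
    rw [Matrix.vecMul_vecMul, hT, Matrix.vecMul_one, Matrix.zero_vecMul] at this
    simpa using congrFun this i
  · rw [Matrix.vecMul_vecMul, Matrix.single_one_vecMul]
    exact hi

theorem det_elim {A₀ : Matrix (Fin k) (Fin n) F} (hF : Frame A₀ 0 b 0 0 s)
    (hk : s.ket = codeKet κ A₀ b) : Det ω elimProg s (ElimInv κ A₀ b k) := by
  refine Det.loop hF.var_k (ElimInv κ A₀ b) ⟨A₀, 0, 0, hF.tick, hk, RowEquiv.refl _,
    fun _ _ => rfl, by simp, by simp⟩ ?_
  rintro m hm t ⟨A, E, β, hF, hk, hR, hE, hβ, hβ'⟩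
  refine Det.seq (det_search (i := ⟨m, hm⟩) (hF.setVar m (by decide)) (var_setVar_self t 2 m)) ?_
  rintro r ⟨hF, hk', h2, h9⟩
  replace hk : r.ket = codeKet κ A b := hk'.trans hk
  rcases h9 with ⟨h9, hz⟩ | ⟨h9, p, h7, hp⟩
  -- A zero row sets the failure cell to `1`, after which the invariant makes no claim about `E`;
  -- elimination of the remaining rows goes on harmlessly.
  · refine Det.ifZero_pos ((get_scratch hF.var_z 9).trans h9) ⟨_, rfl, A, E, 1,
      hF.tick.set_bad 1, hk, hR, fun i hi => hE i (by omega), fun h => absurd h one_ne_zero,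
      fun _ => hR.exists_vecMul_eq_zero hz⟩
  · refine Det.ifZero_neg (fun h => h9 ((get_scratch hF.var_z 9).symm.trans h))
      ((det_pivot hF.tick hk h2 h7 hp).mono ?_)
    rintro r' ⟨A', hF', hk', hA', hz'⟩
    refine ⟨A', _, β, hF', hk', hR.trans hA'.1, fun i hi => ?_, fun h0 i hi => ?_, hβ'⟩
    · funext j
      rw [if_neg (by rintro ⟨rfl, -⟩; simp at hi), hE i (by omega)]
    · by_cases him : i = ⟨m, hm⟩
      · subst him
        have : (fun j => if (⟨m, hm⟩ : Fin k) = ⟨m, hm⟩ ∧ j = p then (A ⟨m, hm⟩ p)⁻¹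
            else E ⟨m, hm⟩ j) = Pi.single p (A ⟨m, hm⟩ p)⁻¹ := by
          funext j
          rw [hE _ le_rfl]
          simp [Pi.single_apply]
        -- After the pivot step, column `p` has its only nonzero entry in row `m`, so its normalised
        -- basis vector is the new column of the right inverse.
        rw [this, Matrix.mulVec_single]
        funext i'
        by_cases hi' : i' = ⟨m, hm⟩
        · subst hi'
          simp [Matrix.col, hA'.2.1, mul_inv_cancel₀ hp]
        · simp [Matrix.col, hz' i' hi', hi']
      · have : (fun j => if i = (⟨m, hm⟩ : Fin k) ∧ j = p then (A ⟨m, hm⟩ p)⁻¹ else E i j) = E i := by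
          funext j; simp [him]
        rw [this]
        refine hA'.2.2 _ i him (hβ h0 i ?_)
        have : (i : ℕ) ≠ m := fun h => him (Fin.ext h)
        omega

end Elimination

/-! ### Erasing the message and measuring the word -/

section Measurement

variable {F : Type u} [Field F] [Fintype F] [DecidableEq F] {n k : ℕ} {ω : ℝ}
variable {A E : Matrix (Fin k) (Fin n) F} {b y : Fin n → F} {β : F} {s : Cfg F} {κ : ℂ}

theorem det_erase (hF : Frame A E b y β s) (hk : s.ket = codeKet κ A b)
    (hE : ∀ i : Fin k, A *ᵥ E i = Pi.single i 1) :
    Det ω eraseProg s fun t => Frame A E b y β t ∧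
      t.ket = ensemble (fun _ : Fin k → F => κ) 0 (fun t j => Pi.single ((t ᵥ* A) j) 1) b := by
  -- `Eᵀ` is a right inverse of `A`, so the message can be recomputed from the word `t A` and
  -- subtracted from itself.
  have top : ∀ (t : Fin k → F) (i : Fin k), partialEncode Eᵀ n (t ᵥ* A) i = t i := by
    intro t i
    rw [partialEncode_top]
    have : ((t ᵥ* A) ᵥ* Eᵀ) i = (t ᵥ* A) ⬝ᵥ E i := rfl
    rw [this, ← Matrix.dotProduct_mulVec, hE, dotProduct_single, mul_one]
  refine (Det.loop hF.var_k (fun i s => Frame A E b y β s ∧ s.ket = ensemble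
    (fun _ : Fin k → F => κ) (fun t i' => if (i' : ℕ) < i then 0 else t i')
    (fun t j => Pi.single ((t ᵥ* A) j) 1) b) ⟨hF.tick, hk.trans (by simp [codeKet]; rfl)⟩ ?_).mono ?_
  · rintro i hi s ⟨hF, hk⟩
    have hF' := hF.setVar (x := 2) i (by decide)
    refine (Det.loop hF'.var_n (fun j s => (Frame A E b y β s ∧ s.ket = ensemble
      (fun _ : Fin k → F => κ) (fun t => Function.update
        (fun i' : Fin k => if (i' : ℕ) < i then 0 else t i') ⟨i, hi⟩
        (t ⟨i, hi⟩ - partialEncode Eᵀ j (t ᵥ* A) ⟨i, hi⟩))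
      (fun t j => Pi.single ((t ᵥ* A) j) 1) b) ∧ s.var 2 = i)
      ⟨⟨hF'.tick, hk.trans ?_⟩, var_setVar_self s 2 i⟩ ?_).mono ?_
    · congr 1
      funext t
      symm
      rw [Function.update_eq_self_iff]
      simp [partialEncode]
    · rintro j hj r ⟨⟨hF, hk⟩, h2⟩
      have hF1 := hF.setVar (x := 3) j (by decide)
      have h2' : (r.setVar 3 j).var 2 = (⟨i, hi⟩ : Fin k) := h2
      have h3' : (r.setVar 3 j).var 3 = (⟨j, hj⟩ : Fin n) := var_setVar_self r 3 j
      refine Det.seq (Q := fun r' => r' = (r.setVar 3 j).set ⟨4, 6, 6⟩ (-E ⟨i, hi⟩ ⟨j, hj⟩))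
        ⟨_, rfl, ?_⟩ ?_
      · rw [hF1.get_piv h2' h3']
      · rintro _ rfl
        have hF2 := hF1.set_scratch (a := ⟨4, 6, 6⟩) (-E ⟨i, hi⟩ ⟨j, hj⟩) (by simp)
        refine ⟨_, rfl, ⟨hF2.setKet _, ?_⟩, h2⟩
        change gate2 (caddMatrix (((r.setVar 3 j).set ⟨4, 6, 6⟩ (-E ⟨i, hi⟩ ⟨j, hj⟩)).get ⟨4, 6, 6⟩))
          ((r.setVar 3 j).addr ⟨1, 3⟩) ((r.setVar 3 j).addr ⟨0, 2⟩) r.ket = _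
        rw [get_scratch hF2.var_z, mem_set_scratch hF1.var_z, addr_eq h2', addr_eq h3', hk]
        refine (cadd_ensemble_word_msg _ _ _ _ _ ⟨j, hj⟩ ⟨i, hi⟩ (fun t => (t ᵥ* A) ⟨j, hj⟩)
          fun t => rfl).trans ?_
        congr 1
        funext t
        rw [Function.update_idem, Function.update_self, partialEncode_succ Eᵀ hj,
          Matrix.transpose_apply]
        congr 1
        ring
    · rintro r ⟨⟨hF, hk⟩, -⟩
      refine ⟨hF, hk.trans ?_⟩
      congr 1
      funext t
      rw [top, sub_self]
      exact update_ite_lt hi _ _ rfl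
  · rintro t ⟨hF, hk⟩
    refine ⟨hF, hk.trans ?_⟩
    congr 1
    funext t
    exact ite_lt_top _ _

/-- The amplitude of the outcome `v` when a symbol `a` with flag `β` is measured. -/
def symAmp (β v a : F) : ℂ := if β = 0 then qftMatrix F v a else (Pi.single a 1 : F → ℂ) v

theorem prod_ite_lt_succ {M : Type*} [CommMonoid M] {j : ℕ} (hj : j < n) (g : Fin n → M) :
    (∏ i : Fin n, if (i : ℕ) < j + 1 then g i else 1) =
      (∏ i : Fin n, if (i : ℕ) < j then g i else 1) * g ⟨j, hj⟩ := by
  rw [← Finset.mul_prod_erase Finset.univ (fun i : Fin n => if (i : ℕ) < j then g i else 1)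
      (Finset.mem_univ (⟨j, hj⟩ : Fin n)),
    ← Finset.mul_prod_erase Finset.univ (fun i : Fin n => if (i : ℕ) < j + 1 then g i else 1)
      (Finset.mem_univ (⟨j, hj⟩ : Fin n))]
  simp only [lt_add_iff_pos_right, zero_lt_one, if_true, lt_irrefl, if_false, one_mul]
  rw [mul_comm]
  congr 1
  refine Finset.prod_congr rfl fun i hi => ?_
  have : (i : ℕ) ≠ j := fun h => Finset.ne_of_mem_erase hi (Fin.ext h)
  by_cases h : (i : ℕ) < j
  · rw [if_pos h, if_pos (by omega)]
  · rw [if_neg h, if_neg (by omega)]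

theorem prod_symAmp_update {j : ℕ} (hj : j < n) (b y a : Fin n → F) (v : F) :
    (∏ i : Fin n, if (i : ℕ) < j then symAmp (b i) (y i) (a i) else 1) *
        symAmp (b ⟨j, hj⟩) v (a ⟨j, hj⟩) =
      ∏ i : Fin n, if (i : ℕ) < j + 1 then
        symAmp (b i) (Function.update y ⟨j, hj⟩ v i) (a i) else 1 := by
  rw [prod_ite_lt_succ hj (fun i : Fin n =>
    symAmp (b i) (Function.update y ⟨j, hj⟩ v i) (a i)), Function.update_self]
  congr 1
  refine Finset.prod_congr rfl fun i _ => ?_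
  by_cases h : (i : ℕ) < j
  · rw [if_pos h, if_pos h, Function.update_of_ne (by rintro rfl; simp at h)]
  · rw [if_neg h, if_neg h]

theorem update_single_ite {j : ℕ} (hj : j < n) (y a : Fin n → F) (v : F) :
    Function.update (fun i : Fin n => if (i : ℕ) < j then (Pi.single (y i) 1 : F → ℂ) else
        Pi.single (a i) 1) ⟨j, hj⟩ (Pi.single v 1) =
      fun i : Fin n => if (i : ℕ) < j + 1 then
        Pi.single (Function.update y ⟨j, hj⟩ v i) 1 else Pi.single (a i) 1 := by
  rw [← update_ite_lt hj (fun i => (Pi.single (Function.update y ⟨j, hj⟩ v i) 1 : F → ℂ)) _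
    (v := Pi.single v 1) (by simp)]
  congr 1
  funext i
  by_cases h : (i : ℕ) < j
  · rw [if_pos h, if_pos h, Function.update_of_ne (by rintro rfl; simp at h)]
  · rw [if_neg h, if_neg h]

/-- The configuration after the first `j` symbols have been measured. -/
def MeasInv (κ : ℂ) (A E : Matrix (Fin k) (Fin n) F) (b : Fin n → F) (β : F) (j : ℕ)
    (y : Fin n → F) (s : Cfg F) : Prop :=
  Frame A E b y β s ∧ s.ket = ensemble
    (fun t => κ * ∏ j' : Fin n, if (j' : ℕ) < j then symAmp (b j') (y j') ((t ᵥ* A) j') else 1) 0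
    (fun t j' => if (j' : ℕ) < j then Pi.single (y j') 1 else Pi.single ((t ᵥ* A) j') 1) b

theorem branches_measBody {j : ℕ} (hj : j < n) (h : MeasInv κ A E b β j y s) :
    Branches ω measBody (s.setVar 3 j) fun v =>
      MeasInv κ A E b β (j + 1) (Function.update y ⟨j, hj⟩ v) := by
  obtain ⟨hF, hk⟩ := h
  set c : (Fin k → F) → ℂ := fun t =>
    κ * ∏ j' : Fin n, if (j' : ℕ) < j then symAmp (b j') (y j') ((t ᵥ* A) j') else 1 with hc
  set f : (Fin k → F) → Fin n → F → ℂ := fun t j' =>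
    if (j' : ℕ) < j then Pi.single (y j') 1 else Pi.single ((t ᵥ* A) j') 1 with hf
  have hfj : ∀ t, f t ⟨j, hj⟩ = Pi.single ((t ᵥ* A) ⟨j, hj⟩) 1 := fun t => by simp [hf]
  have hF1 := hF.setVar (x := 3) j (by decide)
  have h3 : (s.setVar 3 j).var 3 = j := var_setVar_self s 3 j
  have hget : (s.setVar 3 j).get ⟨3, 6, 3⟩ = b ⟨j, hj⟩ := by
    simp only [Cfg.get, h3, hF1.var_z]
    exact hF1.flag ⟨j, hj⟩
  refine Det.seq_branches (Q := fun r => Frame A E b y β r ∧ r.var 3 = j ∧ r.ket = ensemble c 0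
    (fun t => Function.update (f t) ⟨j, hj⟩
      fun v => symAmp (b ⟨j, hj⟩) v ((t ᵥ* A) ⟨j, hj⟩)) b) ?_ ?_
  · by_cases hb : b ⟨j, hj⟩ = 0
    · refine Det.ifZero_pos (hget.trans hb) ⟨_, rfl, hF1.tick.setKet _, h3, ?_⟩
      change gate1 (qftMatrix F) ((s.setVar 3 j).addr ⟨1, 3⟩) s.ket = _
      rw [addr_eq h3, hk]
      refine (gate1_ensemble _ _ _ _ _ ⟨j, hj⟩).trans ?_
      congr 1
      funext t
      rw [hfj]
      congr 1
      funext v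
      rw [symAmp, if_pos hb]
      exact congrFun (qftOp_single _) v
    -- A lost symbol is measured without a transform; `symAmp` is then the amplitude of a basis
    -- state and the quantum state does not change.
    · refine Det.ifZero_neg (fun h => hb (hget.symm.trans h)) ⟨_, rfl, hF1.tick.tick, h3, hk.trans ?_⟩
      congr 1
      funext t
      symm
      rw [Function.update_eq_self_iff, hfj]
      funext v
      rw [symAmp, if_neg hb]
  · rintro r ⟨hF, h3, hk⟩
    refine ⟨_, rfl, fun v => ⟨(hF.set_out v (j := ⟨j, hj⟩) h3).withKet _, ?_⟩⟩
    change r.ket.filter (fun w => w (r.addr ⟨1, 3⟩) = v) = _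
    rw [addr_eq h3, hk]
    refine (filter_ensemble_word _ _ _ _ ⟨j, hj⟩ v).trans ?_
    simp only [Function.update_self, Function.update_idem]
    unfold ensemble
    refine Finset.sum_congr rfl fun t _ => ?_
    rw [hc, hf]
    beta_reduce
    rw [mul_assoc, prod_symAmp_update hj, update_single_ite hj]

/-- The state with empty message, measured word `y` and flags `b`. -/
theorem ensemble_single (c : (Fin k → F) → ℂ) (y b : Fin n → F) :
    ensemble c 0 (fun _ j => Pi.single (y j) 1) b = Finsupp.single
      (basisAt (cellAddr (n := n) (k := k)) (Sum.elim 0 (Sum.elim y b))) (∑ t, c t) := by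
  unfold ensemble
  rw [single_finset_sum]
  refine Finset.sum_congr rfl fun t _ => ?_
  have : cellState ((0 : (Fin k → F) → Fin k → F) t) (fun j => (Pi.single (y j) 1 : F → ℂ)) b =
      fun i => Pi.single ((Sum.elim 0 (Sum.elim y b) : Cell n k → F) i) 1 := by
    funext i
    rcases i with i | i | i <;> rfl
  rw [this, prodKet_basis, Finsupp.smul_single, smul_eq_mul, mul_one]

/-- Different messages are orthogonal, even when they encode to the same word. Thus the failure
branch has the right probability also for rank deficient matrices. -/
theorem weight_codeKet (hk : s.ket = codeKet κ A b) :
    s.weight = (Fintype.card F : ℝ) ^ k * ‖κ‖ ^ 2 := by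
  rw [weight_sum_single s (T := Fin k → F) (w := fun t => basisAt (cellAddr (n := n) (k := k))
    (Sum.elim t (Sum.elim (t ᵥ* A) b))) ?_ (fun _ => κ) ?_]
  · simp
  · intro t t' h
    have := basisAt_injective cellAddr_injective h
    funext i
    exact congrFun this (.inl i)
  · rw [hk]
    unfold codeKet ensemble
    refine Finset.sum_congr rfl fun t _ => ?_
    have : cellState (id t) (fun j => (Pi.single ((t ᵥ* A) j) 1 : F → ℂ)) b =
        fun i => Pi.single ((Sum.elim t (Sum.elim (t ᵥ* A) b) : Cell n k → F) i) 1 := by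
      funext i
      rcases i with i | i | i <;> rfl
    rw [this, prodKet_basis, Finsupp.smul_single, smul_eq_mul, mul_one]

theorem expect_ifZero (a : CLoc) (c d : Cmd) (Φ : Cfg F → ℝ) (s : Cfg F) :
    expect ω (.ifZero a c d) Φ s =
      if s.get a = 0 then expect ω c Φ s.tick else expect ω d Φ s.tick := by
  unfold expect
  conv_lhs => rw [run]
  split_ifs <;> rfl

/-- The contribution of the output `z` to the output distribution. -/
def outWeight (z : Fin n → F) (s : Cfg F) : ℝ := if output n s = z then s.weight else 0

/-- With the message erased, all `t` lead to the same basis state for a given outcome. Amplitudes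
are summed before squaring, and this interference produces the Fourier transform of the code. -/
theorem expect_eraseMeas (hF : Frame A E b 0 β s) (hk : s.ket = codeKet κ A b)
    (hE : ∀ i : Fin k, A *ᵥ E i = Pi.single i 1) (z : Fin n → F) :
    expect ω (.seq eraseProg measProg) (outWeight z) s =
      ‖κ‖ ^ 2 * ‖∑ t : Fin k → F, ∏ j, symAmp (b j) (z j) ((t ᵥ* A) j)‖ ^ 2 := by
  rw [expect_seq]
  refine (det_erase hF hk hE).expect_eq fun t ht => ?_
  refine (expect_loop ht.1.var_n (MeasInv κ A E b β) ⟨ht.1.tick, ht.2.trans (by simp)⟩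
    (fun j hj y t _ h => branches_measBody hj h) (g := fun y => if y = z then
      ‖κ‖ ^ 2 * ‖∑ t : Fin k → F, ∏ j, symAmp (b j) (y j) ((t ᵥ* A) j)‖ ^ 2 else 0) ?_).trans ?_
  · rintro y s ⟨hF, hk⟩
    have ho : output n s = y := funext fun j => hF.out j
    rw [outWeight, ho]
    refine if_congr Iff.rfl ?_ rfl
    have : s.ket = ∑ _u : Unit, Finsupp.single
        (basisAt (cellAddr (n := n) (k := k)) (Sum.elim 0 (Sum.elim y b)))
        (∑ t : Fin k → F, κ * ∏ j, symAmp (b j) (y j) ((t ᵥ* A) j)) := by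
      rw [hk, Fintype.sum_unique]
      simp only [Fin.is_lt, if_true]
      exact ensemble_single _ _ _
    rw [weight_sum_single s (T := Unit) (w := fun _ => _) (fun _ _ _ => rfl) (fun _ => _) this,
      Fintype.sum_unique, ← Finset.mul_sum, norm_mul, mul_pow]
  · rw [Finset.sum_ite_eq' Finset.univ z, if_pos (Finset.mem_univ _)]

/-- The positions with flag `0`. -/
def zeroFlags (b : Fin n → F) : Finset (Fin n) := Finset.univ.filter fun j => b j = 0

theorem mem_zeroFlags {b : Fin n → F} {j : Fin n} : j ∈ zeroFlags b ↔ b j = 0 := by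
  simp [zeroFlags]

/-- Lost positions carry the symbol `0`, so `z` must vanish there. The remaining phases combine to
the character of `t ⬝ᵥ H z`, and orthogonality over `t` forces `H z = 0`. -/
theorem sum_prod_symAmp (H : Matrix (Fin k) (Fin n) F) (b z : Fin n → F) :
    ∑ t : Fin k → F, ∏ j, symAmp (b j) (z j) ((t ᵥ* maskCols b H) j) =
      if (∀ i, i ∉ zeroFlags b → z i = 0) ∧ H *ᵥ z = 0 then
        invSqrtCard F ^ (zeroFlags b).card * (Fintype.card F : ℂ) ^ k else 0 := by
  by_cases hz : ∀ i, i ∉ zeroFlags b → z i = 0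
  · have e : ∀ t : Fin k → F, ∏ j, symAmp (b j) (z j) ((t ᵥ* maskCols b H) j) =
        invSqrtCard F ^ (zeroFlags b).card * traceChar F (t ⬝ᵥ (H *ᵥ z)) := by
      intro t
      have e1 : ∀ j, symAmp (b j) (z j) ((t ᵥ* maskCols b H) j) =
          (if j ∈ zeroFlags b then invSqrtCard F else 1) * traceChar F ((t ᵥ* H) j * z j) := by
        intro j
        rw [symAmp, vecMul_maskCols]
        by_cases hj : b j = 0
        · rw [if_pos hj, if_pos hj, if_pos (mem_zeroFlags.2 hj), qftMatrix_apply, mul_comm (z j)]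
          rfl
        · rw [if_neg hj, if_neg hj, if_neg (fun h => hj (mem_zeroFlags.1 h)),
            hz j (fun h => hj (mem_zeroFlags.1 h))]
          simp
      simp only [e1]
      rw [Finset.prod_mul_distrib, ← traceChar_sum, Finset.prod_ite_mem, Finset.univ_inter,
        Finset.prod_const, Matrix.dotProduct_mulVec]
      rfl
    simp only [e]
    rw [← Finset.mul_sum, sum_traceChar_dotProduct, Fintype.card_fin]
    split_ifs with h1 h2 h2
    · rfl
    · exact absurd ⟨hz, h1⟩ h2
    · exact absurd h2.2 h1
    · rw [mul_zero]
  · rw [if_neg (fun h => hz h.1)]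
    push Not at hz
    obtain ⟨i, hi, hzi⟩ := hz
    have hbi : b i ≠ 0 := fun h => hi (mem_zeroFlags.2 h)
    refine Finset.sum_eq_zero fun t _ => Finset.prod_eq_zero (Finset.mem_univ i) ?_
    rw [symAmp, if_neg hbi, vecMul_maskCols, if_neg hbi, Pi.single_eq_of_ne hzi]

theorem rank_cols_of_mul_eq_one {H : Matrix (Fin k) (Fin n) F} {M : Matrix (Fin n) (Fin k) F}
    (h : maskCols b H * M = 1) : (cols H (zeroFlags b)).rank = k := by
  refine (rank_eq_iff_exists_right_inverse _).2 ⟨M.submatrix (fun j => (j : Fin n)) id, ?_⟩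
  rw [← h]
  ext i i'
  simp only [Matrix.mul_apply, cols, Matrix.submatrix_apply, id, maskCols, ite_mul, zero_mul]
  rw [← Finset.sum_filter, Finset.univ_eq_attach, Finset.sum_attach (zeroFlags b)
    (fun j => H i j * M j i')]
  rfl

theorem rank_cols_ne_of_vecMul_eq_zero {H : Matrix (Fin k) (Fin n) F} {v : Fin k → F} (hv : v ≠ 0)
    (h : v ᵥ* maskCols b H = 0) : (cols H (zeroFlags b)).rank ≠ k := by
  intro hr
  refine hv (vecMul_injective_of_rank_eq hr ?_)
  funext j
  have := congrFun h j
  rw [vecMul_maskCols, if_pos (mem_zeroFlags.1 j.2)] at this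
  exact this.trans (congrFun (Matrix.zero_vecMul _) j).symm

variable (F) in
theorem sq_norm_invSqrtCard : ‖invSqrtCard F‖ ^ 2 = (Fintype.card F : ℝ)⁻¹ := by
  have hq := one_lt_card_real F
  rw [invSqrtCard, Complex.norm_real, Real.norm_eq_abs, sq_abs, div_pow,
    Real.sq_sqrt (by linarith), one_pow, one_div]

/-- The law of the output after state discrimination, for the amplitude `κ` of a codeword. -/
theorem expect_elim {H : Matrix (Fin k) (Fin n) F} (hF : Frame (maskCols b H) 0 b 0 0 s)
    (hk : s.ket = codeKet κ (maskCols b H) b) (z : Fin n → F) :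
    expect ω (.seq elimProg (.ifZero ⟨8, 6, 6⟩ (.seq eraseProg measProg) .skip)) (outWeight z) s =
      (Fintype.card F : ℝ) ^ k * ‖κ‖ ^ 2 * condLaw H (zeroFlags b) z := by
  have hq := one_lt_card_real F
  rw [expect_seq]
  refine (det_elim hF hk).expect_eq fun t ht => ?_
  obtain ⟨A, E, β, hF, hk, ⟨T, T', hT, rfl⟩, -, hβ, hβ'⟩ := ht
  have hbad : t.get ⟨8, 6, 6⟩ = β := by simp [Cfg.get, hF.var_z, hF.bad]
  by_cases hb : β = 0
  · have hE : ∀ i : Fin k, (T * maskCols b H) *ᵥ E i = Pi.single i 1 := fun i => hβ hb i i.2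
    rw [expect_ifZero, if_pos (hbad.trans hb), expect_eraseMeas hF.tick hk hE]
    have hrank : (cols H (zeroFlags b)).rank = k := by
      -- Elimination gives `T (H' Eᵀ) = 1` for the masked matrix `H'`. These factors are square,
      -- hence commute, and `Eᵀ T` is a right inverse of `H'`.
      refine rank_cols_of_mul_eq_one (M := Eᵀ * T) ?_
      have h1 : T * (maskCols b H * Eᵀ) = 1 := by
        rw [← Matrix.mul_assoc]
        ext i i'
        have := congrFun (hE i') i
        rw [Matrix.one_apply, Matrix.mul_apply]
        rw [Matrix.mulVec, dotProduct] at this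
        simpa [Pi.single_apply] using this
      rw [← Matrix.mul_assoc]
      exact mul_eq_one_comm.1 h1
    -- The sum over messages is invariant under the invertible substitution `t ↦ t T`, so the row
    -- operations have no effect on the output.
    have hsum : ∑ t : Fin k → F, ∏ j, symAmp (b j) (z j) ((t ᵥ* (T * maskCols b H)) j) =
        ∑ t : Fin k → F, ∏ j, symAmp (b j) (z j) ((t ᵥ* maskCols b H) j) := by
      refine Fintype.sum_equiv ⟨fun t => t ᵥ* T, fun t => t ᵥ* T', fun t => ?_, fun t => ?_⟩ _ _
        fun t => ?_
      · simp only [Matrix.vecMul_vecMul, hT, Matrix.vecMul_one]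
      · simp only [Matrix.vecMul_vecMul, mul_eq_one_comm.1 hT, Matrix.vecMul_one]
      · simp only [Equiv.coe_fn_mk, Matrix.vecMul_vecMul]
    rw [hsum, sum_prod_symAmp, condLaw, if_pos hrank]
    split_ifs
    · rw [norm_mul, norm_pow, norm_pow, mul_pow, ← pow_mul, mul_comm (zeroFlags b).card, pow_mul,
        sq_norm_invSqrtCard, inv_pow, Complex.norm_natCast]
      field_simp
    · simp
  · obtain ⟨v, hv, hv0⟩ := hβ' hb
    have e : expect ω .skip (outWeight z) t.tick = outWeight z t.tick.tick :=
      Multiset.sum_singleton _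
    have ho : output n t.tick.tick = 0 := funext fun j => hF.out j
    rw [expect_ifZero, if_neg (fun h => hb (hbad.symm.trans h)), e, outWeight, ho, condLaw, if_neg (rank_cols_ne_of_vecMul_eq_zero hv hv0)]
    have hw : t.tick.tick.weight = (Fintype.card F : ℝ) ^ k * ‖κ‖ ^ 2 :=
      weight_codeKet (s := t.tick.tick) hk
    rw [hw]
    by_cases hz : z = 0
    · rw [if_pos hz.symm, if_pos hz, mul_one]
    · rw [if_neg (Ne.symm hz), if_neg hz, mul_zero]

theorem sum_flagAmp_ne_zero (h0 : 0 ≤ ω)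
    (h1 : ω ≤ ((Fintype.card F : ℝ) - 1) / Fintype.card F) :
    ∑ v ∈ Finset.univ.filter (fun v : F => v ≠ 0), flagAmp F ω v ^ 2 = 1 - usdProb F ω := by
  rw [Finset.sum_eq_single (1 : F)]
  · rw [flagAmp, if_neg one_ne_zero, if_pos rfl,
      Real.sq_sqrt (sub_nonneg.2 (usdProb_le_one h0 h1))]
  · intro v hv hv1
    rw [flagAmp, if_neg (Finset.mem_filter.1 hv).2, if_neg hv1]
    simp
  · simp

/-- Flags are `q`-level cells, but values other than `0` and `1` have amplitude zero; summing over
the nonzero values at each position outside `J` gives `1 - p`. -/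
theorem sum_prod_flagAmp (h0 : 0 ≤ ω) (h1 : ω ≤ ((Fintype.card F : ℝ) - 1) / Fintype.card F)
    (J : Finset (Fin n)) :
    ∑ b ∈ Finset.univ.filter (fun b : Fin n → F => zeroFlags b = J), ∏ j, flagAmp F ω (b j) ^ 2 =
      subsetProb (usdProb F ω) J := by
  have e : Finset.univ.filter (fun b : Fin n → F => zeroFlags b = J) =
      Fintype.piFinset fun j => if j ∈ J then {0} else Finset.univ.filter fun v : F => v ≠ 0 := by
    ext b
    simp only [Finset.mem_filter, Finset.mem_univ, true_and, Fintype.mem_piFinset,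
      Finset.ext_iff, mem_zeroFlags]
    refine forall_congr' fun j => ?_
    by_cases hj : j ∈ J <;> simp [hj]
  rw [e, ← Finset.prod_univ_sum (f := fun _ v => flagAmp F ω v ^ 2), subsetProb]
  refine Finset.prod_congr rfl fun j _ => ?_
  by_cases hj : j ∈ J
  · rw [if_pos hj, if_pos hj, Finset.sum_singleton, flagAmp, if_pos rfl,
      Real.sq_sqrt usdProb_nonneg]
  · rw [if_neg hj, if_neg hj, sum_flagAmp_ne_zero h0 h1]

theorem outProb_regevProg (h0 : 0 ≤ ω) (h1 : ω ≤ ((Fintype.card F : ℝ) - 1) / Fintype.card F)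
    (H : Matrix (Fin k) (Fin n) F) (z : Fin n → F) :
    outProb ω regevProg H z = outputLaw ω H z := by
  have hq := one_lt_card_real F
  have e : outProb ω regevProg H z = expect ω regevProg (outWeight z) (initCfg H) := rfl
  rw [e, regevProg, expect_seq]
  refine (det_prep h0 h1 H).expect_eq fun t ht => ?_
  rw [expect_seq]
  have hmask : maskCols (0 : Fin n → F) H = H := by
    ext i j
    simp [maskCols]
  refine (expect_loop ht.1.var_n (UsdInv ω H) ⟨?_, ?_⟩
    (fun j hj b t hb h => branches_usdBody h0 h1 hj hb h)
    (g := fun b => (∏ j, flagAmp F ω (b j) ^ 2) * condLaw H (zeroFlags b) z) ?_).trans ?_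
  · rw [hmask]
    exact ht.1.tick
  · refine ht.2.trans ?_
    simp [flagCoeff]
  · rintro b t ⟨hF, hk⟩
    have hk' : t.ket = codeKet (flagCoeff F ω k n b) (maskCols b H) b := by
      rw [hk]
      unfold codeKet
      congr 1
      funext t
      exact ite_lt_top _ _
    rw [expect_elim hF hk']
    congr 1
    rw [flagCoeff, norm_mul, norm_pow, mul_pow, ← pow_mul, mul_comm k, pow_mul,
      sq_norm_invSqrtCard, ← mul_assoc, ← mul_pow, mul_inv_cancel₀ (by linarith), one_pow, one_mul]
    simp only [Fin.is_lt, if_true]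
    rw [norm_prod, ← Finset.prod_pow]
    refine Finset.prod_congr rfl fun j _ => ?_
    rw [Complex.norm_real, Real.norm_eq_abs, sq_abs]
  · rw [outputLaw_eq h0 h1, ← Finset.sum_fiberwise_of_maps_to (s := Finset.univ)
      (t := Finset.univ) (g := zeroFlags) (fun _ _ => Finset.mem_univ _)]
    refine Finset.sum_congr rfl fun J _ => ?_
    rw [← sum_prod_flagAmp h0 h1, Finset.sum_mul]
    refine Finset.sum_congr rfl fun b hb => ?_
    rw [(Finset.mem_filter.1 hb).2]

end Measurement

/-! ### Parity-check matrices with a given codeword -/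

section Counting

variable {F : Type u} [Field F] [Fintype F] [DecidableEq F] {n k : ℕ}

theorem rank_eq_of_vecMul_injective {ι : Type*} [Fintype ι] [DecidableEq ι] {A : Matrix (Fin k) ι F}
    (h : ∀ y, y ᵥ* A = 0 → y = 0) : A.rank = k := by
  have inj : Function.Injective A.vecMul := by
    intro y y' hy
    rw [← sub_eq_zero]
    apply h
    rw [Matrix.sub_vecMul, sub_eq_zero]
    exact hy
  simpa using (Matrix.vecMul_injective_iff.1 inj).rank_matrix

variable (J : Finset (Fin n)) (z : Fin n → F)

variable (k) in
/-- The parity-check matrices of the codes that contain `z`. -/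
def checkMatrices : Finset (Matrix (Fin k) (Fin n) F) := Finset.univ.filter fun H => H *ᵥ z = 0

/-- The words that are supported in `J` and orthogonal to `z`. -/
def orthogonalWords : Finset (Fin n → F) :=
  Finset.univ.filter fun w => (∀ i, i ∉ J → w i = 0) ∧ w ⬝ᵥ z = 0

variable {J z}

/-- At most `k` linear conditions are imposed. In the injection below a matrix is corrected in the
single column `j`, where `z j ≠ 0`, to have zero syndrome; recording the old syndrome makes this
reversible. -/
theorem card_le_card_checkMatrices (hz : z ≠ 0) :
    Fintype.card F ^ (k * n) ≤ (checkMatrices k z).card * Fintype.card F ^ k := by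
  obtain ⟨j, hj⟩ := Function.ne_iff.1 hz
  have h1 : Fintype.card F ^ (k * n) = (Finset.univ : Finset (Matrix (Fin k) (Fin n) F)).card := by
    have : Fintype.card (Matrix (Fin k) (Fin n) F) = Fintype.card (Fin k → Fin n → F) := rfl
    rw [Finset.card_univ, this]
    simp [← pow_mul, mul_comm]
  have h2 : Fintype.card F ^ k = (Finset.univ : Finset (Fin k → F)).card := by simp
  rw [h1, h2, ← Finset.card_product]
  refine Finset.card_le_card_of_injOn
    (fun H => (H - Matrix.vecMulVec (H *ᵥ z) (Pi.single j (z j)⁻¹), H *ᵥ z)) ?_ ?_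
  · intro H _
    simp only [Finset.coe_product, Set.mem_prod, Finset.mem_coe, Finset.mem_univ, and_true,
      checkMatrices, Finset.mem_filter, true_and]
    rw [Matrix.sub_mulVec, Matrix.vecMulVec_mulVec, single_dotProduct, inv_mul_cancel₀ hj]
    simp
  · intro H _ H' _ h
    simp only [Prod.mk.injEq] at h
    rw [h.2] at h
    exact sub_left_injective h.1

theorem card_le_card_orthogonalWords (hz : z ≠ 0) (hJ : ∀ i, i ∉ J → z i = 0) :
    Fintype.card F ^ J.card ≤ (orthogonalWords J z).card * Fintype.card F := by
  obtain ⟨j, hj⟩ := Function.ne_iff.1 hz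
  have hjJ : j ∈ J := by
    by_contra h
    exact hj (hJ j h)
  have h1 : Fintype.card F ^ J.card = (Finset.univ : Finset (J → F)).card := by simp
  rw [h1, ← Finset.card_univ (α := F), ← Finset.card_product]
  set ext : (J → F) → Fin n → F := fun v i => if h : i ∈ J then v ⟨i, h⟩ else 0 with hext
  refine Finset.card_le_card_of_injOn
    (fun v => (ext v - Pi.single j (ext v ⬝ᵥ z * (z j)⁻¹), ext v ⬝ᵥ z)) ?_ ?_
  · intro v _
    simp only [Finset.coe_product, Set.mem_prod, Finset.mem_coe, Finset.mem_univ, and_true,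
      orthogonalWords, Finset.mem_filter, true_and]
    refine ⟨fun i hi => ?_, ?_⟩
    · have : i ≠ j := fun h => hi (h ▸ hjJ)
      simp [hext, hi, this]
    · rw [sub_dotProduct, single_dotProduct, mul_assoc, inv_mul_cancel₀ hj, mul_one, sub_self]
  · intro v _ v' _ h
    simp only [Prod.mk.injEq] at h
    rw [h.2] at h
    have := sub_left_injective h.1
    funext i
    simpa [hext] using congrFun this i

/-- Adding a rank one matrix with row space spanned by `w ⟂ z` keeps `H z = 0`. With the column
vector normalised against `y`, the word `w` is read off as `y` times the new matrix on `J`, because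
`y H` vanished there. -/
theorem card_mul_card_orthogonalWords_le {y : Fin k → F} (hy : y ≠ 0) :
    ((checkMatrices k z).filter fun H => ∀ j ∈ J, (y ᵥ* H) j = 0).card *
      (orthogonalWords J z).card ≤ (checkMatrices k z).card := by
  obtain ⟨i, hi⟩ := Function.ne_iff.1 hy
  rw [← Finset.card_product]
  refine Finset.card_le_card_of_injOn
    (fun p => p.1 + Matrix.vecMulVec (Pi.single i (y i)⁻¹) p.2) ?_ ?_
  · rintro ⟨H, w⟩ hp
    simp only [Finset.coe_product, Set.mem_prod, Finset.mem_coe, checkMatrices, orthogonalWords,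
      Finset.mem_filter, Finset.mem_univ, true_and] at hp ⊢
    rw [Matrix.add_mulVec, hp.1.1, Matrix.vecMulVec_mulVec, hp.2.2]
    simp
  · rintro ⟨H, w⟩ hp ⟨H', w'⟩ hp' h
    simp only [Finset.coe_product, Set.mem_prod, Finset.mem_coe, checkMatrices, orthogonalWords,
      Finset.mem_filter, Finset.mem_univ, true_and] at hp hp'
    have hw : w = w' := by
      funext j
      by_cases hj : j ∈ J
      · have := congrFun (congrArg (fun M => y ᵥ* M) h) j
        simpa [Matrix.vecMul_add, Matrix.vecMul_vecMulVec, hp.1.2 j hj, hp'.1.2 j hj, show y i ≠ 0 from hi] using this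
      · rw [hp.2.1 j hj, hp'.2.1 j hj]
    subst hw
    rw [Prod.mk.injEq]
    exact ⟨add_right_cancel h, rfl⟩

/-- If `H_J` is rank deficient, some `y ≠ 0` kills it. Each such `y` accounts for a fraction at most
`q ^ (1 - |J|)` of the matrices with `H z = 0`; fewer than `q ^ k` of them together cover at most `1
/ q ≤ 1 / 2`. -/
theorem card_le_card_rank_eq (hz : z ≠ 0) (hJ : ∀ i, i ∉ J → z i = 0) (hk : k + 2 ≤ J.card) :
    Fintype.card F ^ (k * n) ≤ 2 * Fintype.card F ^ k *
      (Finset.univ.filter fun H : Matrix (Fin k) (Fin n) F =>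
        H *ᵥ z = 0 ∧ (cols H J).rank = k).card := by
  set good := Finset.univ.filter fun H : Matrix (Fin k) (Fin n) F =>
    H *ᵥ z = 0 ∧ (cols H J).rank = k with hgood
  set S := checkMatrices k z with hS
  set W := orthogonalWords J z with hW
  set q := Fintype.card F with hq
  have hq2 : 2 ≤ q := Fintype.one_lt_card
  have hS1 := card_le_card_checkMatrices (k := k) hz
  have hW1 := card_le_card_orthogonalWords hz hJ
  have hW2 : 2 * q ^ k ≤ W.card := by
    have h1 : q ^ (k + 1) * q ≤ W.card * q := by
      rw [← pow_succ]
      exact (Nat.pow_le_pow_right (by omega) hk).trans hW1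
    have h2 : q ^ (k + 1) ≤ W.card := Nat.le_of_mul_le_mul_right h1 (by omega)
    rw [pow_succ] at h2
    nlinarith [Nat.mul_le_mul_left (q ^ k) hq2]
  have hcov : S ⊆ good ∪ (Finset.univ.filter fun y : Fin k → F => y ≠ 0).biUnion
      fun y => S.filter fun H => ∀ j ∈ J, (y ᵥ* H) j = 0 := by
    intro H hH
    have hHz : H *ᵥ z = 0 := (Finset.mem_filter.1 hH).2
    by_cases hr : (cols H J).rank = k
    · exact Finset.mem_union_left _ (Finset.mem_filter.2 ⟨Finset.mem_univ _, hHz, hr⟩)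
    · refine Finset.mem_union_right _ ?_
      by_contra hcon
      refine hr (rank_eq_of_vecMul_injective fun y hy => ?_)
      by_contra hy0
      refine hcon (Finset.mem_biUnion.2 ⟨y, Finset.mem_filter.2 ⟨Finset.mem_univ _, hy0⟩,
        Finset.mem_filter.2 ⟨hH, fun j hj => ?_⟩⟩)
      exact congrFun hy ⟨j, hj⟩
  have hsum : S.card * W.card ≤ good.card * W.card + q ^ k * S.card := by
    calc S.card * W.card
        ≤ (good.card + ∑ y ∈ Finset.univ.filter (fun y : Fin k → F => y ≠ 0),
            (S.filter fun H => ∀ j ∈ J, (y ᵥ* H) j = 0).card) * W.card :=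
          Nat.mul_le_mul_right _ ((Finset.card_le_card hcov).trans
            ((Finset.card_union_le _ _).trans (Nat.add_le_add_left Finset.card_biUnion_le _)))
      _ = good.card * W.card + ∑ y ∈ Finset.univ.filter (fun y : Fin k → F => y ≠ 0),
            (S.filter fun H => ∀ j ∈ J, (y ᵥ* H) j = 0).card * W.card := by
          rw [add_mul, Finset.sum_mul]
      _ ≤ good.card * W.card + ∑ y ∈ Finset.univ.filter (fun y : Fin k → F => y ≠ 0), S.card :=
          Nat.add_le_add_left (Finset.sum_le_sum fun y hy =>
            card_mul_card_orthogonalWords_le (Finset.mem_filter.1 hy).2) _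
      _ ≤ good.card * W.card + q ^ k * S.card := by
          rw [Finset.sum_const, smul_eq_mul]
          refine Nat.add_le_add_left (Nat.mul_le_mul_right _ ?_) _
          refine (Finset.card_filter_le _ _).trans ?_
          simp [hq]
  have hSg : S.card ≤ 2 * good.card := by
    have hWpos : 0 < W.card := lt_of_lt_of_le (by positivity) hW2
    have h3 := Nat.mul_le_mul_right S.card hW2
    have : S.card * W.card ≤ 2 * good.card * W.card := by nlinarith
    exact Nat.le_of_mul_le_mul_right this hWpos
  calc q ^ (k * n) ≤ S.card * q ^ k := hS1
    _ ≤ 2 * good.card * q ^ k := Nat.mul_le_mul_right _ hSg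
    _ = 2 * q ^ k * good.card := by ring

end Counting

/-! ### Moments of sums of independent variables -/

section Moments

variable {α : Type*} [Fintype α] (w f : α → ℝ)

theorem sum_prod_weight_succ {n : ℕ} (Φ : (Fin (n + 1) → α) → ℝ) :
    ∑ x, (∏ i, w (x i)) * Φ x =
      ∑ a, w a * ∑ x : Fin n → α, (∏ i, w (x i)) * Φ (Fin.cons a x) := by
  rw [← (Fin.consEquiv fun _ : Fin (n + 1) => α).sum_comp, Fintype.sum_prod_type]
  refine Finset.sum_congr rfl fun a _ => ?_
  rw [Finset.mul_sum]
  refine Finset.sum_congr rfl fun x _ => ?_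
  change (∏ i, w ((Fin.cons a x : Fin (n + 1) → α) i)) * Φ (Fin.cons a x) = _
  rw [Fin.prod_univ_succ, mul_assoc]
  simp only [Fin.cons_zero, Fin.cons_succ]

variable {w f} (hw : ∑ a, w a = 1)

include hw

theorem sum_prod_weight (n : ℕ) : ∑ x : Fin n → α, ∏ i, w (x i) = 1 := by
  classical
  rw [← Fintype.piFinset_univ, ← Finset.prod_univ_sum (f := fun _ a => w a)]
  simp [hw]

variable (hf : ∑ a, w a * f a = 0)

include hf

theorem first_moment (n : ℕ) : ∑ x : Fin n → α, (∏ i, w (x i)) * ∑ i, f (x i) = 0 := by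
  induction n with
  | zero => simp
  | succ n ih =>
    rw [sum_prod_weight_succ]
    simp only [Fin.sum_univ_succ, Fin.cons_zero, Fin.cons_succ, mul_add, Finset.sum_add_distrib, ih,
      add_zero, ← Finset.sum_mul, sum_prod_weight hw, one_mul, hf]

theorem second_moment (n : ℕ) :
    ∑ x : Fin n → α, (∏ i, w (x i)) * (∑ i, f (x i)) ^ 2 = n * ∑ a, w a * f a ^ 2 := by
  induction n with
  | zero => simp
  | succ n ih =>
    rw [sum_prod_weight_succ]
    have e : ∀ a, ∑ x : Fin n → α, (∏ i, w (x i)) * (∑ i, f ((Fin.cons a x : Fin (n + 1) → α) i)) ^ 2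
        = f a ^ 2 + n * ∑ a, w a * f a ^ 2 := by
      intro a
      have : ∀ x : Fin n → α, (∏ i, w (x i)) * (∑ i, f ((Fin.cons a x : Fin (n + 1) → α) i)) ^ 2 =
          (∏ i, w (x i)) * f a ^ 2 + (2 * f a) * ((∏ i, w (x i)) * ∑ i, f (x i)) +
          (∏ i, w (x i)) * (∑ i, f (x i)) ^ 2 := by
        intro x
        simp only [Fin.sum_univ_succ, Fin.cons_zero, Fin.cons_succ]
        ring
      simp only [this, Finset.sum_add_distrib]
      rw [← Finset.sum_mul, ← Finset.mul_sum, first_moment hw hf, ih, sum_prod_weight hw]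
      ring
    simp only [e, mul_add, Finset.sum_add_distrib]
    rw [← Finset.sum_mul, hw]
    push_cast
    ring

/-- In the recursion the third moment of the partial sum appears only multiplied by the mean of `f`,
which is zero, so it need not be computed. -/
theorem fourth_moment (n : ℕ) :
    ∑ x : Fin n → α, (∏ i, w (x i)) * (∑ i, f (x i)) ^ 4 =
      n * ∑ a, w a * f a ^ 4 + 3 * n * (n - 1) * (∑ a, w a * f a ^ 2) ^ 2 := by
  induction n with
  | zero => simp
  | succ n ih =>
    rw [sum_prod_weight_succ]
    have e : ∀ a, w a * ∑ x : Fin n → α, (∏ i, w (x i)) *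
          (∑ i, f ((Fin.cons a x : Fin (n + 1) → α) i)) ^ 4
        = w a * f a ^ 4 + w a * f a ^ 2 * (6 * (n * ∑ a, w a * f a ^ 2)) +
          w a * f a * (4 * ∑ x : Fin n → α, (∏ i, w (x i)) * (∑ i, f (x i)) ^ 3) +
          w a * ∑ x : Fin n → α, (∏ i, w (x i)) * (∑ i, f (x i)) ^ 4 := by
      intro a
      have : ∀ x : Fin n → α, (∏ i, w (x i)) * (∑ i, f ((Fin.cons a x : Fin (n + 1) → α) i)) ^ 4 =
          (∏ i, w (x i)) * f a ^ 4 + (4 * f a ^ 3) * ((∏ i, w (x i)) * ∑ i, f (x i)) +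
          (6 * f a ^ 2) * ((∏ i, w (x i)) * (∑ i, f (x i)) ^ 2) +
          (4 * f a) * ((∏ i, w (x i)) * (∑ i, f (x i)) ^ 3) +
          (∏ i, w (x i)) * (∑ i, f (x i)) ^ 4 := by
        intro x
        simp only [Fin.sum_univ_succ, Fin.cons_zero, Fin.cons_succ]
        ring
      simp only [this, Finset.sum_add_distrib]
      rw [← Finset.sum_mul, ← Finset.mul_sum, ← Finset.mul_sum, ← Finset.mul_sum,
        first_moment hw hf, second_moment hw hf, sum_prod_weight hw]
      ring
    simp only [e, Finset.sum_add_distrib]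
    rw [← Finset.sum_mul, ← Finset.sum_mul, ← Finset.sum_mul, hw, hf, ih]
    push_cast
    ring

end Moments

/-! ### Lower bound for the probability that a sum stays below its mean -/

section Deviation

/-- For `x > 0` the quartic equals `-x (x - 2)² (x + 4) ≤ 0`, and for `x ≤ 0` it stays below `100`
before the division. For mean `0`, variance `1` and fourth moment at most `4`, its expectation is at
least `(12 - 4) / 100`. -/
theorem indicator_nonpos_ge (x : ℝ) :
    (12 * x ^ 2 - 16 * x - x ^ 4) / 100 ≤ if x ≤ 0 then 1 else 0 := by
  split_ifs with h
  · rw [div_le_one (by norm_num)]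
    nlinarith [sq_nonneg (x ^ 2 - 7), sq_nonneg (x + 2.8), sq_nonneg (x + 3)]
  · have hx : 0 < x := not_le.1 h
    have : 0 ≤ x * ((x - 2) ^ 2 * (x + 4)) := by positivity
    rw [div_le_iff₀ (by norm_num)]
    nlinarith

variable {α : Type*} [Fintype α] {w g h : α → ℝ} {τ p δ : ℝ} {n : ℕ}

theorem mul_one_sub_le_one (x : ℝ) : x * (1 - x) ≤ 1 := by
  nlinarith [sq_nonneg (x - 1 / 2)]

theorem centered_moments (hw0 : ∀ a, 0 ≤ w a) (hw : ∑ a, w a = 1) (hg : ∀ a, g a = 0 ∨ g a = 1)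
    (hτ : ∑ a, w a * g a = τ) (h0 : 0 ≤ τ) (h1 : τ ≤ 1) :
    ∑ a, w a * (g a - τ) = 0 ∧ ∑ a, w a * (g a - τ) ^ 2 = τ * (1 - τ) ∧
      ∑ a, w a * (g a - τ) ^ 4 ≤ τ * (1 - τ) := by
  have e2 : ∑ a, w a * (g a - τ) ^ 2 = τ * (1 - τ) := by
    have : ∀ a, w a * (g a - τ) ^ 2 = w a * g a * (1 - 2 * τ) + w a * τ ^ 2 := by
      intro a
      rcases hg a with h | h <;> rw [h] <;> ring
    simp only [this, Finset.sum_add_distrib]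
    rw [← Finset.sum_mul, ← Finset.sum_mul, hw, hτ]
    ring
  refine ⟨?_, e2, ?_⟩
  · simp only [mul_sub, Finset.sum_sub_distrib]
    rw [← Finset.sum_mul, hw, hτ]
    ring
  · rw [← e2]
    refine Finset.sum_le_sum fun a _ => mul_le_mul_of_nonneg_left ?_ (hw0 a)
    have : (g a - τ) ^ 2 ≤ 1 := by
      rcases hg a with h | h <;> rw [h] <;> nlinarith
    nlinarith [sq_nonneg (g a - τ)]

/-- Among `n` independent trials with success probability `τ`, the number of successes is positive
and at most `n τ` with constant probability, even together with an event of large probability. -/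
theorem sum_prod_weight_event_ge (hw0 : ∀ a, 0 ≤ w a) (hw : ∑ a, w a = 1)
    (hg : ∀ a, g a = 0 ∨ g a = 1) (hh : ∀ a, h a = 0 ∨ h a = 1)
    (hτ : ∑ a, w a * g a = τ) (hp : ∑ a, w a * h a = p) (h1 : τ ≤ 1) (hp0 : 0 ≤ p) (hp1 : p ≤ 1)
    (hδ : 0 < δ) (hδτ : δ ≤ τ) (hn : 200 ≤ δ ^ 2 * n) (hv : 1 ≤ n * (τ * (1 - τ)))
    {Φ : (Fin n → α) → ℝ} (hΦ0 : ∀ x, 0 ≤ Φ x)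
    (hΦ : ∀ x, ∑ i, g (x i) ≤ n * τ → 0 < ∑ i, g (x i) → n * (p - δ / 2) < ∑ i, h (x i) →
      1 ≤ Φ x) : 1 / 25 ≤ ∑ x, (∏ i, w (x i)) * Φ x := by
  obtain ⟨m1, m2, m4⟩ := centered_moments hw0 hw hg hτ (hδ.le.trans hδτ) h1
  obtain ⟨l1, l2, -⟩ := centered_moments hw0 hw hh hp hp0 hp1
  have hn0 : (0 : ℝ) < n := by
    by_contra hcon
    have := mul_nonpos_of_nonneg_of_nonpos (sq_nonneg δ) (not_lt.1 hcon)
    linarith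
  have hτ0 : 0 < τ := hδ.trans_le hδτ
  set V : ℝ := n * (τ * (1 - τ)) with hV
  set σ : ℝ := √V with hσ
  have hσ0 : 0 < σ := Real.sqrt_pos.2 (by linarith)
  have hσ2 : σ ^ 2 = V := Real.sq_sqrt (by linarith)
  set S : (Fin n → α) → ℝ := fun x => ∑ i, (g (x i) - τ) with hS
  set L : (Fin n → α) → ℝ := fun x => ∑ i, (h (x i) - p) with hL
  have hSx : ∀ x, S x = ∑ i, g (x i) - n * τ := fun x => by simp [hS]
  have hLx : ∀ x, L x = ∑ i, h (x i) - n * p := fun x => by simp [hL]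
  have hg0 : ∀ x : Fin n → α, 0 ≤ ∑ i, g (x i) := fun x =>
    Finset.sum_nonneg fun i _ => by rcases hg (x i) with h | h <;> simp [h]
  -- The quartic detects `S ≤ 0`. The two subtracted squares are the Chebyshev penalties for too few
  -- successes of `h` and for no success of `g` at all; each is at least `1` when its bad event
  -- occurs.
  have point : ∀ x, (12 * (S x / σ) ^ 2 - 16 * (S x / σ) - (S x / σ) ^ 4) / 100 -
      (L x / (n * (δ / 2))) ^ 2 - (S x / (n * τ)) ^ 2 ≤ Φ x := by
    intro x
    have b1 := indicator_nonpos_ge (S x / σ)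
    have b2 := sq_nonneg (L x / (n * (δ / 2)))
    have b3 := sq_nonneg (S x / (n * τ))
    have b4 := hΦ0 x
    by_cases c1 : S x / σ ≤ 0
    · rw [if_pos c1] at b1
      have c1' : S x ≤ 0 := by
        by_contra hcon
        exact absurd c1 (not_le.2 (div_pos (not_le.1 hcon) hσ0))
      by_cases c2 : 0 < ∑ i, g (x i)
      · by_cases c3 : n * (p - δ / 2) < ∑ i, h (x i)
        · have := hΦ x (by linarith [hSx x]) c2 c3
          linarith
        · have h3 : n * (δ / 2) ≤ -L x := by
            rw [hLx]
            linarith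
          have h4 : 1 ≤ (L x / (n * (δ / 2))) ^ 2 := by
            rw [← neg_sq, ← neg_div, one_le_sq_iff₀ (by
              apply div_nonneg _ (by positivity)
              exact le_trans (by positivity) h3), one_le_div (by positivity)]
            exact h3
          linarith
      · have h3 : S x = -(n * τ) := by
          rw [hSx, le_antisymm (not_lt.1 c2) (hg0 x)]
          ring
        have h4 : (S x / (n * τ)) ^ 2 = 1 := by
          rw [h3, neg_div, div_self (by positivity)]
          norm_num
        linarith
    · rw [if_neg c1] at b1
      linarith
  have hprod : ∀ x : Fin n → α, 0 ≤ ∏ i, w (x i) := fun x => Finset.prod_nonneg fun i _ => hw0 _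
  have M1 : ∑ x : Fin n → α, (∏ i, w (x i)) * S x = 0 := first_moment hw m1 n
  have M2 : ∑ x : Fin n → α, (∏ i, w (x i)) * S x ^ 2 = V := by
    rw [second_moment hw m1 n, m2]
  have L2 : ∑ x : Fin n → α, (∏ i, w (x i)) * L x ^ 2 = n * (p * (1 - p)) := by
    rw [second_moment hw l1 n, l2]
  have M4 : ∑ x : Fin n → α, (∏ i, w (x i)) * S x ^ 4 ≤ 4 * V ^ 2 := by
    rw [fourth_moment hw m1 n, m2]
    have h1 := mul_le_mul_of_nonneg_left m4 hn0.le
    have h2 : 3 * (n : ℝ) * (n - 1) * (τ * (1 - τ)) ^ 2 ≤ 3 * V ^ 2 := by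
      rw [hV, mul_pow]
      linarith [mul_nonneg hn0.le (sq_nonneg (τ * (1 - τ)))]
    -- The variance bound `1 ≤ V` absorbs the diagonal term of the fourth moment, which turns `3 V²
    -- + V` into `4 V²`.
    have h3 : V ≤ V ^ 2 := by
      rw [sq]
      exact le_mul_of_one_le_left (by linarith) hv
    linarith
  have lower : ∑ x : Fin n → α, (∏ i, w (x i)) *
      ((12 * (S x / σ) ^ 2 - 16 * (S x / σ) - (S x / σ) ^ 4) / 100 -
        (L x / (n * (δ / 2))) ^ 2 - (S x / (n * τ)) ^ 2) =
      (12 - (∑ x : Fin n → α, (∏ i, w (x i)) * S x ^ 4) / V ^ 2) / 100 -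
        n * (p * (1 - p)) / (n * (δ / 2)) ^ 2 - V / (n * τ) ^ 2 := by
    have e : ∀ x : Fin n → α, (∏ i, w (x i)) *
        ((12 * (S x / σ) ^ 2 - 16 * (S x / σ) - (S x / σ) ^ 4) / 100 -
          (L x / (n * (δ / 2))) ^ 2 - (S x / (n * τ)) ^ 2) =
        (12 / 100 / σ ^ 2 - 1 / (n * τ) ^ 2) * ((∏ i, w (x i)) * S x ^ 2) -
          16 / 100 / σ * ((∏ i, w (x i)) * S x) - 1 / 100 / σ ^ 4 * ((∏ i, w (x i)) * S x ^ 4) -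
          1 / (n * (δ / 2)) ^ 2 * ((∏ i, w (x i)) * L x ^ 2) := by
      intro x
      ring
    simp only [e, Finset.sum_sub_distrib]
    rw [← Finset.mul_sum, ← Finset.mul_sum, ← Finset.mul_sum, ← Finset.mul_sum, M1, M2, L2,
      show σ ^ 4 = V ^ 2 by rw [← hσ2]; ring, hσ2]
    field_simp
    ring
  have hle := Finset.sum_le_sum fun x (_ : x ∈ (Finset.univ : Finset (Fin n → α))) =>
    mul_le_mul_of_nonneg_left (point x) (hprod x)
  rw [lower] at hle
  refine le_trans ?_ hle
  have t1 : (∑ x : Fin n → α, (∏ i, w (x i)) * S x ^ 4) / V ^ 2 ≤ 4 := by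
    rw [div_le_iff₀ (by positivity)]
    exact M4
  have t2 : n * (p * (1 - p)) / (n * (δ / 2)) ^ 2 ≤ 1 / 50 := by
    rw [div_le_iff₀ (by positivity)]
    have a : p * (1 - p) ≤ 1 := mul_one_sub_le_one p
    rw [show 1 / 50 * (n * (δ / 2)) ^ 2 = n * (δ ^ 2 * n / 200) by ring]
    exact mul_le_mul_of_nonneg_left (by linarith) hn0.le
  have t3 : V / (n * τ) ^ 2 ≤ 1 / 200 := by
    rw [div_le_iff₀ (by positivity), hV]
    have : δ ^ 2 ≤ τ ^ 2 := by gcongr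
    have h2 : 200 ≤ τ ^ 2 * n := hn.trans (by gcongr)
    have a : τ * (1 - τ) ≤ 1 := mul_one_sub_le_one τ
    rw [show 1 / 200 * (n * τ) ^ 2 = n * (τ ^ 2 * n / 200) by ring]
    exact mul_le_mul_of_nonneg_left (by linarith) hn0.le
  -- The total is at least `8/100 - 1/50 - 1/200 = 11/200`, which exceeds `1/25`.
  linarith

end Deviation

/-! ### The success probability for the short codeword problem -/

section Success

variable {F : Type u} [Field F] [Fintype F] [DecidableEq F] {n k : ℕ} {ω : ℝ}

theorem condLaw_nonneg (G : Matrix (Fin k) (Fin n) F) (J : Finset (Fin n)) (z : Fin n → F) :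
    0 ≤ condLaw G J z := by
  unfold condLaw
  split_ifs <;> positivity

theorem subsetProb_nonneg {p : ℝ} (h0 : 0 ≤ p) (h1 : p ≤ 1) (J : Finset (Fin n)) :
    0 ≤ subsetProb p J :=
  Finset.prod_nonneg fun i _ => by split_ifs <;> linarith

variable (F) in
/-- A symbol is lost with probability `1 - p`, and uniform otherwise. -/
def symbolProb (p : ℝ) : Option F → ℝ
  | none => 1 - p
  | some _ => p / Fintype.card F

/-- The positions that are not lost. -/
def positions (x : Fin n → Option F) : Finset (Fin n) := Finset.univ.filter fun i => (x i).isSome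

/-- The word with the lost symbols replaced by zero. -/
def word (x : Fin n → Option F) : Fin n → F := fun i => (x i).getD 0

theorem word_eq_zero_of_notMem (x : Fin n → Option F) (i : Fin n) (hi : i ∉ positions x) :
    word x i = 0 := by
  have : x i = none := by simpa [positions] using hi
  simp [word, this]

/-- Lets a sum over symbol vectors be embedded in the sum over pairs of a position set and a word,
where the remaining terms are nonnegative. -/
theorem positions_word_injective :
    Function.Injective fun x : Fin n → Option F => (positions x, word x) := by
  intro x x' h
  simp only [Prod.mk.injEq] at h
  funext i
  have h1 : (x i).isSome = (x' i).isSome := by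
    have := Finset.ext_iff.1 h.1 i
    simp only [positions, Finset.mem_filter, Finset.mem_univ, true_and] at this
    exact Bool.eq_iff_iff.2 this
  have h2 : (x i).getD 0 = (x' i).getD 0 := congrFun h.2 i
  cases hx : x i <;> cases hx' : x' i <;> simp_all

theorem prod_symbolProb (p : ℝ) (x : Fin n → Option F) :
    ∏ i, symbolProb F p (x i) =
      subsetProb p (positions x) / (Fintype.card F : ℝ) ^ (positions x).card := by
  have e : ∀ i, symbolProb F p (x i) = (if i ∈ positions x then p else 1 - p) *
      if i ∈ positions x then (Fintype.card F : ℝ)⁻¹ else 1 := by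
    intro i
    cases hx : x i <;> simp [symbolProb, positions, hx, div_eq_mul_inv]
  simp only [e]
  rw [Finset.prod_mul_distrib, Finset.prod_ite_mem, Finset.univ_inter, Finset.prod_const, inv_pow,
    subsetProb, div_eq_mul_inv]

open scoped Classical in
theorem scpSuccess_regevProg (h0 : 0 ≤ ω) (h1 : ω ≤ ((Fintype.card F : ℝ) - 1) / Fintype.card F)
    (n k' : ℕ) (w : ℝ) :
    scpSuccess F ω regevProg n k' w = ∑ y : Finset (Fin n) × (Fin n → F),
      subsetProb (usdProb F ω) y.1 *
        ((∑ H : Matrix (Fin (n - k')) (Fin n) F,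
          if IsShortCodeword w H y.2 then condLaw H y.1 y.2 else 0) /
            (Fintype.card (Matrix (Fin (n - k')) (Fin n) F) : ℝ)) := by
  unfold scpSuccess
  have e : ∀ (H : Matrix (Fin (n - k')) (Fin n) F) (z : Fin n → F),
      (if IsShortCodeword w H z then outProb ω regevProg H z else 0) =
        ∑ J : Finset (Fin n), subsetProb (usdProb F ω) J *
          if IsShortCodeword w H z then condLaw H J z else 0 := by
    intro H z
    rw [outProb_regevProg h0 h1, outputLaw_eq h0 h1]
    split_ifs <;> simp
  simp only [e]
  rw [Fintype.sum_prod_type]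
  simp only [Finset.sum_div, Finset.mul_sum, mul_div_assoc]
  exact (Finset.sum_congr rfl fun H _ => Finset.sum_comm).trans
    (Finset.sum_comm.trans (Finset.sum_congr rfl fun J _ => Finset.sum_comm))

open scoped Classical in
/-- A uniformly random word, supported at sufficiently many positions, is in the code with
parity-check matrix `H`, and the columns of `H` at these positions have full rank, with the expected
probability up to a factor `2`. -/
theorem le_sum_condLaw {w : ℝ} {J : Finset (Fin n)} {z : Fin n → F} (hz : z ≠ 0)
    (hJ : ∀ i, i ∉ J → z i = 0) (hk : k + 2 ≤ J.card) (hw : (hammingNorm z : ℝ) ≤ w * n) :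
    1 / 2 / (Fintype.card F : ℝ) ^ J.card ≤
      (∑ H : Matrix (Fin k) (Fin n) F, if IsShortCodeword w H z then condLaw H J z else 0) /
        (Fintype.card (Matrix (Fin k) (Fin n) F) : ℝ) := by
  have hq := one_lt_card_real F
  have hq0 : (0 : ℝ) < Fintype.card F := by linarith
  have hcard : (Fintype.card (Matrix (Fin k) (Fin n) F) : ℝ) = (Fintype.card F : ℝ) ^ (k * n) := by
    have : Fintype.card (Matrix (Fin k) (Fin n) F) = Fintype.card (Fin k → Fin n → F) := rfl
    rw [this]
    simp [← pow_mul, mul_comm]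
  have hsum : (∑ H : Matrix (Fin k) (Fin n) F,
        if IsShortCodeword w H z then condLaw H J z else 0) =
      (Finset.univ.filter fun H : Matrix (Fin k) (Fin n) F =>
        H *ᵥ z = 0 ∧ (cols H J).rank = k).card *
        ((Fintype.card F : ℝ) ^ k / (Fintype.card F : ℝ) ^ J.card) := by
    rw [← nsmul_eq_mul, ← Finset.sum_const, Finset.sum_filter]
    refine Finset.sum_congr rfl fun H _ => ?_
    unfold condLaw IsShortCodeword
    by_cases h1 : H *ᵥ z = 0
    · by_cases h2 : (cols H J).rank = k
      · rw [if_pos ⟨hz, h1, hw⟩, if_pos h2, if_pos ⟨hJ, h1⟩, if_pos ⟨h1, h2⟩]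
      · simp [h1, h2, hz]
    · simp [h1]
  have hcount : (Fintype.card F : ℝ) ^ (k * n) ≤ 2 * (Fintype.card F : ℝ) ^ k *
      (Finset.univ.filter fun H : Matrix (Fin k) (Fin n) F =>
        H *ᵥ z = 0 ∧ (cols H J).rank = k).card := by
    exact_mod_cast card_le_card_rank_eq (k := k) hz hJ hk
  rw [hsum, hcard, le_div_iff₀ (by positivity), div_mul_eq_mul_div, mul_div_assoc',
    div_le_div_iff_of_pos_right (by positivity)]
  linarith

-- Only pairs with the word supported in `J` are kept. The factor `q ^ (-|J|)` from `le_sum_condLaw`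
-- is the uniform law on such words, and together with `subsetProb` it is the product law
-- `symbolProb`.
open scoped Classical in
theorem le_scpSuccess_regevProg (h0 : 0 ≤ ω)
    (h1 : ω ≤ ((Fintype.card F : ℝ) - 1) / Fintype.card F) (n k' : ℕ) (w : ℝ) :
    1 / 2 * ∑ x : Fin n → Option F, (∏ i, symbolProb F (usdProb F ω) (x i)) *
      (if n - k' + 2 ≤ (positions x).card ∧ word x ≠ 0 ∧ (hammingNorm (word x) : ℝ) ≤ w * n
        then 1 else 0) ≤ scpSuccess F ω regevProg n k' w := by
  rw [scpSuccess_regevProg h0 h1]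
  set f : Finset (Fin n) × (Fin n → F) → ℝ := fun y => subsetProb (usdProb F ω) y.1 *
        ((∑ H : Matrix (Fin (n - k')) (Fin n) F,
          if IsShortCodeword w H y.2 then condLaw H y.1 y.2 else 0) /
            (Fintype.card (Matrix (Fin (n - k')) (Fin n) F) : ℝ)) with hf
  have hs := fun J : Finset (Fin n) => subsetProb_nonneg usdProb_nonneg (usdProb_le_one h0 h1) J
  have hf0 : ∀ y, 0 ≤ f y := fun y => mul_nonneg (hs _) (div_nonneg (Finset.sum_nonneg fun H _ => by
    split_ifs
    · exact condLaw_nonneg _ _ _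
    · exact le_rfl) (by positivity))
  refine le_trans ?_ (Finset.sum_le_sum_of_subset_of_nonneg
    (Finset.subset_univ (Finset.univ.image fun x : Fin n → Option F => (positions x, word x)))
    fun y _ _ => hf0 y)
  rw [Finset.sum_image fun x _ x' _ h => positions_word_injective h, Finset.mul_sum]
  refine Finset.sum_le_sum fun x _ => ?_
  split_ifs with h
  · rw [prod_symbolProb]
    refine le_trans (le_of_eq ?_) (mul_le_mul_of_nonneg_left
      (le_sum_condLaw h.2.1 (word_eq_zero_of_notMem x) h.1 h.2.2) (hs _))
    ring
  · rw [mul_zero, mul_zero]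
    exact hf0 (positions x, word x)

theorem sum_symbolProb_isSome (p : ℝ) :
    ∑ a : Option F, symbolProb F p a * (if a.isSome then 1 else 0) = p := by
  have hq := one_lt_card_real F
  rw [Fintype.sum_option]
  simp only [symbolProb, Option.isSome_none, Option.isSome_some, if_true, mul_one, Finset.sum_const,
    Finset.card_univ, nsmul_eq_mul]
  field_simp
  simp

theorem sum_symbolProb (p : ℝ) : ∑ a : Option F, symbolProb F p a = 1 := by
  have hq := one_lt_card_real F
  rw [Fintype.sum_option]
  simp only [symbolProb, Finset.sum_const, Finset.card_univ, nsmul_eq_mul]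
  field_simp
  ring

theorem sum_symbolProb_ne_zero (p : ℝ) :
    ∑ a : Option F, symbolProb F p a * (if a.getD 0 ≠ 0 then 1 else 0) =
      ((Fintype.card F : ℝ) - 1) * p / Fintype.card F := by
  have hq := one_lt_card_real F
  rw [Fintype.sum_option]
  simp only [symbolProb, Option.getD_none, Option.getD_some, ne_eq, not_true_eq_false, if_false,
    mul_zero, zero_add]
  rw [← Finset.mul_sum, Finset.sum_boole, Finset.filter_ne', Finset.card_erase_of_mem
    (Finset.mem_univ _), Finset.card_univ, Nat.cast_sub Fintype.card_pos, Nat.cast_one]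
  ring

theorem regevProg_success_ge {w δ τ : ℝ} (hw : w < 1) (hδ : 0 < δ) {n k' : ℕ}
    (hn1 : 200 ≤ δ ^ 2 * n) (hn2 : 1 ≤ δ * (1 - w) * n) (hn3 : 4 ≤ δ * n) (hk : k' ≤ n)
    (hτ : τ = min w (((Fintype.card F : ℝ) - 1) / Fintype.card F))
    (h : ((Fintype.card F : ℝ) - 1) * ((n : ℝ) - k') / (Fintype.card F * n) + δ ≤ τ) :
    1 / 50 ≤ scpSuccess F (perp F τ) regevProg n k' w := by
  classical
  have hq := one_lt_card_real F
  set q : ℝ := (Fintype.card F : ℝ) with hqdef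
  have hkR : (k' : ℝ) ≤ n := by exact_mod_cast hk
  have hn0 : (0 : ℝ) < n := by
    by_contra hcon
    have := mul_nonpos_of_nonneg_of_nonpos hδ.le (not_lt.1 hcon)
    linarith
  have hτw : τ ≤ w := hτ ▸ min_le_left _ _
  have hτq : τ ≤ (q - 1) / q := hτ ▸ min_le_right _ _
  have hδτ : δ ≤ τ := by
    have : 0 ≤ (q - 1) * ((n : ℝ) - k') / (q * n) :=
      div_nonneg (mul_nonneg (by linarith) (by linarith)) (by positivity)
    linarith
  have hτ0 : 0 ≤ τ := hδ.le.trans hδτ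
  have hτ1 : τ < 1 := hτw.trans_lt hw
  have hω0 : 0 ≤ perp F τ := perp_nonneg F τ
  have hω1 : perp F τ ≤ (q - 1) / q := perp_le hτ0 hτq
  set p := usdProb F (perp F τ) with hp
  have hpτ : p = q * τ / (q - 1) := by
    rw [hp, usdProb, perp_perp hτ0 hτq]
  -- The hypothesis is multiplied by `q n / (q - 1)`; the slack `δ` only grows, since `q / (q - 1) ≥
  -- 1`.
  have hpn : (n : ℝ) - k' + δ * n ≤ n * p := by
    have h2 : (q - 1) * ((n : ℝ) - k') + δ * (q * n) ≤ τ * (q * n) := by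
      have := mul_le_mul_of_nonneg_right h (show 0 ≤ q * n by positivity)
      rwa [add_mul, div_mul_cancel₀ _ (by positivity)] at this
    rw [hpτ, mul_div_assoc', le_div_iff₀ (by linarith)]
    nlinarith [mul_pos hδ hn0]
  have hcard : ∀ x : Fin n → Option F, ∑ i, (if (x i).isSome then (1 : ℝ) else 0) =
      (positions x).card := fun x => by rw [Finset.sum_boole]; rfl
  have hnorm : ∀ x : Fin n → Option F, ∑ i, (if (x i).getD 0 ≠ 0 then (1 : ℝ) else 0) =
      hammingNorm (word x) := fun x => by rw [Finset.sum_boole]; rfl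
  have key := sum_prod_weight_event_ge (α := Option F) (w := symbolProb F p)
    (g := fun a => if a.getD 0 ≠ 0 then 1 else 0) (h := fun a => if a.isSome then 1 else 0)
    (τ := τ) (p := p) (δ := δ) (n := n) ?_ (sum_symbolProb p) ?_ ?_ ?_ (sum_symbolProb_isSome p)
    hτ1.le usdProb_nonneg (usdProb_le_one hω0 hω1) hδ hδτ hn1 ?_
    (Φ := fun x => if n - k' + 2 ≤ (positions x).card ∧ word x ≠ 0 ∧
      (hammingNorm (word x) : ℝ) ≤ w * n then 1 else 0) ?_ ?_
  · have := le_scpSuccess_regevProg hω0 hω1 n k' w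
    linarith
  · rintro (_ | a)
    · exact sub_nonneg.2 (usdProb_le_one hω0 hω1)
    · exact div_nonneg usdProb_nonneg (by positivity)
  · intro a
    split_ifs <;> simp
  · intro a
    split_ifs <;> simp
  · rw [sum_symbolProb_ne_zero, hpτ, ← hqdef]
    have : q - 1 ≠ 0 := by linarith
    field_simp
  -- The weight has variance at least `1`: `τ` stays away from `0` by `δ` and away from `1` because
  -- `τ ≤ w`.
  · have h1 : δ * (1 - w) ≤ τ * (1 - τ) :=
      mul_le_mul hδτ (by linarith) (by linarith) hτ0
    nlinarith
  · intro x
    split_ifs <;> norm_num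
  · intro x hx1 hx2 hx3
    rw [hnorm] at hx1 hx2
    rw [hcard] at hx3
    rw [if_pos]
    refine ⟨?_, ?_, ?_⟩
    -- The mean exceeds `n - k'` by at least `δ n`, half of which is given up to the deviation; `δ n
    -- / 2 ≥ 2` covers the two extra positions needed for the rank.
    · have h2 : ((n - k' : ℕ) : ℝ) + 1 < (positions x).card := by
        rw [Nat.cast_sub hk]
        linarith
      have h3 : n - k' + 1 < (positions x).card := by exact_mod_cast h2
      omega
    · rw [← hammingNorm_pos_iff]
      exact_mod_cast hx2
    · nlinarith

end Success

end RegevUSD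

end

theorem mainTheorem4 :
    ∃ (prog : RegevUSD.Cmd) (P : Polynomial ℕ),
      -- `prog` performs the reduction, in polynomial time
      (∀ (F : Type*) [Field F] [Fintype F] [DecidableEq F] (ω : ℝ) (n k : ℕ)
          (G : Matrix (Fin k) (Fin n) F),
          0 ≤ ω → ω ≤ ((Fintype.card F : ℝ) - 1) / Fintype.card F → k ≤ n →
          RegevUSD.HaltsWithin ω prog G (P.eval n) ∧
          (∀ z : Fin n → F, RegevUSD.outProb ω prog G z = RegevUSD.outputLaw ω G z) ∧
          ∑ z : Fin n → F, RegevUSD.outputLaw ω G z = 1) ∧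
      -- and it solves the short codeword problem with constant probability
      (∀ (ω' δ : ℝ), 0 < ω' → ω' < 1 → 0 < δ → ∃ c : ℝ, 0 < c ∧ ∃ N : ℕ,
        ∀ (F : Type*) [Field F] [Fintype F] [DecidableEq F] (n k' : ℕ) (τ : ℝ),
          N ≤ n → k' ≤ n →
          τ = min ω' (((Fintype.card F : ℝ) - 1) / Fintype.card F) →
          ((Fintype.card F : ℝ) - 1) * ((n : ℝ) - k') / (Fintype.card F * n) + δ ≤ τ →
          c ≤ RegevUSD.scpSuccess F (RegevUSD.perp F τ) prog n k' ω') := by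
  refine ⟨RegevUSD.regevProg, RegevUSD.costPoly RegevUSD.regevProg, ?_, ?_⟩
  · intro F _ _ _ ω n k G h0 h1 hk
    exact ⟨RegevUSD.haltsWithin_regevProg ω hk G, RegevUSD.outProb_regevProg h0 h1 G,
      RegevUSD.sum_outputLaw h0 h1 G⟩
  · intro ω' δ _ hω' hδ
    have hω : 0 < δ * (1 - ω') := mul_pos hδ (by linarith)
    -- `1/50` is half of the `1/25` of the deviation bound. The three summands of `N` secure the
    -- Chebyshev estimates, variance at least `1`, and the two spare positions, in this order.
    refine ⟨1 / 50, by norm_num,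
      ⌈200 / δ ^ 2⌉₊ + ⌈1 / (δ * (1 - ω'))⌉₊ + ⌈4 / δ⌉₊, ?_⟩
    intro F _ _ _ n k' τ hN hk hτ h
    have large : ∀ {a b : ℝ}, 0 < b → ⌈a / b⌉₊ ≤ n → a ≤ b * n := by
      intro a b hb hab
      have := Nat.ceil_le.1 hab
      rwa [div_le_iff₀' hb] at this
    exact RegevUSD.regevProg_success_ge hω' hδ (large (by positivity) (by omega))
      (large hω (by omega)) (large hδ (by omega)) hk hτ h
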